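/- Setting. Two-dimensional strings are partial functions $S:\mathbb{Z}^2\rightharpoonup\Sigma$ with domain $\mathrm{dom}(S)$, where $\Sigma$ consists of integers that fit in a machine word; $(S+u)(v)=S(v-u)$ is the shift, and $\mathrm{Ham}(S,R)$ is the number of $u\in\mathrm{dom}(S)\cap\mathrm{dom}(R)$ with $S(u)\neq R(u)$. Write $[m]=\{0,\dots,m-1\}$ and $u\times v=u.x\,v.y-u.y\,v.x$. Let $k\ge 1$, let $P$ be a pattern with domain $[m]^2$ and $T$ a text with domain $[n]^2$, where $m\ge 1$, $n$ is even and $m\le n\le\frac32 m$. Let $Q$ be a set of $q\in\mathbb{Z}^2$ with $\mathrm{dom}(P+q)\subseteq\mathrm{dom}(T)$ such that $Q$ contains every such $q$ with $\mathrm{Ham}(T,P+q)\le k$, every $q\in Q$ satisfies $\mathrm{Ham}(T,P+q)\le 2k$, and $|Q|>8m+m^2/k$. Let $\phi,\psi\in\mathbb{Z}^2$ be differences of elements of $Q$ with $\psi\in(0,\infty)\times[0,\infty)$, $\phi\in[0,\infty)\times(-\infty,0)$, $|\psi||\phi|\le C_0\,(n-m)^2/|Q|$ for a fixed constant $C_0$,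 and $\sin\alpha\ge\frac12$ for the angle $\alpha$ between $\psi$ and $\phi$. A tile is a set $\{u\in\mathbb{Z}^2:\phi_0\le\phi\times u\le\phi_1,\ \psi_0\le\psi\times u\le\psi_1\}$ with $\phi_0,\phi_1,\psi_0,\psi_1\in\mathbb{Z}$. A subtile is the set of all points $u$ of a tile with $u-\gamma\in\{s\phi+t\psi:s,t\in\mathbb{Z}\}$, for some fixed $\gamma\in\mathbb{Z}^2$. A string is a subtile string if its domain is a subtile, and monochromatic if all its characters are equal to one character. The active text $T_{\mathbf a}$ is the restriction of $T$ to $\bigcup_{q\in Q}\mathrm{dom}(P+q)$. A string is $d$-peripheral if every point of its domain has Euclidean distance at most $d$ from $\mathbb{Z}^2\setminus\mathrm{dom}(T_{\mathbf a})$. A string is partitioned into strings if its domain is the disjoint union of their domains and each of them agrees with it on its own domain. Theorem. For every $C_0$ there are constants $C,c$ and one word-RAM program with the following property. For all $m,n,k,P,T,Q,\phi,\psi$ as above and every integer $\ell\ge 1$, given these data (strings as lists of point-character pairs) on a machine with words of $w\ge c\log_2(n+k+\ell)$ bits, the program halts after at most $C\,(m^2+\ell^2+\ell k)\,(1+\lfloor\log_2(m^2+\ell^2+\ell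 k)\rfloor)^{c}$ steps, i.e. in time $\tilde{\mathcal O}(m^2+\ell^2+\ell k)$. It outputs a partition of $T_{\mathbf a}$ into at most $C\ell k$ monochromatic subtile strings and one $(C m/\ell)$-peripheral string. -/

import Mathlib

/-! ### Points of the integer plane -/

/-- A point (or vector) of the integer plane; `u.1` is the `x`-coordinate, `u.2` the
`y`-coordinate. -/
abbrev Point := ℤ × ℤ

/-- The Euclidean length of a vector. -/
noncomputable def Point.len (u : Point) : ℝ := Real.sqrt ((u.1 : ℝ) ^ 2 + (u.2 : ℝ) ^ 2)

/-- The cross product `u × v = u.x * v.y - u.y * v.x`, that is `|u| |v| sin α` for the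
(oriented) angle `α` from `u` to `v`. -/
def Point.cross (u v : Point) : ℤ := u.1 * v.2 - u.2 * v.1

/-- The square `[m] × [m]` where `[m] = {0, …, m - 1}`. -/
def square (m : ℕ) : Set Point := {u | (0 ≤ u.1 ∧ u.1 < m) ∧ (0 ≤ u.2 ∧ u.2 < m)}

/-! ### Two-dimensional strings -/

/-- A two-dimensional string: a partial function from the integer plane to the characters,
which are integers. -/
abbrev Str := Point → Option ℤ

namespace Str

/-- The domain of a string. -/
def dom (S : Str) : Set Point := {u | ∃ a, S u = some a}

/-- The shifted string `S + u`. -/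
def shift (S : Str) (u : Point) : Str := fun v => S (v - u)

open Classical in
/-- The restriction of a string to a set of points. -/
noncomputable def restrict (S : Str) (U : Set Point) : Str := fun u => if u ∈ U then S u else none

/-- The set of mismatches between two strings. -/
def mismatches (S R : Str) : Set Point := {u | u ∈ S.dom ∧ u ∈ R.dom ∧ S u ≠ R u}

/-- The Hamming distance: the number of mismatches. -/
noncomputable def ham (S R : Str) : ℕ := (mismatches S R).ncard

/-- All characters of the string are equal to one single character. -/
def IsMonochromatic (S : Str) : Prop := ∃ a : ℤ, ∀ u ∈ S.dom, S u = some a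

/-- `S` is partitioned into the strings of the list `Rs`: the domain of `S` is the disjoint union
of their domains, and on its domain each of them agrees with `S`. -/
def IsPartitionedInto (S : Str) (Rs : List Str) : Prop :=
  (∀ u, u ∈ S.dom ↔ ∃ R ∈ Rs, u ∈ R.dom) ∧
  Rs.Pairwise (fun R R' => Disjoint R.dom R'.dom) ∧
  ∀ R ∈ Rs, ∀ u ∈ R.dom, R u = S u

/-- The active text: the restriction of the text `T` to the union of the domains of the
strings `P + q`, `q ∈ Q`. -/
noncomputable def activeText (P T : Str) (Q : Finset Point) : Str :=
  T.restrict (⋃ q ∈ Q, (P.shift q).dom)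

/-- Every character of the string is an integer that fits in a (signed) word of `w` bits. -/
def FitsWord (S : Str) (w : ℕ) : Prop :=
  ∀ u a, S u = some a → -(2 : ℤ) ^ w ≤ 2 * a ∧ 2 * a < (2 : ℤ) ^ w

end Str

/-! ### Tiles, subtiles, peripherality -/

/-- A tile with respect to `φ` and `ψ`: the integer points of a parallelogram with sides
parallel to `φ` and `ψ`. -/
def IsTile (φ ψ : Point) (U : Set Point) : Prop :=
  ∃ φ₀ φ₁ ψ₀ ψ₁ : ℤ,
    U = {u | (φ₀ ≤ φ.cross u ∧ φ.cross u ≤ φ₁) ∧ (ψ₀ ≤ ψ.cross u ∧ ψ.cross u ≤ ψ₁)}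

/-- Two points are congruent if they differ by a vector of the lattice spanned by `φ`, `ψ`. -/
def LatticeCongruent (φ ψ u v : Point) : Prop := ∃ s t : ℤ, u - v = s • φ + t • ψ

/-- A subtile: the points of a tile that are congruent to one fixed point. -/
def IsSubtile (φ ψ : Point) (V : Set Point) : Prop :=
  ∃ U, IsTile φ ψ U ∧ ∃ γ : Point, V = {u | u ∈ U ∧ LatticeCongruent φ ψ u γ}

/-- A string whose domain is a subtile. -/
def Str.IsSubtileString (φ ψ : Point) (S : Str) : Prop := IsSubtile φ ψ S.dom

/-- The distance from `u` to the complement of `D` in the integer plane. -/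
noncomputable def borderDist (D : Set Point) (u : Point) : ℝ :=
  sInf {d : ℝ | ∃ v : Point, v ∉ D ∧ d = (u - v).len}

/-- A string is `d`-peripheral (for the active text `Ta`) if all points of its domain have
distance at most `d` from the complement of the domain of `Ta`. -/
def Str.IsPeripheral (Ta : Str) (d : ℝ) (S : Str) : Prop :=
  ∀ u ∈ S.dom, borderDist Ta.dom u ≤ d

/-! ### The standing assumptions -/

/-- The pattern `P` is `m × m`, the text `T` is `n × n` with `n` even and `m ≤ n ≤ 3m/2`; the set
`Q` of candidate positions contains all `k`-mismatch occurrences of `P` in `T`, consists of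
`2k`-mismatch occurrences, and is large. -/
structure Candidates (m n k : ℕ) (P T : Str) (Q : Finset Point) : Prop where
  m_pos : 0 < m
  k_pos : 0 < k
  m_le : m ≤ n
  n_le : 2 * n ≤ 3 * m
  n_even : Even n
  dom_pattern : P.dom = square m
  dom_text : T.dom = square n
  complete : ∀ q : Point, (P.shift q).dom ⊆ T.dom → T.ham (P.shift q) ≤ k → q ∈ Q
  valid : ∀ q ∈ Q, (P.shift q).dom ⊆ T.dom
  sound : ∀ q ∈ Q, T.ham (P.shift q) ≤ 2 * k
  large : 8 * (m : ℝ) + (m : ℝ) ^ 2 / k < (Q.card : ℝ)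

/-- The two vectors `φ`, `ψ` are differences of candidate positions, lie in neighbouring
quadrants, have a small product of lengths (with constant `C₀`), and the sine of the angle between
them is at least `1/2`. -/
structure BasisPair (C₀ : ℝ) (m n : ℕ) (Q : Finset Point) (φ ψ : Point) : Prop where
  psi_diff : ∃ u ∈ Q, ∃ v ∈ Q, ψ = u - v
  phi_diff : ∃ u ∈ Q, ∃ v ∈ Q, φ = u - v
  psi_quadrant : 0 < ψ.1 ∧ 0 ≤ ψ.2
  phi_quadrant : 0 ≤ φ.1 ∧ φ.2 < 0
  len_mul_len : ψ.len * φ.len ≤ C₀ * (((n : ℝ) - m) ^ 2 / Q.card)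
  sin_angle : 1 / 2 ≤ |(ψ.cross φ : ℝ)| / (ψ.len * φ.len)

/-! ### The word RAM

A word RAM with words of `w` bits: a memory of `2 ^ w` words that is addressed by words, a bounded
number of registers per program (named by natural numbers), and the usual unit-cost operations on
words. Programs are written with structured control flow; one program serves all word sizes. -/

/-- The unit-cost operations on words. Arithmetic is modulo `2 ^ w`. Comparisons return `1` or `0`;
`ult` compares unsigned numbers, `slt` two's complement signed numbers. -/
inductive WordOp where
  | add | sub | mul | udiv | umod | sdiv | and | or | xor | shl | shr | eq | ult | slt

/-- The result of an operation. -/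
def WordOp.eval {w : ℕ} : WordOp → BitVec w → BitVec w → BitVec w
  | .add, a, b => a + b
  | .sub, a, b => a - b
  | .mul, a, b => a * b
  | .udiv, a, b => a / b
  | .umod, a, b => a % b
  | .sdiv, a, b => a.sdiv b
  | .and, a, b => a &&& b
  | .or, a, b => a ||| b
  | .xor, a, b => a ^^^ b
  | .shl, a, b => a <<< b
  | .shr, a, b => a >>> b
  | .eq, a, b => if a = b then 1 else 0
  | .ult, a, b => if a.ult b then 1 else 0
  | .slt, a, b => if a.slt b then 1 else 0

/-- The state of the machine: registers and memory. -/
structure RamState (w : ℕ) where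
  reg : ℕ → BitVec w
  mem : BitVec w → BitVec w

/-- Expressions: constants, registers, memory cells, operations. -/
inductive RamExpr where
  | lit (a : ℤ)
  | reg (x : ℕ)
  | load (address : RamExpr)
  | op (o : WordOp) (e f : RamExpr)

/-- The value of an expression. -/
def RamExpr.eval {w : ℕ} (s : RamState w) : RamExpr → BitVec w
  | .lit a => BitVec.ofInt w a
  | .reg x => s.reg x
  | .load e => s.mem (e.eval s)
  | .op o e f => o.eval (e.eval s) (f.eval s)

/-- The time to evaluate an expression: one step for each constant, register access, memory access
and operation. -/
def RamExpr.cost : RamExpr → ℕ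
  | .lit _ => 1
  | .reg _ => 1
  | .load e => e.cost + 1
  | .op _ e f => e.cost + f.cost + 1

/-- Programs. Conditions are true if they evaluate to a non-zero word. -/
inductive RamProg where
  | skip
  | assign (x : ℕ) (e : RamExpr)
  | store (address e : RamExpr)
  | seq (p q : RamProg)
  | cond (e : RamExpr) (p q : RamProg)
  | loop (e : RamExpr) (p : RamProg)

/-- `RamExec p s t s'`: started in the state `s`, the program `p` halts after exactly `t` steps in
the state `s'`. -/
inductive RamExec {w : ℕ} : RamProg → RamState w → ℕ → RamState w → Prop where
  | skip (s : RamState w) : RamExec .skip s 1 s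
  | assign (x : ℕ) (e : RamExpr) (s : RamState w) :
      RamExec (.assign x e) s (e.cost + 1) { s with reg := Function.update s.reg x (e.eval s) }
  | store (a e : RamExpr) (s : RamState w) :
      RamExec (.store a e) s (a.cost + e.cost + 1)
        { s with mem := Function.update s.mem (a.eval s) (e.eval s) }
  | seq {p q : RamProg} {s s' s'' : RamState w} {t t' : ℕ} :
      RamExec p s t s' → RamExec q s' t' s'' → RamExec (.seq p q) s (t + t') s''
  | cond_true {e : RamExpr} {p q : RamProg} {s s' : RamState w} {t : ℕ} :
      e.eval s ≠ 0 → RamExec p s t s' → RamExec (.cond e p q) s (e.cost + 1 + t) s'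
  | cond_false {e : RamExpr} {p q : RamProg} {s s' : RamState w} {t : ℕ} :
      e.eval s = 0 → RamExec q s t s' → RamExec (.cond e p q) s (e.cost + 1 + t) s'
  | loop_true {e : RamExpr} {p : RamProg} {s s' s'' : RamState w} {t t' : ℕ} :
      e.eval s ≠ 0 → RamExec p s t s' → RamExec (.loop e p) s' t' s'' →
      RamExec (.loop e p) s (e.cost + 1 + t + t') s''
  | loop_false {e : RamExpr} {p : RamProg} {s : RamState w} :
      e.eval s = 0 → RamExec (.loop e p) s (e.cost + 1) s

/-- The initial state: the input is written at the addresses `0, 1, 2, …`, everything else is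
zero. -/
def RamState.init {w : ℕ} (input : List (BitVec w)) : RamState w where
  reg := fun _ => 0
  mem := fun a => input[a.toNat]?.getD 0

/-- In the state `s`, the memory contains the list `output`, starting at the address that
register `0` holds. -/
def RamState.HasOutput {w : ℕ} (s : RamState w) (output : List (BitVec w)) : Prop :=
  (s.reg 0).toNat + output.length ≤ 2 ^ w ∧
  ∀ i (h : i < output.length), s.mem (s.reg 0 + BitVec.ofNat w i) = output[i]

/-! ### Representation of the objects in memory -/

/-- A list of point-character pairs represents a string (in any order, without repetitions). -/
def Represents (L : List (Point × ℤ)) (S : Str) : Prop :=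
  L.Nodup ∧ ∀ u a, (u, a) ∈ L ↔ S u = some a

/-- The words of a point. -/
def pointWords (w : ℕ) (u : Point) : List (BitVec w) := [BitVec.ofInt w u.1, BitVec.ofInt w u.2]

/-- The words of a list of point-character pairs, preceded by its length. -/
def stringWords (w : ℕ) (L : List (Point × ℤ)) : List (BitVec w) :=
  BitVec.ofNat w L.length :: L.flatMap (fun p => pointWords w p.1 ++ [BitVec.ofInt w p.2])

/-- The words of a list of points, preceded by its length. -/
def pointListWords (w : ℕ) (L : List Point) : List (BitVec w) :=
  BitVec.ofNat w L.length :: L.flatMap (pointWords w)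

/-- The words of a list of strings, preceded by their number. -/
def stringListWords (w : ℕ) (Ls : List (List (Point × ℤ))) : List (BitVec w) :=
  BitVec.ofNat w Ls.length :: Ls.flatMap (stringWords w)

/-- The input of the partitioning algorithm: the numbers `m`, `n`, `k`, `l`, the vectors `φ`, `ψ`,
the pattern, the text, and the candidate positions. -/
def inputWords (w m n k l : ℕ) (φ ψ : Point) (LP LT : List (Point × ℤ)) (LQ : List Point) :
    List (BitVec w) :=
  [BitVec.ofNat w m, BitVec.ofNat w n, BitVec.ofNat w k, BitVec.ofNat w l] ++
    pointWords w φ ++ pointWords w ψ ++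
    stringWords w LP ++ stringWords w LT ++ pointListWords w LQ

/-! The vectors φ and ψ are approximate periods of the text. If δ = q₁ - q₂ with q₁, q₂ in `Q`,
comparing the text with the pattern placed at q, q₁ and q₂ shows that in each square `P + q`, q in
`Q`, at most 8k points u have T(u - δ) ≠ T(u) (`Candidates.exists_period_mismatches`). Along the
lattice spanned by φ and ψ the text is therefore nearly constant, and each lattice class can be cut
into maximal lattice rectangles of one character. The difficulty is the irregular boundary of the
active text.

Blocks. Every lattice class is cut into blocks of a × b lattice points that stay within 2W of a
reference point in each coordinate, where W = ⌊m/(16ℓ)⌋. A block is kept if all its points stay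
active under horizontal shifts by ±2W. The active points of the other blocks are within O(W) of the
complement and form the peripheral string (`Inst.Valid.exists_near`). Kept blocks get a label 1, …,
4, the quadrant of their reference point.

Quadrants. Since n ≤ 3m/2, all squares share a large central part, so within a quadrant a point that
is closer to the centre in both coordinates than an active point is itself active
(`Inst.Act.of_between`). The vector ψ points outward in one of the quadrants 1, 4 and inward in the
other; φ does the same for 2 and 3. With rows along ψ in quadrants 1 and 4 and along φ in 2 and 3,
every lattice row meets a label in one contiguous segment (`Inst.Frame.lab_between`).

Counting. A run is a maximal stretch of one label and one character in the row direction ρ;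
consecutive parallel runs of the same label, character and length are stacked in the other direction
τ, and a piece is a maximal stack. If a piece starts at u, then its run starts at a mismatch inside
the label, or u begins the label's segment in the first row of a row of blocks, or u and u - τ carry
different characters, or the runs at u and u - τ have different lengths, in which case the shorter
one ends at a mismatch (`IsRunTable.card_starts_le`). The second case occurs at most once per label,
lattice class and row of blocks. The number of classes is at most the determinant D, which is O(k)
because |Q| > m²/k (`BasisPair.D_le`), and there are O(ℓ) rows of blocks because sin α ≥ 1/2
(`Inst.block_large`). For the other cases, the relevant points of a quadrant are covered by O(ℓ)
squares: the x-axis is cut into bands of width W + 1, and for each band the candidate that reaches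
farthest outward vertically suffices (`Inst.exists_cover`). The margin 2W pays for rounding to bands
and for one step τ. This gives O(ℓ)·8k mismatches and O(ℓk) pieces altogether.

Algorithm. Activity, bad blocks, labels, run lengths and stack heights are tables on a grid of side
5n, each filled by a constant number of sweeps. Sweeping with x decreasing and, within a column, y
increasing, the points u + φ and u + ψ come before u, so the recursions for runs and stacks need one
sweep each. The total time is O(n²) = O(m²), within the claimed bound, and of the pattern only its
length is read. The machine is handled through a small command language with integer values:
loop-free commands by weakest preconditions (`GCmd.runs_of_wp`), loops by invariants
(`GCmd.Runs.loop`, `GCmd.runs_grid`), the whole program by `Ctx.runs_main`. -/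

/-! ### A structured view of the word RAM

The memory is split into a read-only input, a grid of records with eight fields, and an
append-only output list. Values are integers; the word-level state is obtained by reduction. -/

/-- The memory layout: the input ends at `base`, the grid has side `side`. -/
structure Layout where
  base : ℕ
  side : ℕ
  input : ℕ → ℤ

/-- The address at which the output begins. -/
def Layout.outBase (L : Layout) : ℕ := L.base + 8 * (L.side * L.side)

/-- The structured state. -/
structure GState where
  reg : ℕ → ℤ
  fld : ℕ → Point → ℤ
  out : List ℤ

/-- The content of a memory cell. -/
def GState.cell (L : Layout) (s : GState) (a : ℕ) : ℤ :=
  if a < L.base then L.input a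
  else if a < L.outBase then
    s.fld ((a - L.base) % 8)
      ((((a - L.base) / 8 / L.side : ℕ) : ℤ), (((a - L.base) / 8 % L.side : ℕ) : ℤ))
  else s.out.getD (a - L.outBase) 0

/-- The registers of the machine: four are reserved. -/
def GState.machineReg (L : Layout) (s : GState) : ℕ → ℤ
  | 0 => 0
  | 1 => L.base
  | 2 => L.side
  | 3 => (L.outBase + s.out.length : ℕ)
  | x + 4 => s.reg x

/-- The word-level state that a structured state describes. -/
def GState.conc (w : ℕ) (L : Layout) (s : GState) : RamState w where
  reg := fun x => BitVec.ofInt w (s.machineReg L x)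
  mem := fun a => BitVec.ofInt w (s.cell L a.toNat)

/-- Expressions over structured states. -/
inductive GExpr where
  | lit (a : ℤ)
  | reg (x : ℕ)
  | op (o : WordOp) (e f : GExpr)
  | get (f : ℕ) (ex ey : GExpr)
  | inp (e : GExpr)

namespace GExpr

/-- The address of a field of a grid record. -/
def address (f : ℕ) (ex ey : RamExpr) : RamExpr :=
  .op .add (.reg 1) (.op .add (.op .mul (.lit 8) (.op .add (.op .mul ex (.reg 2)) ey)) (.lit f))

/-- Compilation to machine expressions. -/
def comp : GExpr → RamExpr
  | lit a => .lit a
  | reg x => .reg (x + 4)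
  | op o e f => .op o e.comp f.comp
  | get f ex ey => .load (address f ex.comp ey.comp)
  | inp e => .load e.comp

/-- Integer semantics of the supported operations. -/
def opVal : WordOp → ℤ → ℤ → ℤ
  | .add, a, b => a + b
  | .sub, a, b => a - b
  | .mul, a, b => a * b
  | .udiv, a, b => a / b
  | .umod, a, b => a % b
  | .eq, a, b => if a = b then 1 else 0
  | .slt, a, b => if a < b then 1 else 0
  | _, _, _ => 0

/-- The value of an expression. -/
def val (L : Layout) (s : GState) : GExpr → ℤ
  | lit a => a
  | reg x => s.reg x
  | op o e f => opVal o (e.val L s) (f.val L s)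
  | get f ex ey => s.fld f (ex.val L s, ey.val L s)
  | inp e => L.input (e.val L s).toNat

/-- `v` is representable as a signed word. -/
def InRange (w : ℕ) (v : ℤ) : Prop := -(2 : ℤ) ^ w ≤ 2 * v ∧ 2 * v < (2 : ℤ) ^ w

/-- Side conditions under which word operations agree with integer operations. -/
def opOk (w : ℕ) : WordOp → ℤ → ℤ → Prop
  | .add, _, _ => True
  | .sub, _, _ => True
  | .mul, _, _ => True
  | .udiv, a, b => (0 ≤ a ∧ InRange w a) ∧ (0 ≤ b ∧ InRange w b)
  | .umod, a, b => (0 ≤ a ∧ InRange w a) ∧ (0 ≤ b ∧ InRange w b)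
  | .eq, a, b => InRange w a ∧ InRange w b
  | .slt, a, b => InRange w a ∧ InRange w b
  | _, _, _ => False

/-- Side conditions under which the compiled expression has the intended value. -/
def ok (w : ℕ) (L : Layout) (s : GState) : GExpr → Prop
  | lit _ => True
  | reg _ => True
  | op o e f => e.ok w L s ∧ f.ok w L s ∧ opOk w o (e.val L s) (f.val L s)
  | get f ex ey => f < 8 ∧ ex.ok w L s ∧ ey.ok w L s ∧
      (0 ≤ ex.val L s ∧ ex.val L s < L.side) ∧ (0 ≤ ey.val L s ∧ ey.val L s < L.side)
  | inp e => e.ok w L s ∧ 0 ≤ e.val L s ∧ e.val L s < L.base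

/-! ### Integer arithmetic versus word arithmetic. -/

theorem toNat_ofInt_of_lt {w : ℕ} {v : ℤ} (h0 : 0 ≤ v) (h : v < (2 : ℤ) ^ w) :
    (BitVec.ofInt w v).toNat = v.toNat := by
  rw [BitVec.toNat_ofInt]
  congr 1
  apply Int.emod_eq_of_lt h0
  exact_mod_cast h

theorem toInt_ofInt_of_inRange {w : ℕ} {v : ℤ} (h : InRange w v) :
    (BitVec.ofInt w v).toInt = v := by
  rw [BitVec.toInt_ofInt]
  obtain ⟨h1, h2⟩ := h
  apply Int.bmod_eq_of_le_mul_two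
  · push_cast; linarith
  · push_cast; linarith

theorem ofInt_injOn {w : ℕ} {u v : ℤ} (hu : InRange w u) (hv : InRange w v) :
    BitVec.ofInt w u = BitVec.ofInt w v ↔ u = v := by
  constructor
  · intro h
    rw [← toInt_ofInt_of_inRange hu, h, toInt_ofInt_of_inRange hv]
  · rintro rfl; rfl

theorem ofInt_sub (w : ℕ) (x y : ℤ) :
    BitVec.ofInt w (x - y) = BitVec.ofInt w x - BitVec.ofInt w y := by
  rw [sub_eq_add_neg, BitVec.ofInt_add, BitVec.ofInt_neg, BitVec.sub_eq_add_neg]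

/-- Addition, subtraction and multiplication commute with reduction modulo `2 ^ w`, so range
conditions are needed only for quotients, remainders and comparisons. -/
theorem opVal_spec {w : ℕ} (o : WordOp) (a b : ℤ) (h : opOk w o a b) :
    o.eval (BitVec.ofInt w a) (BitVec.ofInt w b) = BitVec.ofInt w (opVal o a b) := by
  have lt_of : ∀ v : ℤ, 0 ≤ v → InRange w v → v < (2 : ℤ) ^ w := fun v h0 h => by
    have := h.2; linarith
  cases o <;> simp only [opOk] at h <;> try exact h.elim
  · simp [WordOp.eval, opVal, BitVec.ofInt_add]
  · simp [WordOp.eval, opVal, ofInt_sub]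
  · simp [WordOp.eval, opVal, BitVec.ofInt_mul]
  · obtain ⟨⟨ha, ha'⟩, hb, hb'⟩ := h
    apply BitVec.eq_of_toNat_eq
    simp only [WordOp.eval, opVal]
    have hq : a / b ≤ a := Int.ediv_le_self _ ha
    have := lt_of a ha ha'
    rw [BitVec.toNat_udiv, toNat_ofInt_of_lt ha (lt_of a ha ha'),
      toNat_ofInt_of_lt hb (lt_of b hb hb'),
      toNat_ofInt_of_lt (Int.ediv_nonneg ha hb) (by linarith)]
    obtain ⟨x, rfl⟩ := Int.eq_ofNat_of_zero_le ha
    obtain ⟨y, rfl⟩ := Int.eq_ofNat_of_zero_le hb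
    rfl
  · obtain ⟨⟨ha, ha'⟩, hb, hb'⟩ := h
    apply BitVec.eq_of_toNat_eq
    simp only [WordOp.eval, opVal]
    have hm : 0 ≤ a % b ∧ a % b ≤ a := by
      obtain ⟨x, rfl⟩ := Int.eq_ofNat_of_zero_le ha
      obtain ⟨y, rfl⟩ := Int.eq_ofNat_of_zero_le hb
      exact ⟨Int.natCast_nonneg (x % y), by exact_mod_cast Nat.mod_le x y⟩
    obtain ⟨h0, hq⟩ := hm
    have := lt_of a ha ha'
    rw [BitVec.toNat_umod, toNat_ofInt_of_lt ha (lt_of a ha ha'),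
      toNat_ofInt_of_lt hb (lt_of b hb hb'),
      toNat_ofInt_of_lt h0 (by linarith)]
    exact (Int.toNat_emod ha hb).symm
  · simp only [WordOp.eval, opVal, ofInt_injOn h.1 h.2]
    split_ifs <;> simp
  · simp only [WordOp.eval, opVal, BitVec.slt_iff_toInt_lt, toInt_ofInt_of_inRange h.1,
      toInt_ofInt_of_inRange h.2]
    split_ifs <;> simp

theorem address_eval {w : ℕ} {L : Layout} (s : GState) (f : ℕ) {ex ey : RamExpr} {x y : ℤ}
    (hx : ex.eval (s.conc w L) = BitVec.ofInt w x)
    (hy : ey.eval (s.conc w L) = BitVec.ofInt w y) :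
    (address f ex ey).eval (s.conc w L) =
      BitVec.ofInt w (L.base + (8 * (x * L.side + y) + f)) := by
  simp only [address, RamExpr.eval, hx, hy, WordOp.eval, BitVec.ofInt_add, BitVec.ofInt_mul]
  rfl

theorem address_bound {L : Layout} {f : ℕ} (hf : f < 8) {x y : ℤ}
    (hx : 0 ≤ x ∧ x < L.side) (hy : 0 ≤ y ∧ y < L.side) :
    (L.base : ℤ) ≤ L.base + (8 * (x * L.side + y) + f) ∧
      (L.base + (8 * (x * L.side + y) + f) : ℤ) < L.outBase := by
  have h1 : 0 ≤ x * L.side := mul_nonneg hx.1 (by positivity)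
  have h2 : (x + 1) * L.side ≤ (L.side : ℤ) * L.side :=
    mul_le_mul_of_nonneg_right (by omega) (by positivity)
  have hf' : (f : ℤ) < 8 := by exact_mod_cast hf
  unfold Layout.outBase
  push_cast
  constructor <;> nlinarith

/-- An address is a mixed-radix numeral with digits `x`, `y`, `f`; the bounds on the digits make the
decoding by division and remainder exact. -/
theorem cell_address {L : Layout} (s : GState) {f : ℕ} (hf : f < 8) {x y : ℤ}
    (hx : 0 ≤ x ∧ x < L.side) (hy : 0 ≤ y ∧ y < L.side) :
    s.cell L (L.base + (8 * (x * L.side + y) + f) : ℤ).toNat = s.fld f (x, y) := by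
  obtain ⟨h1, h2⟩ := address_bound hf hx hy
  obtain ⟨x, rfl⟩ := Int.eq_ofNat_of_zero_le hx.1
  obtain ⟨y, rfl⟩ := Int.eq_ofNat_of_zero_le hy.1
  have hy' : y < L.side := by exact_mod_cast hy.2
  have e : (L.base + (8 * ((x : ℤ) * L.side + y) + f) : ℤ).toNat
      = L.base + (8 * (x * L.side + y) + f) := by
    have : (L.base + (8 * ((x : ℤ) * L.side + y) + f) : ℤ)
      = ((L.base + (8 * (x * L.side + y) + f) : ℕ) : ℤ) := by push_cast; rfl
    rw [this]; rfl
  have h3 : L.base + (8 * (x * L.side + y) + f) < L.outBase := by exact_mod_cast h2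
  rw [e]
  unfold GState.cell
  rw [if_neg (by omega), if_pos h3]
  have e1 : L.base + (8 * (x * L.side + y) + f) - L.base = 8 * (x * L.side + y) + f := by omega
  have e2 : (8 * (x * L.side + y) + f) / 8 = x * L.side + y := by omega
  have e3 : (8 * (x * L.side + y) + f) % 8 = f := by omega
  rw [e1, e2, e3, Nat.add_comm, Nat.add_mul_div_right _ _ (by omega), Nat.div_eq_of_lt hy',
    Nat.add_mul_mod_self_right, Nat.mod_eq_of_lt hy']
  simp

theorem comp_eval {w : ℕ} {L : Layout} (hL : (L.outBase : ℤ) ≤ 2 ^ w) (s : GState) :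
    ∀ e : GExpr, e.ok w L s → e.comp.eval (s.conc w L) = BitVec.ofInt w (e.val L s)
  | lit a, _ => rfl
  | reg x, _ => rfl
  | op o e f, h => by
      simp only [comp, RamExpr.eval, val]
      rw [comp_eval hL s e h.1, comp_eval hL s f h.2.1, opVal_spec _ _ _ h.2.2]
  | get f ex ey, h => by
      obtain ⟨hf, hx, hy, hbx, hby⟩ := h
      obtain ⟨h1, h2⟩ := address_bound hf hbx hby
      simp only [comp, RamExpr.eval, val]
      rw [address_eval s f (comp_eval hL s ex hx) (comp_eval hL s ey hy)]
      simp only [GState.conc]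
      rw [toNat_ofInt_of_lt (le_trans (by positivity) h1) (lt_of_lt_of_le h2 hL),
        cell_address s hf hbx hby]
  | inp e, h => by
      obtain ⟨he, h0, h1⟩ := h
      simp only [comp, RamExpr.eval, val]
      rw [comp_eval hL s e he]
      simp only [GState.conc]
      have : (L.base : ℤ) ≤ L.outBase := by
        unfold Layout.outBase; push_cast; nlinarith [mul_self_nonneg (L.side : ℤ)]
      rw [toNat_ofInt_of_lt h0 (by linarith)]
      unfold GState.cell
      rw [if_pos (by omega)]

end GExpr

/-- Commands over structured states. -/
inductive GCmd where
  | set (x : ℕ) (e : GExpr)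
  | put (f : ℕ) (ex ey e : GExpr)
  | emit (e : GExpr)
  | patch (i e : GExpr)
  | seq (c d : GCmd)
  | ite (e : GExpr) (c d : GCmd)
  | loop (x : ℕ) (e : GExpr) (c : GCmd)

/-- Assignment to a register of a structured state. -/
def GState.setReg (s : GState) (x : ℕ) (v : ℤ) : GState :=
  { s with reg := Function.update s.reg x v }

/-- Assignment to a field of a grid record. -/
def GState.putFld (s : GState) (f : ℕ) (p : Point) (v : ℤ) : GState :=
  { s with fld := Function.update s.fld f (Function.update (s.fld f) p v) }

/-- Appending a value to the output. -/
def GState.emitVal (s : GState) (v : ℤ) : GState := { s with out := s.out ++ [v] }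

/-- Overwriting a value of the output. -/
def GState.patchVal (s : GState) (i : ℕ) (v : ℤ) : GState := { s with out := s.out.set i v }

/-! ### Compilation of commands, and rules for their effect and running time. -/

namespace GCmd

/-- The address of an output cell. -/
def outAddress (e : RamExpr) : RamExpr :=
  .op .add (.reg 1) (.op .add (.op .mul (.lit 8) (.op .mul (.reg 2) (.reg 2))) e)

/-- Compilation to machine programs. -/
def comp : GCmd → RamProg
  | set x e => .assign (x + 4) e.comp
  | put f ex ey e => .store (GExpr.address f ex.comp ey.comp) e.comp
  | emit e => .seq (.store (.reg 3) e.comp) (.assign 3 (.op .add (.reg 3) (.lit 1)))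
  | patch i e => .store (outAddress i.comp) e.comp
  | seq c d => .seq c.comp d.comp
  | ite e c d => .cond e.comp c.comp d.comp
  | loop x e c => .seq (.assign (x + 4) (.lit 0))
      (.loop (.op .slt (.reg (x + 4)) e.comp)
        (.seq c.comp (.assign (x + 4) (.op .add (.reg (x + 4)) (.lit 1)))))

/-- `c.Runs w L T s Q`: started in `s`, the compiled command halts within `T` steps in a state that
satisfies `Q`. -/
def Runs (w : ℕ) (L : Layout) (c : GCmd) (T : ℕ) (s : GState) (Q : GState → Prop) : Prop :=
  ∃ t s', RamExec c.comp (s.conc w L) t (s'.conc w L) ∧ t ≤ T ∧ Q s'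

theorem Runs.mono {w : ℕ} {L : Layout} {c : GCmd} {T T' : ℕ} {s : GState} {Q Q' : GState → Prop}
    (h : c.Runs w L T s Q) (hT : T ≤ T') (hQ : ∀ s', Q s' → Q' s') : c.Runs w L T' s Q' := by
  obtain ⟨t, s', h1, h2, h3⟩ := h
  exact ⟨t, s', h1, h2.trans hT, hQ _ h3⟩

theorem Runs.seq {w : ℕ} {L : Layout} {c d : GCmd} {T T' : ℕ} {s : GState} {Q R : GState → Prop}
    (h : c.Runs w L T s Q) (h' : ∀ s', Q s' → d.Runs w L T' s' R) :
    (GCmd.seq c d).Runs w L (T + T') s R := by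
  obtain ⟨t, s', h1, h2, h3⟩ := h
  obtain ⟨t', s'', h1', h2', h3'⟩ := h' s' h3
  exact ⟨t + t', s'', .seq h1 h1', by omega, h3'⟩

theorem conc_setReg (w : ℕ) (L : Layout) (s : GState) (x : ℕ) (v : ℤ) :
    (s.setReg x v).conc w L =
      { s.conc w L with
        reg := Function.update (s.conc w L).reg (x + 4) (BitVec.ofInt w v) } := by
  have h : ∀ y, ((s.setReg x v).conc w L).reg y =
      Function.update (s.conc w L).reg (x + 4) (BitVec.ofInt w v) y := by
    intro y
    match y with
    | 0 => simp [Function.update, GState.conc, GState.machineReg]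
    | 1 => simp [Function.update, GState.conc, GState.machineReg]
    | 2 => simp [Function.update, GState.conc, GState.machineReg]
    | 3 => simp [Function.update, GState.conc, GState.machineReg, GState.setReg]
    | y + 4 =>
      by_cases h : y = x
      · subst h; simp [GState.conc, GState.machineReg, GState.setReg]
      · simp [GState.conc, GState.machineReg, GState.setReg, Function.update, h]
  show RamState.mk _ _ = RamState.mk _ _
  congr 1
  exact funext h

theorem ofInt_eq_iff_toNat {w : ℕ} {v : ℤ} (h0 : 0 ≤ v) (h : v < (2 : ℤ) ^ w) (a : BitVec w) :
    a = BitVec.ofInt w v ↔ a.toNat = v.toNat := by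
  rw [← BitVec.toNat_inj, GExpr.toNat_ofInt_of_lt h0 h]

theorem mem_update {w : ℕ} {L : Layout} {s s' : GState} {v c : ℤ} (h0 : 0 ≤ v)
    (h : v < (2 : ℤ) ^ w)
    (hcell : ∀ a : ℕ, s'.cell L a = if a = v.toNat then c else s.cell L a) :
    (s'.conc w L).mem =
      Function.update (s.conc w L).mem (BitVec.ofInt w v) (BitVec.ofInt w c) := by
  funext a
  simp only [GState.conc, Function.update_apply, ofInt_eq_iff_toNat h0 h, hcell]
  split_ifs <;> rfl

theorem conc_putFld {w : ℕ} {L : Layout} (hL : (L.outBase : ℤ) ≤ 2 ^ w) (s : GState) {f : ℕ}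
    (hf : f < 8) {x y : ℤ} (hx : 0 ≤ x ∧ x < L.side) (hy : 0 ≤ y ∧ y < L.side) (v : ℤ) :
    (s.putFld f (x, y) v).conc w L =
      { s.conc w L with
        mem := Function.update (s.conc w L).mem
          (BitVec.ofInt w (L.base + (8 * (x * L.side + y) + f))) (BitVec.ofInt w v) } := by
  obtain ⟨h1, h2⟩ := GExpr.address_bound hf hx hy
  show RamState.mk _ _ = RamState.mk _ _
  congr 1
  refine mem_update (le_trans (by positivity) h1) (lt_of_lt_of_le h2 hL) fun a => ?_
  split_ifs with ha
  · rw [ha, GExpr.cell_address _ hf hx hy]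
    simp [GState.putFld]
  · unfold GState.cell
    split_ifs with h3 h4
    · rfl
    · simp only [GState.putFld]
      by_cases h5 : (a - L.base) % 8 = f
      swap
      · rw [Function.update_of_ne h5]
      rw [h5, Function.update_self]
      by_cases h6 : ((((a - L.base) / 8 / L.side : ℕ) : ℤ),
          (((a - L.base) / 8 % L.side : ℕ) : ℤ)) = (x, y)
      swap
      · rw [Function.update_of_ne h6]
      -- If the field and the point both coincide, reassembling the digits of `a` yields the written
      -- address, against `ha`.
      · exfalso
        apply ha
        rw [Prod.mk.injEq] at h6
        have e1 := Nat.div_add_mod ((a - L.base) / 8) L.side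
        have e2 := Nat.div_add_mod (a - L.base) 8
        rw [← h6.1, ← h6.2, ← h5]
        have e3 : (((L.base : ℤ) + (8 * ((((a - L.base) / 8 / L.side : ℕ) : ℤ) * L.side +
            (((a - L.base) / 8 % L.side : ℕ) : ℤ)) + (((a - L.base) % 8 : ℕ) : ℤ))))
            = ((a : ℕ) : ℤ) := by
          have : (((a - L.base) / 8 / L.side : ℕ) : ℤ) * L.side +
            (((a - L.base) / 8 % L.side : ℕ) : ℤ) = (((a - L.base) / 8 : ℕ) : ℤ) := by
            rw [mul_comm]; exact_mod_cast e1
          rw [this]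
          omega
        rw [e3]; rfl
    · rfl

/-- Cells beyond the output decode to the default value 0 both before and after, so appending
changes exactly one memory cell. -/
theorem conc_emitVal {w : ℕ} {L : Layout} (s : GState)
    (h : (L.outBase + s.out.length + 1 : ℤ) ≤ 2 ^ w) (v : ℤ) :
    (s.emitVal v).conc w L =
      ⟨Function.update (s.conc w L).reg 3 (BitVec.ofInt w (L.outBase + s.out.length : ℕ) + BitVec.ofInt w 1),
        Function.update (s.conc w L).mem
          (BitVec.ofInt w (L.outBase + s.out.length : ℕ)) (BitVec.ofInt w v)⟩ := by
  show RamState.mk _ _ = RamState.mk _ _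
  congr 1
  · funext y
    match y with
    | 0 => simp [Function.update, GState.conc, GState.machineReg]
    | 1 => simp [Function.update, GState.conc, GState.machineReg]
    | 2 => simp [Function.update, GState.conc, GState.machineReg]
    | 3 =>
      simp only [GState.machineReg, GState.emitVal, List.length_append, List.length_singleton,
        Function.update_self]
      rw [← Nat.add_assoc]
      push_cast
      rw [BitVec.ofInt_add]
    | y + 4 => simp [GState.conc, GState.machineReg, GState.emitVal, Function.update]
  · refine mem_update (by positivity) (by push_cast; linarith) fun a => ?_
    simp only [Int.toNat_natCast]
    have hb : L.base ≤ L.outBase := Nat.le_add_right _ _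
    unfold GState.cell
    simp only [GState.emitVal]
    by_cases h1 : a < L.base
    · rw [if_pos h1, if_neg (by omega), if_pos h1]
    by_cases h2 : a < L.outBase
    · rw [if_neg h1, if_pos h2, if_neg (by omega), if_neg h1, if_pos h2]
    rw [if_neg h1, if_neg h2, if_neg h1, if_neg h2]
    split_ifs with h3
    · have : a - L.outBase = s.out.length := by omega
      rw [this]; simp
    · rcases lt_or_ge (a - L.outBase) s.out.length with h4 | h4
      · simp [List.getD, List.getElem?_append_left h4]
      · have h5 : s.out.length + 1 ≤ a - L.outBase := by omega
        simp [List.getD, List.getElem?_eq_none h4, List.getElem?_eq_none, h5]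

theorem conc_patchVal {w : ℕ} {L : Layout} (s : GState)
    (h : (L.outBase + s.out.length : ℤ) ≤ 2 ^ w) {i : ℕ} (hi : i < s.out.length) (v : ℤ) :
    (s.patchVal i v).conc w L =
      { s.conc w L with
        mem := Function.update (s.conc w L).mem
          (BitVec.ofInt w (L.outBase + i : ℕ)) (BitVec.ofInt w v) } := by
  show RamState.mk _ _ = RamState.mk _ _
  congr 1
  · funext y
    match y with
    | 0 => rfl
    | 1 => rfl
    | 2 => rfl
    | 3 => simp [GState.conc, GState.machineReg, GState.patchVal]
    | y + 4 => rfl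
  · refine mem_update (by positivity) (by push_cast; omega) fun a => ?_
    simp only [Int.toNat_natCast]
    have hb : L.base ≤ L.outBase := Nat.le_add_right _ _
    unfold GState.cell
    simp only [GState.patchVal]
    by_cases h1 : a < L.base
    · rw [if_pos h1, if_neg (by omega), if_pos h1]
    by_cases h2 : a < L.outBase
    · rw [if_neg h1, if_pos h2, if_neg (by omega), if_neg h1, if_pos h2]
    rw [if_neg h1, if_neg h2, if_neg h1, if_neg h2]
    split_ifs with h3
    · have : a - L.outBase = i := by omega
      rw [this]; simp [List.getD, hi]
    · have : i ≠ a - L.outBase := by omega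
      simp [List.getD, List.getElem?_set_ne this]

/-- The number of steps of a loop-free command, at most. -/
def maxTime : GCmd → ℕ
  | set _ e => e.comp.cost + 1
  | put f ex ey e => (GExpr.address f ex.comp ey.comp).cost + e.comp.cost + 1
  | emit e => e.comp.cost + 6
  | patch i e => (outAddress i.comp).cost + e.comp.cost + 1
  | seq c d => c.maxTime + d.maxTime
  | ite e c d => e.comp.cost + 1 + (c.maxTime + d.maxTime)
  | loop _ _ _ => 0

/-- Weakest preconditions of loop-free commands. -/
def wp (w : ℕ) (L : Layout) : GCmd → (GState → Prop) → GState → Prop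
  | set x e, Q, s => e.ok w L s ∧ Q (s.setReg x (e.val L s))
  | put f ex ey e, Q, s => (GExpr.get f ex ey).ok w L s ∧ e.ok w L s ∧
      Q (s.putFld f (ex.val L s, ey.val L s) (e.val L s))
  | emit e, Q, s => e.ok w L s ∧ (L.outBase + s.out.length + 1 : ℤ) ≤ 2 ^ w ∧
      Q (s.emitVal (e.val L s))
  | patch i e, Q, s => i.ok w L s ∧ e.ok w L s ∧ (L.outBase + s.out.length : ℤ) ≤ 2 ^ w ∧
      (0 ≤ i.val L s ∧ (i.val L s) < s.out.length) ∧ Q (s.patchVal (i.val L s).toNat (e.val L s))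
  | seq c d, Q, s => wp w L c (fun s' => wp w L d Q s') s
  | ite e c d, Q, s => e.ok w L s ∧ GExpr.InRange w (e.val L s) ∧
      (e.val L s ≠ 0 → wp w L c Q s) ∧ (e.val L s = 0 → wp w L d Q s)
  | loop _ _ _, _, _ => False

/-- The range condition excludes non-zero multiples of `2 ^ w`, which the machine would take for
false. -/
theorem eval_ne_zero {w : ℕ} {L : Layout} (hL : (L.outBase : ℤ) ≤ 2 ^ w) (s : GState)
    (e : GExpr) (he : e.ok w L s) (hr : GExpr.InRange w (e.val L s)) :
    e.comp.eval (s.conc w L) = 0 ↔ e.val L s = 0 := by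
  have h0 : GExpr.InRange w 0 := by
    have : (0 : ℤ) < 2 ^ w := by positivity
    exact ⟨by linarith, by linarith⟩
  rw [GExpr.comp_eval hL s e he, ← GExpr.ofInt_injOn hr h0]
  simp

/-- Structural recursion with one execution rule per clause; loops are excluded because their
precondition is `False`. -/
theorem runs_of_wp {w : ℕ} {L : Layout} (hL : (L.outBase : ℤ) ≤ 2 ^ w) :
    ∀ (c : GCmd) (Q : GState → Prop) (s : GState), c.wp w L Q s → c.Runs w L c.maxTime s Q
  | set x e, Q, s, h => by
      refine ⟨_, s.setReg x (e.val L s), ?_, le_rfl, h.2⟩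
      rw [conc_setReg, ← GExpr.comp_eval hL s e h.1]
      exact .assign _ _ _
  | put f ex ey e, Q, s, h => by
      obtain ⟨⟨hf, hx, hy, hbx, hby⟩, he, hQ⟩ := h
      refine ⟨_, s.putFld f (ex.val L s, ey.val L s) (e.val L s), ?_, le_rfl, hQ⟩
      rw [conc_putFld hL s hf hbx hby, ← GExpr.comp_eval hL s e he,
        ← GExpr.address_eval s f (GExpr.comp_eval hL s ex hx) (GExpr.comp_eval hL s ey hy)]
      exact .store _ _ _
  | emit e, Q, s, h => by
      obtain ⟨he, hb, hQ⟩ := h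
      refine ⟨(1 + e.comp.cost + 1) + (3 + 1), s.emitVal (e.val L s), ?_, ?_, hQ⟩
      · rw [conc_emitVal s hb, ← GExpr.comp_eval hL s e he]
        exact .seq (.store _ _ _) (.assign _ _ _)
      · simp only [maxTime]; omega
  | patch i e, Q, s, h => by
      obtain ⟨hi, he, hb, ⟨h0, h1⟩, hQ⟩ := h
      refine ⟨_, s.patchVal (i.val L s).toNat (e.val L s), ?_, le_rfl, hQ⟩
      have : (outAddress i.comp).eval (s.conc w L) =
          BitVec.ofInt w (L.outBase + (i.val L s).toNat : ℕ) := by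
        simp only [outAddress, RamExpr.eval, WordOp.eval, GExpr.comp_eval hL s i hi]
        simp only [GState.conc, GState.machineReg, Layout.outBase]
        push_cast
        rw [Int.toNat_of_nonneg h0]
        simp only [BitVec.ofInt_add, BitVec.ofInt_mul, BitVec.add_assoc]
      rw [conc_patchVal s hb (by omega), ← GExpr.comp_eval hL s e he, ← this]
      exact .store _ _ _
  | seq c d, Q, s, h =>
      Runs.seq (runs_of_wp hL c _ s h) fun s' hs' => runs_of_wp hL d Q s' hs'
  | ite e c d, Q, s, h => by
      obtain ⟨he, hr, h1, h2⟩ := h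
      by_cases hv : e.val L s = 0
      · obtain ⟨t, s', h3, h4, h5⟩ := runs_of_wp hL d Q s (h2 hv)
        exact ⟨_, s', .cond_false ((eval_ne_zero hL s e he hr).2 hv) h3,
          by simp only [maxTime]; omega, h5⟩
      · obtain ⟨t, s', h3, h4, h5⟩ := runs_of_wp hL c Q s (h1 hv)
        exact ⟨_, s', .cond_true (fun h => hv ((eval_ne_zero hL s e he hr).1 h)) h3,
          by simp only [maxTime]; omega, h5⟩

/-- A counting loop with the invariant `I`. -/
theorem Runs.loop {w : ℕ} {L : Layout} (hL : (L.outBase : ℤ) ≤ 2 ^ w) {x : ℕ} {e : GExpr}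
    {c : GCmd} {N : ℕ} (hN : GExpr.InRange w N) (T : ℕ → ℕ) (I : ℕ → GState → Prop) {s : GState}
    (h0 : I 0 (s.setReg x 0))
    (hreg : ∀ i s', I i s' → s'.reg x = i)
    (he : ∀ i s', i ≤ N → I i s' → e.ok w L s' ∧ e.val L s' = N)
    (hc : ∀ i s', i < N → I i s' →
      c.Runs w L (T i) s' fun s'' => s''.reg x = i ∧ I (i + 1) (s''.setReg x (i + 1))) :
    (GCmd.loop x e c).Runs w L
      ((∑ i ∈ Finset.range N, (T i + (e.comp.cost + 7))) + (e.comp.cost + 5)) s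
      fun s' => I N s' := by
  -- Induction on the number `j` of remaining iterations.
  have key : ∀ j i s', i + j = N → I i s' → ∃ t s'',
      RamExec (.loop (.op .slt (.reg (x + 4)) e.comp)
        (.seq c.comp (.assign (x + 4) (.op .add (.reg (x + 4)) (.lit 1)))))
        (s'.conc w L) t (s''.conc w L) ∧
      t ≤ (∑ i ∈ Finset.Ico i N, (T i + (e.comp.cost + 7))) + (e.comp.cost + 3) ∧ I N s'' := by
    intro j
    induction j with
    | zero =>
      intro i s' hij hI
      obtain rfl : i = N := by omega
      obtain ⟨he1, he2⟩ := he i s' le_rfl hI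
      have hr := hreg i s' hI
      have hv : (GExpr.op .slt (.reg x) e).ok w L s' := by
        refine ⟨trivial, he1, ?_, ?_⟩
        · simpa [GExpr.val, hr] using hN
        · simpa [he2] using hN
      refine ⟨_, s', .loop_false ?_, ?_, hI⟩
      · have := GExpr.comp_eval hL s' _ hv
        simp only [GExpr.comp] at this
        rw [this]
        simp [GExpr.val, GExpr.opVal, hr, he2]
      · simp [RamExpr.cost]; omega
    | succ j ih =>
      intro i s' hij hI
      obtain ⟨he1, he2⟩ := he i s' (by omega) hI
      have hr := hreg i s' hI
      have hiN : (i : ℤ) < N := by omega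
      have hir : GExpr.InRange w i := by
        have := hN.1
        have := hN.2
        constructor
        · have : (0 : ℤ) < 2 ^ w := by positivity
          linarith
        · linarith
      have hv : (GExpr.op .slt (.reg x) e).ok w L s' := by
        refine ⟨trivial, he1, ?_, ?_⟩
        · simpa [GExpr.val, hr] using hir
        · simpa [he2] using hN
      obtain ⟨t, s1, h1, h2, h3, h4⟩ := hc i s' (by omega) hI
      obtain ⟨t', s2, h5, h6, h7⟩ := ih (i + 1) _ (by omega) h4
      have h8 : RamExec (.assign (x + 4) (.op .add (.reg (x + 4)) (.lit 1))) (s1.conc w L)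
          ((RamExpr.op .add (.reg (x + 4)) (.lit 1)).cost + 1)
          ((s1.setReg x (i + 1)).conc w L) := by
        have e0 := GExpr.comp_eval hL s1 (.op .add (.reg x) (.lit 1)) ⟨trivial, trivial, trivial⟩
        simp only [GExpr.val, GExpr.opVal, h3] at e0
        rw [conc_setReg, ← e0]
        exact .assign _ _ _
      refine ⟨_, s2, .loop_true ?_ (.seq h1 h8) h5, ?_, h7⟩
      · have := GExpr.comp_eval hL s' _ hv
        simp only [GExpr.comp] at this
        rw [this]
        simp only [GExpr.val, GExpr.opVal, hr, he2, if_pos hiN]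
        have h2w : GExpr.InRange w 1 := by
          constructor
          · have : (0 : ℤ) < 2 ^ w := by positivity
            linarith
          · have := hN.2
            have h0 : (0 : ℤ) ≤ i := by positivity
            linarith
        have h0w : GExpr.InRange w 0 := by
          have : (0 : ℤ) < 2 ^ w := by positivity
          exact ⟨by linarith, by linarith⟩
        intro h
        have := (GExpr.ofInt_injOn h2w h0w).1 (by simpa using h)
        omega
      · rw [Finset.sum_eq_sum_Ico_succ_bot (by omega : i < N)]
        simp only [RamExpr.cost] at *
        omega
  have h1 : RamExec (.assign (x + 4) (.lit 0)) (s.conc w L) (1 + 1)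
      ((s.setReg x 0).conc w L) := by
    rw [conc_setReg]
    exact .assign _ (.lit 0) _
  obtain ⟨t, s', h2, h3, h4⟩ := key N 0 _ (by omega) h0
  refine ⟨_, s', .seq h1 h2, ?_, h4⟩
  rw [Finset.range_eq_Ico]
  omega

/-- Unlike the clause of `wp`, this rule charges only the branch taken and admits loops inside the
branches. -/
theorem Runs.ite {w : ℕ} {L : Layout} (hL : (L.outBase : ℤ) ≤ 2 ^ w) {e : GExpr} {c d : GCmd}
    {T T' : ℕ} {s : GState} {Q : GState → Prop} (he : e.ok w L s)
    (hr : GExpr.InRange w (e.val L s)) (h1 : e.val L s ≠ 0 → c.Runs w L T s Q)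
    (h2 : e.val L s = 0 → d.Runs w L T' s Q) :
    (GCmd.ite e c d).Runs w L
      (e.comp.cost + 1 + if e.val L s ≠ 0 then T else T') s Q := by
  by_cases hv : e.val L s = 0
  · obtain ⟨t, s', h3, h4, h5⟩ := h2 hv
    exact ⟨_, s', .cond_false ((eval_ne_zero hL s e he hr).2 hv) h3, by simp [hv]; omega, h5⟩
  · obtain ⟨t, s', h3, h4, h5⟩ := h1 hv
    exact ⟨_, s', .cond_true (fun h => hv ((eval_ne_zero hL s e he hr).1 h)) h3,
      by simp [hv]; omega, h5⟩

end GCmd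

/-! ### Decomposing a labelled lattice string into rectangles -/

section Chains

open Classical in
/-- `F` counts the length of the chain `u, u + d, u + 2 d, …` along which `R` holds. -/
structure IsChainLength (d : Point) (Z : Set Point) (R : Point → Prop) (F : Point → ℕ) : Prop where
  mem : ∀ u, R u → u ∈ Z ∧ u + d ∈ Z
  rec_eq : ∀ u ∈ Z, F u = 1 + if R u then F (u + d) else 0

variable {d : Point} {Z : Set Point} {R : Point → Prop} {F : Point → ℕ}

theorem add_succ_smul (u d : Point) (i : ℕ) : u + ((i + 1 : ℕ) : ℤ) • d = u + (i : ℤ) • d + d := by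
  push_cast
  rw [add_smul, one_smul, add_assoc]

theorem IsChainLength.pos (h : IsChainLength d Z R F) {u : Point} (hu : u ∈ Z) : 0 < F u := by
  rw [h.rec_eq u hu]; omega

/-- On `Z` the recursion says that `R v` holds exactly if `F v > 1`; so `F` drops by one per step
until it reaches 1, where the chain stops. -/
theorem IsChainLength.forward (h : IsChainLength d Z R F) {u : Point} (hu : u ∈ Z) (i : ℕ)
    (hi : i < F u) : u + (i : ℤ) • d ∈ Z ∧ F (u + (i : ℤ) • d) + i = F u ∧
      (R (u + (i : ℤ) • d) ↔ i + 1 < F u) := by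
  have key : ∀ v, v ∈ Z → (R v ↔ 1 < F v) := by
    intro v hv
    have e := h.rec_eq v hv
    constructor
    · intro hR
      rw [if_pos hR] at e
      have := h.pos (h.mem v hR).2
      omega
    · intro h1
      by_contra hR
      rw [if_neg hR] at e
      omega
  induction i with
  | zero => simpa using ⟨hu, key u hu⟩
  | succ i ih =>
    obtain ⟨h1, h2, h3⟩ := ih (by omega)
    have hR := h3.2 hi
    have h4 := (h.mem _ hR).2
    have e := h.rec_eq _ h1
    rw [if_pos hR] at e
    rw [add_succ_smul]
    refine ⟨h4, by omega, ?_⟩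
    rw [key _ h4]
    omega

/-- Stepping back by `d` while `R` holds terminates, since `key` strictly decreases and is
non-negative on `Z`. The last point reached is a start. -/
theorem IsChainLength.backward (h : IsChainLength d Z R F) (key : Point → ℤ)
    (hk : ∀ u, key (u - d) < key u) (hk0 : ∀ u ∈ Z, 0 ≤ key u) {u : Point} (hu : u ∈ Z) :
    ∃ (s : Point) (i : ℕ), s ∈ Z ∧ ¬ R (s - d) ∧ i < F s ∧ u = s + (i : ℤ) • d := by
  have main : ∀ (k : ℕ) (u : Point), u ∈ Z → key u < k →
      ∃ (s : Point) (i : ℕ), s ∈ Z ∧ ¬ R (s - d) ∧ i < F s ∧ u = s + (i : ℤ) • d := by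
    intro k
    induction k with
    | zero => intro u hu hlt; have := hk0 u hu; simp at hlt; omega
    | succ k ih =>
      intro u hu hlt
      by_cases hR : R (u - d)
      · have hz := (h.mem _ hR).1
        have := hk u
        obtain ⟨s, i, h1, h2, h3, h4⟩ := ih (u - d) hz (by push_cast at hlt; omega)
        refine ⟨s, i + 1, h1, h2, ?_, ?_⟩
        · exact (h.forward h1 i h3).2.2.1 (h4 ▸ hR)
        · rw [add_succ_smul, ← h4, sub_add_cancel]
      · exact ⟨u, 0, hu, hR, h.pos hu, by simp⟩
  have h0 := hk0 u hu
  exact main ((key u).toNat + 1) u hu (by push_cast; omega)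

/-- Of two different starts on a common chain, the later one would be entered from its predecessor
with `R` holding, so it would not be a start. -/
theorem IsChainLength.unique (h : IsChainLength d Z R F) {s s' : Point} {i i' : ℕ} (hs : s ∈ Z)
    (hs' : s' ∈ Z) (hR : ¬ R (s - d)) (hR' : ¬ R (s' - d)) (hi : i < F s) (hi' : i' < F s')
    (he : s + (i : ℤ) • d = s' + (i' : ℤ) • d) : i = i' ∧ s = s' := by
  have main : ∀ {s s' : Point} {i i' : ℕ}, s ∈ Z → ¬ R (s' - d) → i < F s → i' < i →
      s + (i : ℤ) • d = s' + (i' : ℤ) • d → False := by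
    intro s s' i i' hs hR' hi hlt he
    apply hR'
    have e : s' - d = s + ((i - i' - 1 : ℕ) : ℤ) • d := by
      have : ((i - i' - 1 : ℕ) : ℤ) = i - i' - 1 := by omega
      rw [this, sub_smul, sub_smul, one_smul]
      have : s' = s + (i : ℤ) • d - (i' : ℤ) • d := by rw [he, add_sub_cancel_right]
      rw [this]
      abel
    rw [e]
    exact (h.forward hs _ (by omega)).2.2.2 (by omega)
  rcases lt_trichotomy i i' with hlt | rfl | hlt
  · exact (main hs' hR hi' hlt he.symm).elim
  · exact ⟨rfl, add_right_cancel he⟩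
  · exact (main hs hR' hi hlt he).elim

end Chains

/-- Two points carry the same non-zero label and the same character. -/
def SameCell (lab col : Point → ℤ) (u v : Point) : Prop :=
  lab u ≠ 0 ∧ lab u = lab v ∧ col u = col v

/-- The runs that start at `u` and at `v` have the same label, character and length. -/
def MergeRuns (lab col : Point → ℤ) (ρ : Point) (L : Point → ℕ) (u v : Point) : Prop :=
  SameCell lab col u v ∧ ¬ SameCell lab col (u - ρ) u ∧ ¬ SameCell lab col (v - ρ) v ∧ L u = L v

/-- `L` tabulates the lengths of the runs in direction `ρ`, and `H` the heights of the stacks of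
equal runs in direction `τ`. -/
structure IsRunTable (lab col : Point → ℤ) (ρ τ : Point) (L H : Point → ℕ) : Prop where
  run : IsChainLength ρ {u | lab u ≠ 0} (fun u => SameCell lab col u (u + ρ)) L
  stack : IsChainLength τ {u | lab u ≠ 0} (fun u => MergeRuns lab col ρ L u (u + τ)) H
  exists_key : ∃ key : Point → ℤ, (∀ u, key (u - ρ) < key u) ∧ (∀ u, key (u - τ) < key u) ∧
    ∀ u, lab u ≠ 0 → 0 ≤ key u

/-- `u` is the first point of the lowest run of a stack. -/
def IsStart (lab col : Point → ℤ) (ρ τ : Point) (L : Point → ℕ) (u : Point) : Prop :=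
  lab u ≠ 0 ∧ ¬ SameCell lab col (u - ρ) u ∧ ¬ MergeRuns lab col ρ L (u - τ) u

namespace IsRunTable

variable {lab col : Point → ℤ} {ρ τ : Point} {L H : Point → ℕ}

theorem stack_spec (h : IsRunTable lab col ρ τ L H) {u : Point} (hu : lab u ≠ 0)
    (hs : ¬ SameCell lab col (u - ρ) u) {j : ℕ} (hj : j < H u) :
    lab (u + (j : ℤ) • τ) = lab u ∧ col (u + (j : ℤ) • τ) = col u ∧
      L (u + (j : ℤ) • τ) = L u ∧
      ¬ SameCell lab col (u + (j : ℤ) • τ - ρ) (u + (j : ℤ) • τ) := by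
  induction j with
  | zero => simpa using hs
  | succ j ih =>
    obtain ⟨h1, h2, h3, h4⟩ := ih (by omega)
    obtain ⟨h5, h6, h7, h8⟩ := (h.stack.forward hu j (by omega)).2.2.2 hj
    rw [add_succ_smul]
    exact ⟨h5.2.1.symm.trans h1, h5.2.2.symm.trans h2, h8.symm.trans h3, h7⟩

theorem run_spec (h : IsRunTable lab col ρ τ L H) {u : Point} (hu : lab u ≠ 0) {i : ℕ}
    (hi : i < L u) : lab (u + (i : ℤ) • ρ) = lab u ∧ col (u + (i : ℤ) • ρ) = col u := by
  induction i with
  | zero => simp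
  | succ i ih =>
    obtain ⟨h1, h2⟩ := ih (by omega)
    obtain ⟨h5, h6, h7⟩ := (h.run.forward hu i (by omega)).2.2.2 hi
    rw [add_succ_smul]
    exact ⟨h6.symm.trans h1, h7.symm.trans h2⟩

theorem piece_spec (h : IsRunTable lab col ρ τ L H) {u : Point} (hu : IsStart lab col ρ τ L u)
    {i j : ℕ} (hj : j < H u) (hi : i < L u) :
    lab (u + (j : ℤ) • τ + (i : ℤ) • ρ) = lab u ∧ col (u + (j : ℤ) • τ + (i : ℤ) • ρ) = col u := by
  obtain ⟨h1, h2, h3, -⟩ := h.stack_spec hu.1 hu.2.1 hj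
  obtain ⟨h5, h6⟩ := h.run_spec (u := u + (j : ℤ) • τ) (h1 ▸ hu.1) (i := i) (by omega)
  exact ⟨h5.trans h1, h6.trans h2⟩

/-- Walk back along `ρ` to the start of the run, then along `τ` to the bottom of the stack. All runs
of a stack have equal length, so the offset `i` is also valid for the bottom run. -/
theorem exists_piece (h : IsRunTable lab col ρ τ L H) {v : Point} (hv : lab v ≠ 0) :
    ∃ (u : Point) (i j : ℕ), IsStart lab col ρ τ L u ∧ j < H u ∧ i < L u ∧
      v = u + (j : ℤ) • τ + (i : ℤ) • ρ := by
  obtain ⟨key, k1, k2, k3⟩ := h.exists_key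
  obtain ⟨s, i, hs, hsr, hi, rfl⟩ := h.run.backward key k1 k3 hv
  obtain ⟨u, j, hu, hur, hj, rfl⟩ := h.stack.backward key k2 k3 hs
  simp only [sub_add_cancel] at hsr hur
  -- For `j = 0` the bottom is the run start just found; otherwise the merge of `u` with the point
  -- above it says that a run starts at `u`.
  have hstart : ¬ SameCell lab col (u - ρ) u := by
    rcases Nat.eq_zero_or_pos j with rfl | hpos
    · simpa using hsr
    · have := (h.stack.forward hu 0 (by omega)).2.2.2 (by omega)
      simpa using this.2.1
  refine ⟨u, i, j, ⟨hu, hstart, hur⟩, hj, ?_, rfl⟩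
  rwa [(h.stack_spec hu hstart hj).2.2.1] at hi

theorem piece_unique (h : IsRunTable lab col ρ τ L H) {u u' : Point} {i j i' j' : ℕ}
    (hu : IsStart lab col ρ τ L u) (hu' : IsStart lab col ρ τ L u') (hj : j < H u) (hi : i < L u)
    (hj' : j' < H u') (hi' : i' < L u')
    (he : u + (j : ℤ) • τ + (i : ℤ) • ρ = u' + (j' : ℤ) • τ + (i' : ℤ) • ρ) :
    u = u' ∧ i = i' ∧ j = j' := by
  obtain ⟨h1, h2, h3, h4⟩ := h.stack_spec hu.1 hu.2.1 hj
  obtain ⟨h1', h2', h3', h4'⟩ := h.stack_spec hu'.1 hu'.2.1 hj'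
  obtain ⟨e1, e2⟩ := h.run.unique (s := u + (j : ℤ) • τ) (s' := u' + (j' : ℤ) • τ)
    (by simpa only [Set.mem_ofPred_eq, h1] using hu.1)
    (by simpa only [Set.mem_ofPred_eq, h1'] using hu'.1) (by simpa using h4) (by simpa using h4')
    (by omega) (by omega) he
  obtain ⟨e3, e4⟩ := h.stack.unique (s := u) (s' := u') hu.1 hu'.1 (by simpa using hu.2.2)
    (by simpa using hu'.2.2) hj hj' e2
  exact ⟨e4, e1, e3⟩

/-- The end of a run is a mismatch, provided that the label does not change there. -/
theorem run_end (h : IsRunTable lab col ρ τ L H) {u : Point} (hu : lab u ≠ 0)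
    (hl : lab (u + (L u : ℤ) • ρ) = lab u) :
    lab (u + (L u : ℤ) • ρ - ρ) = lab (u + (L u : ℤ) • ρ) ∧
      col (u + (L u : ℤ) • ρ - ρ) ≠ col (u + (L u : ℤ) • ρ) := by
  have hpos := h.run.pos hu
  obtain ⟨h1, h2⟩ := h.run_spec hu (i := L u - 1) (by omega)
  have h3 := (h.run.forward hu (L u - 1) (by omega)).2.2
  have e : u + (L u : ℤ) • ρ = u + ((L u - 1 : ℕ) : ℤ) • ρ + ρ := by
    rw [← add_succ_smul]; congr 3; omega
  rw [e] at hl ⊢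
  rw [add_sub_cancel_right, h1]
  refine ⟨hl.symm, fun hc => ?_⟩
  have h4 : ¬ (L u - 1 + 1 < L u) := by omega
  exact h4 (h3.1 ⟨by rw [h1]; exact hu, by rw [h1, hl], hc⟩)

/-- If the first points of two rows with the same labels have runs that end at the same label,
then the two points agree. -/
theorem run_end_injective (h : IsRunTable lab col ρ τ L H) {u u' : Point} (hu : lab u ≠ 0)
    (hu' : lab u' ≠ 0) (hr : lab (u - ρ) ≠ lab u) (hr' : lab (u' - ρ) ≠ lab u')
    (he : u + (L u : ℤ) • ρ = u' + (L u' : ℤ) • ρ) : u = u' := by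
  have h1 := h.run.pos hu
  have h1' := h.run.pos hu'
  have e : ∀ (v : Point), 0 < L v → v + (L v : ℤ) • ρ = v + ((L v - 1 : ℕ) : ℤ) • ρ + ρ := by
    intro v hv
    rw [← add_succ_smul]; congr 3; omega
  rw [e u h1, e u' h1'] at he
  refine (h.run.unique (s := u) (s' := u') hu hu' ?_ ?_ (by omega) (by omega)
    (add_right_cancel he)).2
  · simp only [sub_add_cancel]; exact fun hc => hr hc.2.1
  · simp only [sub_add_cancel]; exact fun hc => hr' hc.2.1

/-- The number of pieces is bounded by the number of mismatches and the number of first rows of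
blocks. `SB u` says that `u - τ` and `u` lie in the same block. -/
theorem card_starts_le (h : IsRunTable lab col ρ τ L H) (SB : Point → Prop) (A : Finset Point)
    (E₀ E₁ E₂ : Finset Point)
    (hSB : ∀ u (i : ℤ), SB u → lab (u - τ + i • ρ) = lab (u + i • ρ))
    (hA : ∀ u ∈ A, IsStart lab col ρ τ L u)
    (h₀ : ∀ u ∈ A, lab (u - ρ) ≠ lab u → ¬ SB u → u ∈ E₀)
    (h₁ : ∀ u ∈ A, ∀ v, lab v = lab u → lab (v - ρ) = lab v → col (v - ρ) ≠ col v → v ∈ E₁)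
    (h₂ : ∀ u ∈ A, SB u → col (u - τ) ≠ col u → u ∈ E₂) :
    A.card ≤ E₀.card + 3 * E₁.card + E₂.card := by
  classical
  -- In `A₁` the run of `u` itself ends at a mismatch, in `A₂` the run of `u - τ` does. The end of
  -- such a run determines its start, so each set injects into `E₁`; with `E₁` itself this gives the
  -- factor 3.
  set A₁ := A.filter fun u => lab (u - ρ) ≠ lab u ∧ SB u ∧ u + (L u : ℤ) • ρ ∈ E₁ with hA₁
  set A₂ := A.filter fun u => lab (u - ρ) ≠ lab u ∧ SB u ∧ lab (u - τ) ≠ 0 ∧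
    lab (u - τ - ρ) ≠ lab (u - τ) ∧ u - τ + (L (u - τ) : ℤ) • ρ ∈ E₁ with hA₂
  have hsub : A ⊆ E₀ ∪ E₁ ∪ E₂ ∪ A₁ ∪ A₂ := by
    intro u hu
    obtain ⟨hu0, hu1, hu2⟩ := hA u hu
    simp only [Finset.mem_union]
    by_cases hl : lab (u - ρ) = lab u
    · refine .inl (.inl (.inl (.inr (h₁ u hu u rfl hl fun hc => hu1 ⟨?_, hl, hc⟩))))
      rw [hl]; exact hu0
    by_cases hS : SB u
    swap
    · exact .inl (.inl (.inl (.inl (h₀ u hu hl hS))))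
    by_cases hc : col (u - τ) = col u
    swap
    · exact .inl (.inl (.inr (h₂ u hu hS hc)))
    have e0 : lab (u - τ) = lab u := by simpa using hSB u 0 hS
    have e1 : lab (u - τ - ρ) = lab (u - ρ) := by
      have := hSB u (-1) hS
      simpa [sub_eq_add_neg] using this
    have hv0 : lab (u - τ) ≠ 0 := by rw [e0]; exact hu0
    have hv1 : lab (u - τ - ρ) ≠ lab (u - τ) := by rw [e0, e1]; exact hl
    -- Equal lengths would merge the two runs, and `u` would not start a piece.
    have hne : L (u - τ) ≠ L u := fun hL =>
      hu2 ⟨⟨hv0, e0, hc⟩, fun hh => hv1 hh.2.1, hu1, hL⟩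
    rcases lt_or_gt_of_ne hne with hlt | hlt
    · right
      simp only [hA₂, Finset.mem_filter]
      refine ⟨hu, hl, hS, hv0, hv1, ?_⟩
      -- At the end of the shorter run the longer one still continues, so the label is unchanged
      -- there and only a change of character can have stopped the shorter run.
      have e2 : lab (u - τ + (L (u - τ) : ℤ) • ρ) = lab (u - τ) := by
        rw [hSB u _ hS, e0]
        exact (h.run_spec hu0 hlt).1
      obtain ⟨e3, e4⟩ := h.run_end hv0 e2
      exact h₁ u hu _ (e2.trans e0) e3 e4
    · left; right
      simp only [hA₁, Finset.mem_filter]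
      refine ⟨hu, hl, hS, ?_⟩
      have e2 : lab (u + (L u : ℤ) • ρ) = lab u := by
        rw [← hSB u _ hS, ← e0]
        exact (h.run_spec hv0 hlt).1
      obtain ⟨e3, e4⟩ := h.run_end hu0 e2
      exact h₁ u hu _ e2 e3 e4
  have c₁ : A₁.card ≤ E₁.card := by
    refine Finset.card_le_card_of_injOn (fun u => u + (L u : ℤ) • ρ) ?_ ?_
    · intro u hu
      exact (Finset.mem_filter.1 hu).2.2.2
    · intro u hu u' hu' he
      have a1 := Finset.mem_filter.1 hu
      have a2 := Finset.mem_filter.1 hu'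
      exact h.run_end_injective (hA u a1.1).1 (hA u' a2.1).1 a1.2.1 a2.2.1 he
  have c₂ : A₂.card ≤ E₁.card := by
    refine Finset.card_le_card_of_injOn (fun u => u - τ + (L (u - τ) : ℤ) • ρ) ?_ ?_
    · intro u hu
      exact (Finset.mem_filter.1 hu).2.2.2.2.2
    · intro u hu u' hu' he
      have a1 := (Finset.mem_filter.1 hu).2
      have a2 := (Finset.mem_filter.1 hu').2
      exact sub_left_injective (h.run_end_injective a1.2.2.1 a2.2.2.1 a1.2.2.2.1 a2.2.2.2.1 he)
  have := Finset.card_le_card hsub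
  have u1 := Finset.card_union_le (E₀ ∪ E₁ ∪ E₂ ∪ A₁) A₂
  have u2 := Finset.card_union_le (E₀ ∪ E₁ ∪ E₂) A₁
  have u3 := Finset.card_union_le (E₀ ∪ E₁) E₂
  have u4 := Finset.card_union_le E₀ E₁
  omega

end IsRunTable

/-- A lattice parallelogram. -/
def parallelogram (u ρ τ : Point) (p q : ℕ) : Set Point :=
  {v | ∃ i j : ℕ, j < q ∧ i < p ∧ v = u + (j : ℤ) • τ + (i : ℤ) • ρ}

/-- A step along `ψ` adds the determinant to `φ × u` and a step along `φ` subtracts it from `ψ × u`,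
so bounds on the two cross products are bounds on the two lattice coordinates. For `p = 0` or `q =
0` the bounds cross and both sets are empty. -/
theorem isSubtile_parallelogram {φ ψ : Point} (hD : 0 < φ.cross ψ) (u : Point) (p q : ℕ) :
    IsSubtile φ ψ (parallelogram u ψ φ p q) := by
  have c1 : ∀ s t : ℤ, φ.cross (u + t • φ + s • ψ) = φ.cross u + s * φ.cross ψ := by
    intro s t; simp [Point.cross]; ring
  have c2 : ∀ s t : ℤ, ψ.cross (u + t • φ + s • ψ) = ψ.cross u - t * φ.cross ψ := by
    intro s t; simp [Point.cross]; ring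
  refine ⟨_, ⟨φ.cross u, φ.cross u + (p - 1) * φ.cross ψ, ψ.cross u - (q - 1) * φ.cross ψ,
    ψ.cross u, rfl⟩, u, ?_⟩
  ext v
  simp only [parallelogram, Set.mem_ofPred_eq]
  constructor
  · rintro ⟨i, j, hj, hi, rfl⟩
    rw [c1, c2]
    refine ⟨⟨⟨?_, ?_⟩, ?_, ?_⟩, j, i, ?_⟩
    · have : 0 ≤ (i : ℤ) * φ.cross ψ := by positivity
      linarith
    · have : (i : ℤ) * φ.cross ψ ≤ (p - 1) * φ.cross ψ :=
        mul_le_mul_of_nonneg_right (by omega) hD.le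
      linarith
    · have : (j : ℤ) * φ.cross ψ ≤ (q - 1) * φ.cross ψ :=
        mul_le_mul_of_nonneg_right (by omega) hD.le
      linarith
    · have : 0 ≤ (j : ℤ) * φ.cross ψ := by positivity
      linarith
    · abel
  · rintro ⟨⟨⟨h1, h2⟩, h3, h4⟩, t, s, hst⟩
    have e : v = u + t • φ + s • ψ := by rw [add_assoc, ← hst]; abel
    rw [e, c1] at h1 h2
    rw [e, c2] at h3 h4
    have hs : 0 ≤ s := by
      by_contra hneg
      have : s * φ.cross ψ < 0 := mul_neg_of_neg_of_pos (by omega) hD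
      linarith
    have ht : 0 ≤ t := by
      by_contra hneg
      have : t * φ.cross ψ < 0 := mul_neg_of_neg_of_pos (by omega) hD
      linarith
    have hs' : s ≤ p - 1 := le_of_mul_le_mul_right (by linarith) hD
    have ht' : t ≤ q - 1 := le_of_mul_le_mul_right (by linarith) hD
    obtain ⟨s, rfl⟩ := Int.eq_ofNat_of_zero_le hs
    obtain ⟨t, rfl⟩ := Int.eq_ofNat_of_zero_le ht
    exact ⟨s, t, by omega, by omega, e⟩

theorem parallelogram_comm (u ρ τ : Point) (p q : ℕ) :
    parallelogram u ρ τ p q = parallelogram u τ ρ q p := by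
  ext v
  constructor <;> rintro ⟨i, j, hj, hi, rfl⟩ <;> exact ⟨j, i, hi, hj, by abel⟩

/-! ### The geometry of the active text -/

/-- The data on which the partition depends. -/
structure Inst where
  m : ℕ
  n : ℕ
  l : ℕ
  φ : Point
  ψ : Point
  T : Str
  Q : Finset Point

namespace Inst

/-- A sixteenth of `m / l`, rounded down. -/
def W (I : Inst) : ℤ := (I.m : ℤ) / (16 * I.l)

/-- The determinant of the lattice. -/
def D (I : Inst) : ℤ := I.φ.1 * I.ψ.2 - I.φ.2 * I.ψ.1

/-- The number of lattice points along `φ` in a block. -/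
def a (I : Inst) : ℤ := 1 + (I.m : ℤ) / (16 * I.l * (I.φ.1 - I.φ.2))

/-- The number of lattice points along `ψ` in a block. -/
def b (I : Inst) : ℤ := 1 + (I.m : ℤ) / (16 * I.l * (I.ψ.1 + I.ψ.2))

/-- The lattice coordinate along `φ`. -/
def S (I : Inst) (u : Point) : ℤ :=
  -- The offsets here and in `R` keep the dividend non-negative on the work area, as unsigned
  -- machine division requires.
  ((u.1 + 2 * I.n) * I.ψ.2 + (3 * I.n - u.2) * I.ψ.1) / I.D

/-- The lattice coordinate along `ψ`. -/
def R (I : Inst) (u : Point) : ℤ :=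
  ((u.2 + 2 * I.n) * I.φ.1 - (u.1 + 2 * I.n) * I.φ.2) / I.D

/-- The reference point of the block of `u`. -/
def ref (I : Inst) (u : Point) : Point :=
  (u.1 - (I.S u % I.a) * I.φ.1 - (I.R u % I.b) * I.ψ.1,
    u.2 - (I.S u % I.a) * I.φ.2 - (I.R u % I.b) * I.ψ.2)

/-- `u` lies in the square of side `m` at `q`. -/
def InSquare (I : Inst) (q u : Point) : Prop :=
  (q.1 ≤ u.1 ∧ u.1 < q.1 + I.m) ∧ q.2 ≤ u.2 ∧ u.2 < q.2 + I.m

/-- `u` lies in the active text. -/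
def Act (I : Inst) (u : Point) : Prop := ∃ q ∈ I.Q, I.InSquare q u

/-- The active text extends horizontally by `2 W` around `u`. -/
def Deep (I : Inst) (u : Point) : Prop :=
  I.Act (u.1 + 2 * I.W, u.2) ∧ I.Act (u.1 - 2 * I.W, u.2)

/-- All points of the block with reference point `r` are deep. -/
def Good (I : Inst) (r : Point) : Prop := ∀ v, I.ref v = r → I.Deep v

open Classical in
/-- The label of a point: zero, or the quadrant of the reference point of its block. -/
noncomputable def lab (I : Inst) (u : Point) : ℤ :=
  if I.Good (I.ref u) then
    1 + (if (I.n : ℤ) ≤ 2 * (I.ref u).1 then 1 else 0) +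
      2 * (if (I.n : ℤ) ≤ 2 * (I.ref u).2 then 1 else 0)
  else 0

/-- The character at `u`. -/
def col (I : Inst) (u : Point) : ℤ := (I.T u).getD 0

/-- The properties of the data that the geometric arguments use. -/
structure Valid (I : Inst) : Prop where
  m_pos : 0 < I.m
  l_pos : 0 < I.l
  m_le : I.m ≤ I.n
  n_le : 2 * I.n ≤ 3 * I.m
  n_even : Even I.n
  phi1 : 0 ≤ I.φ.1
  phi2 : I.φ.2 < 0
  psi1 : 0 < I.ψ.1
  psi2 : 0 ≤ I.ψ.2
  phi1_le : I.φ.1 + I.m ≤ I.n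
  phi2_le : -I.φ.2 + I.m ≤ I.n
  psi1_le : I.ψ.1 + I.m ≤ I.n
  psi2_le : I.ψ.2 + I.m ≤ I.n
  Q_mem : ∀ q ∈ I.Q, (0 ≤ q.1 ∧ q.1 + I.m ≤ I.n) ∧ 0 ≤ q.2 ∧ q.2 + I.m ≤ I.n
  dom : I.T.dom = square I.n
  four_D : (I.φ.1 - I.φ.2) * (I.ψ.1 + I.ψ.2) ≤ 4 * I.D

variable {I : Inst}

theorem Valid.D_pos (h : I.Valid) : 0 < I.D := by
  have := mul_nonneg h.phi1 h.psi2
  have := mul_pos (neg_pos.2 h.phi2) h.psi1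
  unfold D; linarith

theorem Valid.W_nonneg (_h : I.Valid) : 0 ≤ I.W := by unfold W; positivity

theorem Valid.W_le (h : I.Valid) : 16 * I.W ≤ I.m := by
  have hl : (1 : ℤ) ≤ I.l := by exact_mod_cast h.l_pos
  have h1 : I.W * (16 * I.l) ≤ I.m := Int.ediv_mul_le _ (by positivity)
  have := h.W_nonneg
  nlinarith

theorem Act.mem_text (h : I.Valid) {u : Point} (hu : I.Act u) :
    (0 ≤ u.1 ∧ u.1 < I.n) ∧ 0 ≤ u.2 ∧ u.2 < I.n := by
  obtain ⟨q, hq, hs⟩ := hu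
  have := h.Q_mem q hq
  unfold InSquare at hs
  omega

theorem Deep.mem_text (h : I.Valid) {u : Point} (hu : I.Deep u) :
    (0 ≤ u.1 ∧ u.1 < I.n) ∧ 0 ≤ u.2 ∧ u.2 < I.n := by
  have h1 := hu.1.mem_text h
  have h2 := hu.2.mem_text h
  have := h.W_nonneg
  dsimp only at h1 h2
  omega

theorem deep_of_lab (u : Point) (hu : I.lab u ≠ 0) : I.Deep u := by
  unfold lab at hu
  split_ifs at hu with hg
  all_goals first
    | exact hg u rfl
    | exact (hu rfl).elim

/-- This explains the form of `a` and `b`: with `d = 16 l` and `e` the ℓ¹-length of a lattice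
vector, a block extends by at most `W` in each coordinate along that vector. -/
theorem mul_floor_le {m d e x : ℤ} (hm : 0 ≤ m) (hd : 0 < d) (hxe : x ≤ e)
    (he : 0 < e) : m / (d * e) * x ≤ m / d := by
  have h0 : 0 ≤ m / (d * e) := Int.ediv_nonneg hm (by positivity)
  have h1 : m / (d * e) * (d * e) ≤ m := Int.ediv_mul_le _ (by positivity)
  rw [Int.le_ediv_iff_mul_le hd]
  have : m / (d * e) * x ≤ m / (d * e) * e := mul_le_mul_of_nonneg_left hxe h0
  nlinarith

/-- The two roles of the lattice vectors: `ρ` is the direction of runs, `τ` the direction of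
stacks. -/
structure Frame (I : Inst) (ρ τ : Point) (sρ sτ : Point → ℤ) (aρ aτ : ℤ) : Prop where
  ref_eq : ∀ u, I.ref u = u - (sτ u % aτ) • τ - (sρ u % aρ) • ρ
  s_rho : ∀ u (i j : ℤ), sρ (u + i • τ + j • ρ) = sρ u + j
  s_tau : ∀ u (i j : ℤ), sτ (u + i • τ + j • ρ) = sτ u + i
  a_rho : 0 < aρ
  a_tau : 0 < aτ
  rho1 : (aρ - 1) * |ρ.1| ≤ I.W
  rho2 : (aρ - 1) * |ρ.2| ≤ I.W
  tau1 : (aτ - 1) * |τ.1| ≤ I.W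
  tau2 : (aτ - 1) * |τ.2| ≤ I.W
  rows : ∃ K : Finset ℤ, K.card ≤ 98 * I.l ∧
    ∀ u : Point, ((0 ≤ u.1 ∧ u.1 < I.n) ∧ 0 ≤ u.2 ∧ u.2 < I.n) → sτ u / aτ ∈ K
  span : ∀ u v, LatticeCongruent I.φ I.ψ u v → ∃ i j : ℤ, u = v + i • τ + j • ρ

/-! ### Lattice coordinates and rows of blocks. -/

theorem Valid.S_add (h : I.Valid) (u : Point) (i j : ℤ) :
    I.S (u + i • I.φ + j • I.ψ) = I.S u + i := by
  have hD := h.D_pos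
  unfold S
  have : (u + i • I.φ + j • I.ψ).1 = u.1 + i * I.φ.1 + j * I.ψ.1 := by simp
  have h2 : (u + i • I.φ + j • I.ψ).2 = u.2 + i * I.φ.2 + j * I.ψ.2 := by simp
  rw [this, h2, ← Int.add_mul_ediv_right _ _ hD.ne']
  congr 1
  unfold D; ring

theorem Valid.R_add (h : I.Valid) (u : Point) (i j : ℤ) :
    I.R (u + i • I.φ + j • I.ψ) = I.R u + j := by
  have hD := h.D_pos
  unfold R
  have : (u + i • I.φ + j • I.ψ).1 = u.1 + i * I.φ.1 + j * I.ψ.1 := by simp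
  have h2 : (u + i • I.φ + j • I.ψ).2 = u.2 + i * I.φ.2 + j * I.ψ.2 := by simp
  rw [this, h2, ← Int.add_mul_ediv_right _ _ hD.ne']
  congr 1
  unfold D; ring

theorem rows_aux {X X₀ B L d : ℤ} (hd : 0 < d) (h0 : X₀ ≤ X) (hX : X ≤ X₀ + B)
    (hB : B ≤ 96 * L * d) : X / d ∈ Finset.Icc (X₀ / d) (X₀ / d + (96 * L + 1)) := by
  rw [Finset.mem_Icc]
  refine ⟨Int.ediv_le_ediv hd h0, ?_⟩
  have h1 : X ≤ X₀ + 96 * L * d := by linarith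
  have h2 := Int.ediv_le_ediv hd h1
  rw [Int.add_mul_ediv_right _ _ hd.ne'] at h2
  linarith

theorem rows_card {L : ℕ} (hL : 0 < L) (x : ℤ) :
    (Finset.Icc x (x + (96 * (L : ℤ) + 1))).card ≤ 98 * L := by
  rw [Int.card_Icc]; omega

/-- The bound on the sine enters through `hef`. By the choice of `c`, `16 l e c > m ≥ 2n/3`, hence
`n ≤ 24 l e c`; multiplying by `f` and using `e f ≤ 4 D` gives `96 l D c`. Since the dividend of `S`
or `R` varies by at most `n f` over the text, it meets O(l) strips of width `D c`. -/
theorem block_large (h : I.Valid) {e f c : ℤ} (he : 0 < e) (hf : 0 ≤ f)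
    (hef : e * f ≤ 4 * I.D) (hc : c = 1 + (I.m : ℤ) / (16 * I.l * e)) :
    I.n * f ≤ 96 * I.l * (I.D * c) := by
  have hl : (1 : ℤ) ≤ I.l := by exact_mod_cast h.l_pos
  have hn : (2 * I.n : ℤ) ≤ 3 * I.m := by exact_mod_cast h.n_le
  have h1 : (I.m : ℤ) < c * (16 * I.l * e) := by
    rw [hc, add_comm]
    exact Int.lt_ediv_add_one_mul_self _ (by positivity)
  have hc0 : 0 ≤ c := by
    rw [hc]
    have : 0 ≤ (I.m : ℤ) / (16 * I.l * e) := Int.ediv_nonneg (by positivity) (by positivity)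
    linarith
  have h2 : (I.n : ℤ) ≤ 24 * I.l * e * c := by linarith
  calc I.n * f ≤ 24 * I.l * e * c * f := mul_le_mul_of_nonneg_right h2 hf
    _ = 24 * I.l * c * (e * f) := by ring
    _ ≤ 24 * I.l * c * (4 * I.D) := mul_le_mul_of_nonneg_left hef (by positivity)
    _ = _ := by ring

theorem Valid.a_pos (h : I.Valid) : 0 < I.a := by
  have h1 := h.phi1
  have h2 := h.phi2
  have : 0 ≤ (I.m : ℤ) / (16 * I.l * (I.φ.1 - I.φ.2)) :=
    Int.ediv_nonneg (by positivity) (mul_nonneg (by positivity) (by linarith))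
  unfold a; linarith

theorem Valid.b_pos (h : I.Valid) : 0 < I.b := by
  have h1 := h.psi1
  have h2 := h.psi2
  have : 0 ≤ (I.m : ℤ) / (16 * I.l * (I.ψ.1 + I.ψ.2)) :=
    Int.ediv_nonneg (by positivity) (mul_nonneg (by positivity) (by linarith))
  unfold b; linarith

theorem Valid.phi_small (h : I.Valid) :
    (I.a - 1) * |I.φ.1| ≤ I.W ∧ (I.a - 1) * |I.φ.2| ≤ I.W := by
  have h1 := h.phi1
  have h2 := h.phi2
  have hl : (0 : ℤ) < 16 * I.l := by have := h.l_pos; positivity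
  have e : I.a - 1 = (I.m : ℤ) / (16 * I.l * (I.φ.1 - I.φ.2)) := by unfold a; ring
  rw [e, abs_of_nonneg h1, abs_of_neg h2]
  exact ⟨mul_floor_le (by positivity) hl (by linarith) (by linarith),
    mul_floor_le (by positivity) hl (by linarith) (by linarith)⟩

theorem Valid.psi_small (h : I.Valid) :
    (I.b - 1) * |I.ψ.1| ≤ I.W ∧ (I.b - 1) * |I.ψ.2| ≤ I.W := by
  have h1 := h.psi1
  have h2 := h.psi2
  have hl : (0 : ℤ) < 16 * I.l := by have := h.l_pos; positivity
  have e : I.b - 1 = (I.m : ℤ) / (16 * I.l * (I.ψ.1 + I.ψ.2)) := by unfold b; ring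
  rw [e, abs_of_pos h1, abs_of_nonneg h2]
  exact ⟨mul_floor_le (by positivity) hl (by linarith) (by linarith),
    mul_floor_le (by positivity) hl (by linarith) (by linarith)⟩

/-- The geometric arguments do not distinguish the two lattice vectors. They are carried out for a
`Frame`, and the two instances differ only in which vector is the direction of the runs. -/
theorem frame_psi (h : I.Valid) : Frame I I.ψ I.φ I.R I.S I.b I.a where
  ref_eq u := by ext <;> simp [ref]
  s_rho u i j := h.R_add u i j
  s_tau u i j := h.S_add u i j
  a_rho := h.b_pos
  a_tau := h.a_pos
  rho1 := h.psi_small.1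
  rho2 := h.psi_small.2
  tau1 := h.phi_small.1
  tau2 := h.phi_small.2
  rows := by
    have h1 := h.phi1
    have h2 := h.phi2
    have h3 := h.psi1
    have h4 := h.psi2
    have hbig := block_large h (e := I.φ.1 - I.φ.2) (f := I.ψ.1 + I.ψ.2) (c := I.a)
      (by linarith) (by linarith) h.four_D rfl
    refine ⟨_, rows_card h.l_pos ((2 * I.n * I.ψ.2 + 2 * I.n * I.ψ.1) / (I.D * I.a)), ?_⟩
    intro u hu
    -- Nested floors collapse, so the rows of blocks are strips of width `D * a` of a single linear
    -- form.
    have e : I.S u / I.a =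
        ((u.1 + 2 * I.n) * I.ψ.2 + (3 * I.n - u.2) * I.ψ.1) / (I.D * I.a) := by
      unfold S
      rw [Int.ediv_ediv_of_nonneg h.D_pos.le]
    rw [e]
    refine rows_aux (mul_pos h.D_pos h.a_pos) ?_ ?_ hbig
    · nlinarith
    · nlinarith
  span := by
    rintro u v ⟨s, t, hst⟩
    exact ⟨s, t, by rw [add_assoc, ← hst]; abel⟩

theorem frame_phi (h : I.Valid) : Frame I I.φ I.ψ I.S I.R I.a I.b where
  ref_eq u := by ext <;> simp [ref] <;> ring
  s_rho u i j := by rw [add_right_comm]; exact h.S_add u j i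
  s_tau u i j := by rw [add_right_comm]; exact h.R_add u j i
  a_rho := h.a_pos
  a_tau := h.b_pos
  rho1 := h.phi_small.1
  rho2 := h.phi_small.2
  tau1 := h.psi_small.1
  tau2 := h.psi_small.2
  rows := by
    have h1 := h.phi1
    have h2 := h.phi2
    have h3 := h.psi1
    have h4 := h.psi2
    have hbig := block_large h (e := I.ψ.1 + I.ψ.2) (f := I.φ.1 - I.φ.2) (c := I.b)
      (by linarith) (by linarith) (by rw [mul_comm]; exact h.four_D) rfl
    refine ⟨_, rows_card h.l_pos ((2 * I.n * I.φ.1 - 2 * I.n * I.φ.2) / (I.D * I.b)), ?_⟩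
    intro u hu
    have e : I.R u / I.b =
        ((u.2 + 2 * I.n) * I.φ.1 - (u.1 + 2 * I.n) * I.φ.2) / (I.D * I.b) := by
      unfold R
      rw [Int.ediv_ediv_of_nonneg h.D_pos.le]
    rw [e]
    refine rows_aux (mul_pos h.D_pos h.b_pos) ?_ ?_ hbig
    · nlinarith
    · nlinarith
  span := by
    rintro u v ⟨s, t, hst⟩
    exact ⟨t, s, by rw [add_right_comm, add_assoc, ← hst]; abel⟩

namespace Frame

variable {ρ τ : Point} {sρ sτ : Point → ℤ} {aρ aτ : ℤ}

theorem emod_mul_le {s c x W : ℤ} (hc : 0 < c) (h : (c - 1) * |x| ≤ W) : |s % c * x| ≤ W := by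
  rw [abs_mul, abs_of_nonneg (Int.emod_nonneg _ hc.ne')]
  have := Int.emod_lt_of_pos s hc
  exact (mul_le_mul_of_nonneg_right (by omega) (abs_nonneg x)).trans h

theorem ref_near (hf : Frame I ρ τ sρ sτ aρ aτ) (u : Point) :
    (-(2 * I.W) ≤ u.1 - (I.ref u).1 ∧ u.1 - (I.ref u).1 ≤ 2 * I.W) ∧
      -(2 * I.W) ≤ u.2 - (I.ref u).2 ∧ u.2 - (I.ref u).2 ≤ 2 * I.W := by
  have h1 := abs_le.1 (emod_mul_le (s := sρ u) hf.a_rho hf.rho1)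
  have h2 := abs_le.1 (emod_mul_le (s := sρ u) hf.a_rho hf.rho2)
  have h3 := abs_le.1 (emod_mul_le (s := sτ u) hf.a_tau hf.tau1)
  have h4 := abs_le.1 (emod_mul_le (s := sτ u) hf.a_tau hf.tau2)
  rw [hf.ref_eq]
  simp only [Prod.fst_sub, Prod.snd_sub, Prod.smul_fst, Prod.smul_snd, smul_eq_mul]
  omega

theorem ref_add_mul (hf : Frame I ρ τ sρ sτ aρ aτ) (u : Point) (k : ℤ) :
    I.ref (u + (aρ * k) • ρ) = I.ref u + (aρ * k) • ρ := by
  have h1 := hf.s_rho u 0 (aρ * k)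
  have h2 := hf.s_tau u 0 (aρ * k)
  simp only [zero_smul, add_zero] at h1 h2
  rw [hf.ref_eq, hf.ref_eq, h1, h2, Int.add_mul_emod_self_left]
  abel

/-- A non-zero index along `τ` means that `u - τ` is in the same row of blocks. Moving along `ρ`
does not change this index, so the two rows pass through the same blocks side by side. -/
theorem ref_row (hf : Frame I ρ τ sρ sτ aρ aτ) (u : Point) (hu : sτ u % aτ ≠ 0) (i : ℤ) :
    I.ref (u - τ + i • ρ) = I.ref (u + i • ρ) := by
  have h1 := hf.s_rho u (-1) i
  have h2 := hf.s_tau u (-1) i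
  have h3 := hf.s_rho u 0 i
  have h4 := hf.s_tau u 0 i
  have e : u + (-1 : ℤ) • τ + i • ρ = u - τ + i • ρ := by rw [neg_one_smul, sub_eq_add_neg]
  simp only [zero_smul, add_zero] at h3 h4
  rw [e] at h1 h2
  have e2 : (sτ u + -1) % aτ = sτ u % aτ - 1 := by
    have h5 := Int.emod_nonneg (sτ u) hf.a_tau.ne'
    have h6 := Int.emod_lt_of_pos (sτ u) hf.a_tau
    have h7 := Int.emod_add_mul_ediv (sτ u) aτ
    have : sτ u + -1 = (sτ u % aτ - 1) + aτ * (sτ u / aτ) := by linarith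
    rw [this, Int.add_mul_emod_self_left, Int.emod_eq_of_lt (by omega) (by omega)]
  rw [hf.ref_eq, hf.ref_eq, h1, h2, h3, h4, e2, sub_smul, one_smul]
  abel

/-- Along a row the reference point jumps by whole blocks, namely by the difference of the block
indices. -/
theorem ref_along (hf : Frame I ρ τ sρ sτ aρ aτ) (u : Point) (t : ℤ) :
    I.ref (u + t • ρ) = I.ref u + (aρ * ((sρ u + t) / aρ - sρ u / aρ)) • ρ := by
  have h1 := hf.s_rho u 0 t
  have h2 := hf.s_tau u 0 t
  simp only [zero_smul, add_zero] at h1 h2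
  have h7 := Int.emod_add_mul_ediv (sρ u) aρ
  have h8 := Int.emod_add_mul_ediv (sρ u + t) aρ
  have e : aρ * ((sρ u + t) / aρ - sρ u / aρ) = t - (sρ u + t) % aρ + sρ u % aρ := by linarith
  rw [hf.ref_eq, hf.ref_eq, h1, h2, e, add_smul, sub_smul]
  abel

end Frame

/-! ### Monotonicity of the active text within a quadrant. -/

/-- The half line of coordinates on one side of the centre. -/
def Side (n : ℕ) (s x : ℤ) : Prop := (s = 1 ∧ (n : ℤ) ≤ 2 * x) ∨ (s = -1 ∧ 2 * x < n)

/-- The label of a quadrant. -/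
def code (sx sy : ℤ) : ℤ := (5 + sx + 2 * sy) / 2

/-- The sign patterns (-,-), (+,-), (-,+), (+,+) have the codes 1, 2, 3, 4, in agreement with the
arithmetic in `lab`. -/
theorem lab_eq_code_iff {sx sy : ℤ} (hx : sx = 1 ∨ sx = -1) (hy : sy = 1 ∨ sy = -1) (u : Point) :
    I.lab u = code sx sy ↔
      I.Good (I.ref u) ∧ Side I.n sx (I.ref u).1 ∧ Side I.n sy (I.ref u).2 := by
  unfold lab code Side
  by_cases hg : I.Good (I.ref u)
  · simp only [hg, if_true, true_and]
    rcases hx with rfl | rfl <;> rcases hy with rfl | rfl <;> norm_num <;> split_ifs <;> omega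
  · simp only [hg, if_false, false_and, iff_false]
    rcases hx with rfl | rfl <;> rcases hy with rfl | rfl <;> norm_num

/-- The square that contains `p` also contains `p'`: its left and lower edges are at most `n - m`
and its right and upper edges at least `m`, so each edge is respected either for this reason or by
comparison with `p`. -/
theorem Act.of_between (h : I.Valid) {p p' : Point} (hp : I.Act p)
    (h1 : I.n ≤ p'.1 + I.m ∨ p.1 ≤ p'.1) (h2 : p'.1 < I.m ∨ p'.1 ≤ p.1)
    (h3 : I.n ≤ p'.2 + I.m ∨ p.2 ≤ p'.2) (h4 : p'.2 < I.m ∨ p'.2 ≤ p.2) : I.Act p' := by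
  obtain ⟨q, hq, hs⟩ := hp
  refine ⟨q, hq, ?_⟩
  have := h.Q_mem q hq
  unfold InSquare at *
  omega

/-- With `r` on the given side, `v` and its horizontal shifts by `2 W` cross the centre line by at
most `4 W`. As `n / 2 + 4 W ≤ m`, they are still within reach of every square on the inner side, and
on the outer side `v + e` dominates. The 16 in `W` is chosen for this inequality. -/
theorem deep_of_outward (h : I.Valid) {sx sy : ℤ} {v e r : Point} (hx : Side I.n sx r.1)
    (hy : Side I.n sy r.2) (h1 : 0 ≤ sx * e.1) (h2 : 0 ≤ sy * e.2)
    (hr : (-(2 * I.W) ≤ v.1 - r.1 ∧ v.1 - r.1 ≤ 2 * I.W) ∧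
      -(2 * I.W) ≤ v.2 - r.2 ∧ v.2 - r.2 ≤ 2 * I.W)
    (hd : I.Deep (v + e)) : I.Deep v := by
  have hW := h.W_le
  have hW0 := h.W_nonneg
  have hn := h.n_le
  obtain ⟨c, hc⟩ := h.n_even
  obtain ⟨d1, d2⟩ := hd
  constructor
  · refine d1.of_between h ?_ ?_ ?_ ?_ <;>
    rcases hx with ⟨rfl, hx⟩ | ⟨rfl, hx⟩ <;> rcases hy with ⟨rfl, hy⟩ | ⟨rfl, hy⟩ <;>
    simp only [Prod.fst_add, Prod.snd_add] <;> omega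
  · refine d2.of_between h ?_ ?_ ?_ ?_ <;>
    rcases hx with ⟨rfl, hx⟩ | ⟨rfl, hx⟩ <;> rcases hy with ⟨rfl, hy⟩ | ⟨rfl, hy⟩ <;>
    simp only [Prod.fst_add, Prod.snd_add] <;> omega

theorem Side.outward {n : ℕ} {s x e : ℤ} (h : Side n s x) (he : 0 ≤ s * e) : Side n s (x + e) := by
  unfold Side at *
  rcases h with ⟨rfl, h⟩ | ⟨rfl, h⟩
  · left; omega
  · right; omega

/-- The vector `ρ` points away from the centre in the quadrant, or towards it. -/
def Aligned (sx sy : ℤ) (ρ : Point) : Prop :=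
  (0 ≤ sx * ρ.1 ∧ 0 ≤ sy * ρ.2) ∨ (0 ≤ sx * -ρ.1 ∧ 0 ≤ sy * -ρ.2)

namespace Frame

variable {ρ τ : Point} {sρ sτ : Point → ℤ} {aρ aτ : ℤ}

theorem good_of_outward (h : I.Valid) (hf : Frame I ρ τ sρ sτ aρ aτ) {sx sy k : ℤ} {r : Point}
    (hx : Side I.n sx r.1) (hy : Side I.n sy r.2)
    (h1 : 0 ≤ sx * ((aρ * k) • ρ).1) (h2 : 0 ≤ sy * ((aρ * k) • ρ).2)
    (hg : I.Good (r + (aρ * k) • ρ)) : I.Good r := by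
  intro v hv
  have := hf.ref_near v
  rw [hv] at this
  refine deep_of_outward h hx hy h1 h2 this (hg _ ?_)
  rw [hf.ref_add_mul, hv]

/-- In each row, the points of a quadrant with the same label are contiguous. -/
theorem lab_between (h : I.Valid) (hf : Frame I ρ τ sρ sτ aρ aτ) {sx sy : ℤ}
    (hx : sx = 1 ∨ sx = -1) (hy : sy = 1 ∨ sy = -1) (hal : Aligned sx sy ρ) {u : Point}
    {t t' : ℤ} (ht : 0 ≤ t') (htt : t' ≤ t) (h0 : I.lab u = code sx sy)
    (h1 : I.lab (u + t • ρ) = code sx sy) : I.lab (u + t' • ρ) = code sx sy := by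
  rw [lab_eq_code_iff hx hy] at *
  obtain ⟨g0, x0, y0⟩ := h0
  obtain ⟨g1, x1, y1⟩ := h1
  have e1 := hf.ref_along u t'
  have e2 := hf.ref_along u t
  set k := (sρ u + t') / aρ - sρ u / aρ with hk
  set k' := (sρ u + t) / aρ - (sρ u + t') / aρ with hk'
  have hk0 : 0 ≤ k := sub_nonneg.2 (Int.ediv_le_ediv hf.a_rho (by omega))
  have hk0' : 0 ≤ k' := sub_nonneg.2 (Int.ediv_le_ediv hf.a_rho (by omega))
  have e3 : I.ref (u + t • ρ) = I.ref (u + t' • ρ) + (aρ * k') • ρ := by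
    rw [e1, e2, add_assoc, ← add_smul]
    congr 2
    rw [hk, hk']; ring
  have c1 : 0 ≤ aρ * k := mul_nonneg hf.a_rho.le hk0
  have c2 : 0 ≤ aρ * k' := mul_nonneg hf.a_rho.le hk0'
  -- Being on a side propagates outward and goodness propagates inward. So the inner end of the
  -- segment supplies the quadrant and the outer end the goodness; the two cases say which end is
  -- which.
  rcases hal with ⟨a1, a2⟩ | ⟨a1, a2⟩
  · have p1 : 0 ≤ sx * ((aρ * k) • ρ).1 := by
      have := mul_nonneg c1 a1; simp only [Prod.smul_fst, smul_eq_mul]; linarith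
    have p2 : 0 ≤ sy * ((aρ * k) • ρ).2 := by
      have := mul_nonneg c1 a2; simp only [Prod.smul_snd, smul_eq_mul]; linarith
    have p3 : 0 ≤ sx * ((aρ * k') • ρ).1 := by
      have := mul_nonneg c2 a1; simp only [Prod.smul_fst, smul_eq_mul]; linarith
    have p4 : 0 ≤ sy * ((aρ * k') • ρ).2 := by
      have := mul_nonneg c2 a2; simp only [Prod.smul_snd, smul_eq_mul]; linarith
    have x2 : Side I.n sx (I.ref (u + t' • ρ)).1 := by rw [e1]; exact x0.outward p1
    have y2 : Side I.n sy (I.ref (u + t' • ρ)).2 := by rw [e1]; exact y0.outward p2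
    exact ⟨hf.good_of_outward h x2 y2 p3 p4 (e3 ▸ g1), x2, y2⟩
  · have p1 : 0 ≤ sx * ((aρ * -k) • ρ).1 := by
      have := mul_nonneg c1 a1; simp only [Prod.smul_fst, smul_eq_mul]; linarith
    have p2 : 0 ≤ sy * ((aρ * -k) • ρ).2 := by
      have := mul_nonneg c1 a2; simp only [Prod.smul_snd, smul_eq_mul]; linarith
    have p3 : 0 ≤ sx * ((aρ * -k') • ρ).1 := by
      have := mul_nonneg c2 a1; simp only [Prod.smul_fst, smul_eq_mul]; linarith
    have p4 : 0 ≤ sy * ((aρ * -k') • ρ).2 := by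
      have := mul_nonneg c2 a2; simp only [Prod.smul_snd, smul_eq_mul]; linarith
    have e4 : I.ref (u + t' • ρ) = I.ref (u + t • ρ) + (aρ * -k') • ρ := by
      rw [e3, add_assoc, ← add_smul]; simp
    have e5 : I.ref u = I.ref (u + t' • ρ) + (aρ * -k) • ρ := by
      rw [e1, add_assoc, ← add_smul]; simp
    have x2 : Side I.n sx (I.ref (u + t' • ρ)).1 := by rw [e4]; exact x1.outward p3
    have y2 : Side I.n sy (I.ref (u + t' • ρ)).2 := by rw [e4]; exact y1.outward p4
    exact ⟨hf.good_of_outward h x2 y2 p1 p2 (e5 ▸ g0), x2, y2⟩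

end Frame

end Inst

/-! ### Counting mismatches and pieces -/

/-- The number of classes modulo a lattice is at most its determinant. -/
theorem exists_classes (φ ψ : Point) (hψ : 0 < ψ.1) (hD : 0 < φ.cross ψ) :
    ∃ (cls : Point → Point) (K : Finset Point), (K.card : ℤ) ≤ φ.cross ψ ∧ (∀ u, cls u ∈ K) ∧
      ∀ u v, cls u = cls v → LatticeCongruent φ ψ u v := by
  set g : ℤ := (Int.gcd ψ.1 ψ.2 : ℤ) with hg
  have hg0 : 0 < g := by
    rw [hg]; exact_mod_cast Int.gcd_pos_of_ne_zero_left _ hψ.ne'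
  obtain ⟨p, hp⟩ : g ∣ ψ.1 := Int.gcd_dvd_left _ _
  obtain ⟨q, hq⟩ : g ∣ ψ.2 := Int.gcd_dvd_right _ _
  set α := Int.gcdA ψ.1 ψ.2
  set β := Int.gcdB ψ.1 ψ.2
  have hbez : α * p + β * q = 1 := by
    have h1 : g = ψ.1 * α + ψ.2 * β := Int.gcd_eq_gcd_ab _ _
    have h2 : g * (α * p + β * q) = g * 1 := by
      rw [hp, hq] at h1; linarith
    exact mul_left_cancel₀ hg0.ne' h2
  set d := φ.1 * q - φ.2 * p with hd
  have hDd : φ.cross ψ = g * d := by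
    simp only [Point.cross]; rw [hp, hq, hd]; ring
  have hd0 : 0 < d := by
    rw [hDd] at hD; exact (mul_pos_iff_of_pos_left hg0).1 hD
  -- The form `X` vanishes on `ψ` and equals `d` on `φ`, while the Bézout form `Z` equals `g` on
  -- `ψ`. In these coordinates the lattice is triangular with diagonal `d`, `g`, where `g * d` is
  -- the determinant: reduce `X` modulo `d`, correct `Z` for the multiples of `φ` removed, then
  -- reduce modulo `g`.
  set X : Point → ℤ := fun u => u.1 * q - u.2 * p with hX
  set Z : Point → ℤ := fun u => α * u.1 + β * u.2 with hZ
  refine ⟨fun u => (X u % d, (Z u - X u / d * Z φ) % g),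
    Finset.Ico 0 d ×ˢ Finset.Ico 0 g, ?_, ?_, ?_⟩
  · rw [Finset.card_product, Int.card_Ico, Int.card_Ico, hDd]
    push_cast
    rw [Int.toNat_of_nonneg (by linarith), Int.toNat_of_nonneg (by linarith)]
    linarith
  · intro u
    simp only [Finset.mem_product, Finset.mem_Ico]
    exact ⟨⟨Int.emod_nonneg _ hd0.ne', Int.emod_lt_of_pos _ hd0⟩, Int.emod_nonneg _ hg0.ne',
      Int.emod_lt_of_pos _ hg0⟩
  · intro u v huv
    obtain ⟨h1, h2⟩ := Prod.mk.inj huv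
    have e1 := Int.emod_add_mul_ediv (X u) d
    have e2 := Int.emod_add_mul_ediv (X v) d
    obtain ⟨t, ht⟩ := Int.ModEq.dvd (Eq.symm h2)
    set s := X u / d - X v / d with hs
    have e3 : X u - X v = s * d := by rw [hs]; linarith
    have e4 : Z u - Z v = s * Z φ + g * t := by rw [hs]; linarith
    refine ⟨s, t, ?_⟩
    simp only [hX] at e3
    simp only [hZ] at e4
    ext
    · simp only [Prod.fst_sub, Prod.fst_add, Prod.smul_fst, smul_eq_mul, hp]
      linear_combination (-(u.1 - v.1 - s * φ.1)) * hbez + p * e4 + β * e3 + s * β * hd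
    · simp only [Prod.snd_sub, Prod.snd_add, Prod.smul_snd, smul_eq_mul, hq]
      linear_combination (-(u.2 - v.2 - s * φ.2)) * hbez + q * e4 - α * e3 - s * α * hd

namespace Inst

variable {I : Inst}

/-- `x` is not beyond the central square on the side opposite to `s`. -/
def Slack (I : Inst) (s x : ℤ) : Prop := (s = 1 ∧ (I.n : ℤ) ≤ x + I.m) ∨ (s = -1 ∧ x < I.m)

/-- All points of the text on the central side of `z`, in the given quadrant, lie in a square
that depends on few data only. -/
theorem exists_cover (h : I.Valid) (hQ : I.Q.Nonempty) {sx sy : ℤ} (hx : sx = 1 ∨ sx = -1)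
    (hy : sy = 1 ∨ sy = -1) (β : ℤ) :
    ∃ q ∈ I.Q, ∀ z : Point, z.1 / (I.W + 1) = β → I.Act (z.1 + sx * I.W, z.2) →
      ∀ p : Point, I.Slack sx p.1 → I.Slack sy p.2 → sx * p.1 ≤ sx * z.1 → sy * p.2 ≤ sy * z.2 →
        I.InSquare q p := by
  classical
  have hW := h.W_nonneg
  -- The candidates whose squares reach horizontally over the outer edge of the band. If `z` in the
  -- band is active even after a shift outward by `W`, the square responsible for it belongs to `F`.
  set F := I.Q.filter fun q => (sx = 1 ∧ β * (I.W + 1) + I.W < q.1 + I.m) ∨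
    (sx = -1 ∧ q.1 ≤ β * (I.W + 1)) with hF
  by_cases hne : F.Nonempty
  -- Within `F` the horizontal extent no longer matters, so the candidate that reaches farthest
  -- outward vertically dominates all others.
  · obtain ⟨q, hq, hmax⟩ := F.exists_max_image (fun q => sy * q.2) hne
    obtain ⟨hqQ, hqF⟩ := Finset.mem_filter.1 hq
    refine ⟨q, hqQ, ?_⟩
    rintro z hz ⟨q', hq', hs⟩ p p1 p2 p3 p4
    have hb1 : β * (I.W + 1) ≤ z.1 := hz ▸ Int.ediv_mul_le _ (by linarith)
    have hb2 : z.1 < β * (I.W + 1) + (I.W + 1) := by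
      have := Int.lt_ediv_add_one_mul_self z.1 (show 0 < I.W + 1 by linarith)
      rw [hz] at this; linarith
    set B := β * (I.W + 1)
    have hq'F : q' ∈ F := by
      refine Finset.mem_filter.2 ⟨hq', ?_⟩
      unfold InSquare at hs
      dsimp only at hs
      rcases hx with rfl | rfl
      · left; omega
      · right; omega
    have hm := hmax q' hq'F
    have b1 := h.Q_mem q hqQ
    have b2 := h.Q_mem q' hq'
    unfold InSquare Slack at *
    dsimp only at hs
    rcases hx with rfl | rfl <;> rcases hy with rfl | rfl <;> omega
  · obtain ⟨q, hq⟩ := hQ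
    refine ⟨q, hq, ?_⟩
    rintro z hz ⟨q', hq', hs⟩
    exfalso
    apply hne
    have hb1 : β * (I.W + 1) ≤ z.1 := hz ▸ Int.ediv_mul_le _ (by linarith)
    have hb2 : z.1 < β * (I.W + 1) + (I.W + 1) := by
      have := Int.lt_ediv_add_one_mul_self z.1 (show 0 < I.W + 1 by linarith)
      rw [hz] at this; linarith
    refine ⟨q', Finset.mem_filter.2 ⟨hq', ?_⟩⟩
    set B := β * (I.W + 1)
    unfold InSquare at hs
    dsimp only at hs
    rcases hx with rfl | rfl
    · left; omega
    · right; omega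

/-- In each square of a candidate, at most `B` points differ from their translates by `-δ`. -/
def MismatchBound (I : Inst) (δ : Point) (B : ℕ) : Prop :=
  ∀ q ∈ I.Q, ∃ M : Finset Point, M.card ≤ B ∧ ∀ u, I.InSquare q u → I.InSquare q (u - δ) →
    I.col (u - δ) ≠ I.col u → u ∈ M

/-- A point `z` that bounds both `u` and `u - δ` from outside puts them into the square chosen for
the band of `z`, where the mismatch is counted. As `n < 24 l (W + 1)`, there are at most `24 l + 1 ≤
25 l` bands. -/
theorem exists_mismatch_set (h : I.Valid) (hQ : I.Q.Nonempty) {δ : Point} {B : ℕ}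
    (hM : I.MismatchBound δ B) {sx sy : ℤ} (hx : sx = 1 ∨ sx = -1) (hy : sy = 1 ∨ sy = -1) :
    ∃ E : Finset Point, E.card ≤ 25 * I.l * B ∧ ∀ u z : Point,
      I.Act (z.1 + sx * I.W, z.2) → (0 ≤ z.1 ∧ z.1 < I.n) →
      I.Slack sx u.1 → I.Slack sy u.2 → I.Slack sx (u - δ).1 → I.Slack sy (u - δ).2 →
      sx * u.1 ≤ sx * z.1 → sy * u.2 ≤ sy * z.2 →
      sx * (u - δ).1 ≤ sx * z.1 → sy * (u - δ).2 ≤ sy * z.2 →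
      I.col (u - δ) ≠ I.col u → u ∈ E := by
  classical
  choose q hq hcov using exists_cover h hQ hx hy
  choose! M hMc hMu using hM
  refine ⟨(Finset.Icc 0 (24 * (I.l : ℤ))).biUnion fun β => M (q β), ?_, ?_⟩
  · refine (Finset.card_biUnion_le_card_mul _ _ B fun β _ => hMc _ (hq β)).trans ?_
    refine Nat.mul_le_mul_right _ ?_
    have := h.l_pos
    rw [Int.card_Icc]; omega
  · intro u z hz hz' u1 u2 v1 v2 u3 u4 v3 v4 hc
    rw [Finset.mem_biUnion]
    refine ⟨z.1 / (I.W + 1), ?_, hMu _ (hq _) u (hcov _ z rfl hz u u1 u2 u3 u4)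
      (hcov _ z rfl hz (u - δ) v1 v2 v3 v4) hc⟩
    have hW := h.W_nonneg
    have hl : (0 : ℤ) < 16 * I.l := by have := h.l_pos; positivity
    have hn : (2 * I.n : ℤ) ≤ 3 * I.m := by exact_mod_cast h.n_le
    have hlt : (I.m : ℤ) < (I.W + 1) * (16 * I.l) := Int.lt_ediv_add_one_mul_self _ hl
    rw [Finset.mem_Icc]
    refine ⟨Int.ediv_nonneg hz'.1 (by linarith), ?_⟩
    refine Int.ediv_le_of_le_mul (by linarith) ?_
    linarith

theorem slack_of_lab (h : I.Valid) {ρ τ : Point} {sρ sτ : Point → ℤ} {aρ aτ : ℤ}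
    (hf : Frame I ρ τ sρ sτ aρ aτ) {sx sy : ℤ} (hx : sx = 1 ∨ sx = -1) (hy : sy = 1 ∨ sy = -1)
    {u : Point} (hu : I.lab u = code sx sy) :
    I.Deep u ∧ I.Slack sx u.1 ∧ I.Slack sy u.2 := by
  obtain ⟨g, s1, s2⟩ := (lab_eq_code_iff hx hy u).1 hu
  have hr := hf.ref_near u
  have hW := h.W_le
  have hn := h.n_le
  obtain ⟨c, hc⟩ := h.n_even
  refine ⟨g u rfl, ?_, ?_⟩
  · unfold Side Slack at *
    rcases s1 with ⟨rfl, s1⟩ | ⟨rfl, s1⟩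
    · left; omega
    · right; omega
  · unfold Side Slack at *
    rcases s2 with ⟨rfl, s2⟩ | ⟨rfl, s2⟩
    · left; omega
    · right; omega

/-- Half of the margin `2 W` is spent on moving from `u` outward to `z`, the other half on the shift
by `W` that the covering by bands asks for. -/
theorem Deep.act_near (h : I.Valid) {u z : Point} (hu : I.Deep u) {sx : ℤ}
    (hx : sx = 1 ∨ sx = -1) (hsx : I.Slack sx u.1) (hy : z.2 = u.2)
    (hz1 : sx * u.1 ≤ sx * z.1) (hz2 : sx * z.1 ≤ sx * u.1 + I.W) :
    I.Act (z.1 + sx * I.W, z.2) ∧ 0 ≤ z.1 ∧ z.1 < I.n := by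
  have hW := h.W_le
  have hW0 := h.W_nonneg
  have hn := h.n_le
  have hm := h.m_le
  obtain ⟨d1, d2⟩ := hu
  have t1 := d1.mem_text h
  have t2 := d2.mem_text h
  dsimp only at t1 t2
  unfold Slack at hsx
  rcases hx with rfl | rfl
  · refine ⟨d1.of_between h ?_ ?_ ?_ ?_, ?_, ?_⟩ <;> omega
  · refine ⟨d2.of_between h ?_ ?_ ?_ ?_, ?_, ?_⟩ <;> omega

/-- The number of pieces of one label. -/
theorem card_starts (h : I.Valid) (hQ : I.Q.Nonempty) {ρ τ : Point} {sρ sτ : Point → ℤ}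
    {aρ aτ : ℤ} (hf : Frame I ρ τ sρ sτ aρ aτ) {B : ℕ} (hMρ : I.MismatchBound ρ B)
    (hMτ : I.MismatchBound τ B) {L H : Point → ℕ} (hrun : IsRunTable I.lab I.col ρ τ L H)
    {sx sy : ℤ} (hx : sx = 1 ∨ sx = -1) (hy : sy = 1 ∨ sy = -1) (hal : Aligned sx sy ρ)
    (A : Finset Point) (hA : ∀ u ∈ A, IsStart I.lab I.col ρ τ L u)
    (hAc : ∀ u ∈ A, I.lab u = code sx sy) :
    A.card ≤ 98 * I.l * I.D.toNat + 100 * I.l * B := by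
  classical
  have hslack := fun u => slack_of_lab (u := u) h hf hx hy
  obtain ⟨E₁, c₁, hE₁⟩ := exists_mismatch_set h hQ hMρ hx hy
  obtain ⟨E₂, c₂, hE₂⟩ := exists_mismatch_set h hQ hMτ hx hy
  have h₁ : ∀ u ∈ A, ∀ v, I.lab v = I.lab u → I.lab (v - ρ) = I.lab v →
      I.col (v - ρ) ≠ I.col v → v ∈ E₁ := by
    intro u hu v hv hv' hc
    rw [hAc u hu] at hv
    obtain ⟨d1, s1, s2⟩ := hslack v hv
    obtain ⟨d1', s1', s2'⟩ := hslack (v - ρ) (hv'.trans hv)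
    -- Because `ρ` is aligned with the quadrant, one of `v` and `v - ρ` is the outer one in both
    -- coordinates and can serve as `z`.
    rcases hal with ⟨a1, a2⟩ | ⟨a1, a2⟩
    · obtain ⟨z1, z2⟩ := d1.act_near (z := v) h hx s1 rfl le_rfl
        (by linarith [h.W_nonneg])
      refine hE₁ v v z1 z2 s1 s2 s1' s2' le_rfl le_rfl ?_ ?_ hc
      · simp only [Prod.fst_sub]; linarith
      · simp only [Prod.snd_sub]; linarith
    · obtain ⟨z1, z2⟩ := d1'.act_near (z := v - ρ) h hx s1' rfl le_rfl
        (by linarith [h.W_nonneg])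
      refine hE₁ v (v - ρ) z1 z2 s1 s2 s1' s2' ?_ ?_ le_rfl le_rfl hc
      · simp only [Prod.fst_sub]; linarith
      · simp only [Prod.snd_sub]; linarith
  have hrow : ∀ u (i : ℤ), sτ u % aτ ≠ 0 → I.lab (u - τ + i • ρ) = I.lab (u + i • ρ) := by
    intro u i hu
    unfold lab
    rw [hf.ref_row u hu i]
  have h₂ : ∀ u ∈ A, sτ u % aτ ≠ 0 → I.col (u - τ) ≠ I.col u → u ∈ E₂ := by
    intro u hu hS hc
    have hl := hAc u hu
    have hl' : I.lab (u - τ) = code sx sy := by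
      have := hrow u 0 hS
      simpa [hl] using this
    obtain ⟨d1, s1, s2⟩ := hslack u hl
    obtain ⟨d1', s1', s2'⟩ := hslack (u - τ) hl'
    -- With `aτ = 1` all remainders would vanish. So `aτ ≥ 2`, and the bound on the extent of a
    -- block along `τ` bounds a single step by `W`.
    have ha : 1 ≤ aτ - 1 := by
      have := hf.a_tau
      by_contra hcon
      have : aτ = 1 := by omega
      rw [this] at hS
      exact hS (Int.emod_one _)
    have t1 : |τ.1| ≤ I.W := by
      have := hf.tau1
      have := mul_le_mul_of_nonneg_right ha (abs_nonneg τ.1)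
      linarith
    obtain ⟨t1, t2⟩ := abs_le.1 t1
    simp only [Prod.fst_sub, Prod.snd_sub] at s1' s2'
    -- the corner of the two points that is farthest from the centre
    set z : Point := (if sx * u.1 ≤ sx * (u - τ).1 then (u - τ).1 else u.1,
      if sy * u.2 ≤ sy * (u - τ).2 then (u - τ).2 else u.2) with hz
    have hz1 : sx * u.1 ≤ sx * z.1 ∧ sx * (u - τ).1 ≤ sx * z.1 := by
      simp only [hz]; split_ifs <;> constructor <;> linarith
    have hz2 : sy * u.2 ≤ sy * z.2 ∧ sy * (u - τ).2 ≤ sy * z.2 := by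
      simp only [hz]; split_ifs <;> constructor <;> linarith
    have hact : I.Act (z.1 + sx * I.W, z.2) ∧ 0 ≤ z.1 ∧ z.1 < I.n := by
      -- The vectors `τ` and the quadrant are in general not aligned. The corner `z` has the height
      -- of the vertically outer point and is at most `|τ.1| ≤ W` away from it horizontally.
      by_cases hyy : sy * u.2 ≤ sy * (u - τ).2
      · refine d1'.act_near h hx s1' ?_ hz1.2 ?_
        · simp only [hz, if_pos hyy]
        · simp only [hz, Prod.fst_sub]
          rcases hx with rfl | rfl <;> split_ifs <;> omega
      · refine d1.act_near h hx s1 ?_ hz1.1 ?_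
        · simp only [hz, if_neg hyy]
        · simp only [hz, Prod.fst_sub]
          rcases hx with rfl | rfl <;> split_ifs <;> omega
    exact hE₂ u z hact.1 hact.2 s1 s2 s1' s2' hz1.1 hz2.1 hz1.2 hz2.2 hc
  have hD : 0 < I.φ.cross I.ψ := h.D_pos
  obtain ⟨cls, K, hK, hcK, hcong⟩ := exists_classes I.φ I.ψ h.psi1 hD
  obtain ⟨K', hK', hrows⟩ := hf.rows
  set E₀ := A.filter fun u => I.lab (u - ρ) ≠ I.lab u ∧ sτ u % aτ = 0 with hE₀
  -- The index along `τ` is a multiple of `aτ` here, so the lattice class and the row of blocks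
  -- determine the lattice row. Its points with this label are contiguous, hence have only one first
  -- point.
  have c₀ : E₀.card ≤ K.card * K'.card := by
    rw [← Finset.card_product]
    refine Finset.card_le_card_of_injOn (fun u => (cls u, sτ u / aτ)) ?_ ?_
    · intro u hu
      have hu' := (Finset.mem_filter.1 hu).1
      have ht := (deep_of_lab u (hA u hu').1).mem_text h
      simp only [Finset.coe_product, Set.mem_prod, Finset.mem_coe]
      exact ⟨hcK u, hrows u ht⟩
    · have key : ∀ u ∈ E₀, ∀ v ∈ E₀, ∀ j : ℤ, 0 < j → v ≠ u + j • ρ := by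
        rintro u hu v hv j hj rfl
        have hu' := Finset.mem_filter.1 hu
        have hv' := Finset.mem_filter.1 hv
        apply hv'.2.1
        have e : u + j • ρ - ρ = u + (j - 1) • ρ := by rw [sub_smul, one_smul]; abel
        rw [hAc _ hv'.1, e]
        exact hf.lab_between h hx hy hal (by omega) (by omega) (hAc _ hu'.1) (hAc _ hv'.1)
      intro u hu v hv he
      obtain ⟨e1, e2⟩ := Prod.mk.inj he
      obtain ⟨i, j, hij⟩ := hf.span _ _ (hcong u v e1)
      have hu' := (Finset.mem_filter.1 hu).2.2
      have hv' := (Finset.mem_filter.1 hv).2.2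
      have h3 := hf.s_tau v i j
      rw [← hij] at h3
      have h4 := Int.emod_add_mul_ediv (sτ u) aτ
      have h5 := Int.emod_add_mul_ediv (sτ v) aτ
      rw [e2] at h4
      have hi : i = 0 := by rw [hu'] at h4; rw [hv'] at h5; linarith
      subst hi
      rw [zero_smul, add_zero] at hij
      rcases lt_trichotomy j 0 with hj | rfl | hj
      · exfalso
        refine key u hu v hv (-j) (by omega) ?_
        rw [hij, neg_smul]; abel
      · simpa using hij
      · exact (key v hv u hu j hj hij).elim
  have hmain := hrun.card_starts_le (fun u => sτ u % aτ ≠ 0) A E₀ E₁ E₂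
    (fun u i hu => hrow u i hu) hA
    (fun u hu h1 h2 => Finset.mem_filter.2 ⟨hu, h1, by simpa using h2⟩) h₁ h₂
  have hKD : K.card ≤ I.D.toNat := by
    have : (K.card : ℤ) ≤ I.D := hK
    omega
  have hprod : K.card * K'.card ≤ I.D.toNat * (98 * I.l) := Nat.mul_le_mul hKD hK'
  calc A.card ≤ E₀.card + 3 * E₁.card + E₂.card := hmain
    _ ≤ I.D.toNat * (98 * I.l) + 3 * (25 * I.l * B) + 25 * I.l * B := by omega
    _ = _ := by ring

end Inst

/-! ### The standing assumptions imply the geometric ones -/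

theorem square_finite (n : ℕ) : (square n).Finite := by
  refine Set.Finite.subset
    ((Set.finite_Icc (0 : ℤ) n).prod (Set.finite_Icc (0 : ℤ) n)) fun u hu => ?_
  obtain ⟨⟨h1, h2⟩, h3, h4⟩ := hu
  exact ⟨⟨h1, h2.le⟩, h3, h4.le⟩

theorem Str.mem_dom_shift {P : Str} {q u : Point} : u ∈ (P.shift q).dom ↔ u - q ∈ P.dom :=
  Iff.rfl

namespace Candidates

variable {m n k : ℕ} {P T : Str} {Q : Finset Point}

theorem mem_shift_dom (h : Candidates m n k P T Q) (q u : Point) :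
    u ∈ (P.shift q).dom ↔ (q.1 ≤ u.1 ∧ u.1 < q.1 + m) ∧ q.2 ≤ u.2 ∧ u.2 < q.2 + m := by
  rw [Str.mem_dom_shift, h.dom_pattern]
  simp only [square, Set.mem_ofPred_eq, Prod.fst_sub, Prod.snd_sub]
  omega

theorem Q_mem (h : Candidates m n k P T Q) {q : Point} (hq : q ∈ Q) :
    (0 ≤ q.1 ∧ q.1 + m ≤ n) ∧ 0 ≤ q.2 ∧ q.2 + m ≤ n := by
  have hm := h.m_pos
  have h1 := h.valid q hq ((h.mem_shift_dom q q).2 (by omega))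
  have h2 := h.valid q hq
    ((h.mem_shift_dom q (q.1 + (m - 1), q.2 + (m - 1))).2 (by dsimp only; omega))
  rw [h.dom_text] at h1 h2
  simp only [square, Set.mem_ofPred_eq] at h1 h2
  omega

theorem nonempty (h : Candidates m n k P T Q) : Q.Nonempty := by
  rw [← Finset.card_pos]
  have h1 := h.large
  have h2 : (0 : ℝ) ≤ 8 * (m : ℝ) + (m : ℝ) ^ 2 / k := by positivity
  exact_mod_cast h2.trans_lt h1

/-- The mismatches of a candidate, as a finite set. -/
theorem exists_mismatches (h : Candidates m n k P T Q) {q : Point} (hq : q ∈ Q) :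
    ∃ A : Finset Point, A.card ≤ 2 * k ∧
      ∀ u, u ∈ (P.shift q).dom → T u ≠ P (u - q) → u ∈ A := by
  have hfin : (Str.mismatches T (P.shift q)).Finite := by
    refine (square_finite n).subset fun u hu => ?_
    rw [← h.dom_text]; exact hu.1
  refine ⟨hfin.toFinset, ?_, fun u hu hne => ?_⟩
  · rw [← Set.ncard_eq_toFinset_card _ hfin]
    exact h.sound q hq
  · rw [Set.Finite.mem_toFinset]
    exact ⟨h.valid q hq hu, hu, hne⟩

/-- Off four sets of at most 2k points each, T(u) = P(u - q) = T(u - q + q₂) = P(u - q + q₂ - q₁) =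
P(u - δ - q) = T(u - δ): the candidates q, q₂, q₁ and again q justify the comparisons of text and
pattern. -/
theorem exists_period_mismatches (h : Candidates m n k P T Q) {δ q₁ q₂ q : Point} (h₁ : q₁ ∈ Q)
    (h₂ : q₂ ∈ Q) (hδ : δ = q₁ - q₂) (hq : q ∈ Q) :
    ∃ M : Finset Point, M.card ≤ 8 * k ∧ ∀ u, u ∈ (P.shift q).dom → u - δ ∈ (P.shift q).dom →
      T (u - δ) ≠ T u → u ∈ M := by
  classical
  obtain ⟨A, cA, hA⟩ := h.exists_mismatches hq
  obtain ⟨A₁, cA₁, hA₁⟩ := h.exists_mismatches h₁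
  obtain ⟨A₂, cA₂, hA₂⟩ := h.exists_mismatches h₂
  refine ⟨A ∪ A.image (· + δ) ∪ A₁.image (· - q₂ + q) ∪ A₂.image (· - q₂ + q), ?_, ?_⟩
  · have c1 : (A.image (· + δ)).card ≤ A.card := Finset.card_image_le
    have c2 : (A₁.image (· - q₂ + q)).card ≤ A₁.card := Finset.card_image_le
    have c3 : (A₂.image (· - q₂ + q)).card ≤ A₂.card := Finset.card_image_le
    have u1 := Finset.card_union_le A (A.image (· + δ))
    have u2 := Finset.card_union_le (A ∪ A.image (· + δ)) (A₁.image (· - q₂ + q))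
    have u3 := Finset.card_union_le (A ∪ A.image (· + δ) ∪ A₁.image (· - q₂ + q))
      (A₂.image (· - q₂ + q))
    omega
  · intro u hu hu' hne
    simp only [Finset.mem_union, Finset.mem_image]
    by_contra hcon
    simp only [not_or, not_exists, not_and] at hcon
    obtain ⟨⟨⟨n1, n2⟩, n3⟩, n4⟩ := hcon
    have e1 : T u = P (u - q) := by_contra fun hc => n1 (hA u hu hc)
    have e2 : T (u - δ) = P (u - δ - q) := by_contra fun hc =>
      n2 (u - δ) (hA _ hu' hc) (sub_add_cancel _ _)
    have y1 : u - q + q₂ - q₁ = u - δ - q := by rw [hδ]; abel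
    have y2 : u - q + q₂ - q₂ = u - q := by abel
    have y3 : u - q + q₂ - q₂ + q = u := by abel
    have e3 : T (u - q + q₂) = P (u - q) := by
      by_contra hc
      refine n4 (u - q + q₂) (hA₂ _ ?_ (by rwa [y2])) y3
      rw [Str.mem_dom_shift, y2]; exact hu
    have e4 : T (u - q + q₂) = P (u - δ - q) := by
      by_contra hc
      refine n3 (u - q + q₂) (hA₁ _ ?_ (by rwa [y1])) y3
      rw [Str.mem_dom_shift, y1]; exact hu'
    exact hne (by rw [e1, e2, ← e3, ← e4])

theorem mismatchBound (h : Candidates m n k P T Q) (l : ℕ) (φ ψ : Point) {δ : Point}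
    (hδ : ∃ u ∈ Q, ∃ v ∈ Q, δ = u - v) : Inst.MismatchBound ⟨m, n, l, φ, ψ, T, Q⟩ δ (8 * k) := by
  intro q hq
  obtain ⟨q₁, h₁, q₂, h₂, e⟩ := hδ
  obtain ⟨M, hM, hM'⟩ := h.exists_period_mismatches h₁ h₂ e hq
  refine ⟨M, hM, fun u hu hu' hne => hM' u ((h.mem_shift_dom q u).2 hu)
    ((h.mem_shift_dom q _).2 hu') fun he => hne ?_⟩
  simp only [Inst.col]
  exact congrArg (fun o : Option ℤ => o.getD 0) he

end Candidates

/-! ### Consequences of the assumptions on φ and ψ. -/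

namespace BasisPair

variable {C₀ : ℝ} {m n : ℕ} {Q : Finset Point} {φ ψ : Point}

theorem len_pos {u : Point} (hu : 0 < u.1 ∨ u.2 < 0) : 0 < u.len := by
  apply Real.sqrt_pos.2
  rcases hu with hu | hu
  · have : (0 : ℝ) < u.1 := by exact_mod_cast hu
    positivity
  · have : (u.2 : ℝ) < 0 := by exact_mod_cast hu
    have := sq_pos_of_neg this
    positivity

theorem len_sq (u : Point) : u.len ^ 2 = (u.1 : ℝ) ^ 2 + (u.2 : ℝ) ^ 2 :=
  Real.sq_sqrt (by positivity)

theorem D_pos (h : BasisPair C₀ m n Q φ ψ) : 0 < φ.1 * ψ.2 - φ.2 * ψ.1 := by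
  have := mul_nonneg h.phi_quadrant.1 h.psi_quadrant.2
  have := mul_pos (neg_pos.2 h.phi_quadrant.2) h.psi_quadrant.1
  linarith

/-- The ℓ¹-length of a vector is at most √2 times its Euclidean length, so the product is at most
2|ψ||φ|, and the bound on the sine turns this into four times the determinant. -/
theorem four_D (h : BasisPair C₀ m n Q φ ψ) :
    (φ.1 - φ.2) * (ψ.1 + ψ.2) ≤ 4 * (φ.1 * ψ.2 - φ.2 * ψ.1) := by
  have p1 := len_pos (u := φ) (.inr h.phi_quadrant.2)
  have p2 := len_pos (u := ψ) (.inl h.psi_quadrant.1)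
  have hD := h.D_pos
  have hs := h.sin_angle
  rw [le_div_iff₀ (mul_pos p2 p1)] at hs
  have e : (ψ.cross φ : ℝ) = -((φ.1 : ℝ) * ψ.2 - φ.2 * ψ.1) := by
    simp only [Point.cross]; push_cast; ring
  have hD' : (0 : ℝ) < (φ.1 : ℝ) * ψ.2 - φ.2 * ψ.1 := by exact_mod_cast hD
  rw [e, abs_neg, abs_of_pos hD'] at hs
  have s2 : ((φ.1 : ℝ) - φ.2) ^ 2 ≤ 2 * φ.len ^ 2 := by
    rw [len_sq]; nlinarith [sq_nonneg ((φ.1 : ℝ) + φ.2)]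
  have s3 : ((ψ.1 : ℝ) + ψ.2) ^ 2 ≤ 2 * ψ.len ^ 2 := by
    rw [len_sq]; nlinarith [sq_nonneg ((ψ.1 : ℝ) - ψ.2)]
  have s4 : (((φ.1 : ℝ) - φ.2) * (ψ.1 + ψ.2)) ^ 2 ≤ (2 * (ψ.len * φ.len)) ^ 2 := by
    calc (((φ.1 : ℝ) - φ.2) * (ψ.1 + ψ.2)) ^ 2
        = ((φ.1 : ℝ) - φ.2) ^ 2 * ((ψ.1 : ℝ) + ψ.2) ^ 2 := by ring
      _ ≤ (2 * φ.len ^ 2) * (2 * ψ.len ^ 2) := mul_le_mul s2 s3 (by positivity) (by positivity)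
      _ = _ := by ring
  have s5 := (abs_le_of_sq_le_sq' s4 (by positivity)).2
  have s6 : ((φ.1 : ℝ) - φ.2) * (ψ.1 + ψ.2) ≤ 4 * ((φ.1 : ℝ) * ψ.2 - φ.2 * ψ.1) := by linarith
  exact_mod_cast s6

/-- The determinant is at most |ψ||φ| ≤ C₀(n - m)²/|Q|, and the last quotient is at most k because n
- m ≤ m/2 and |Q| > m²/k. -/
theorem D_le (h : BasisPair C₀ m n Q φ ψ) {k : ℕ} {P T : Str} (hc : Candidates m n k P T Q) :
    (φ.1 * ψ.2 - φ.2 * ψ.1).toNat ≤ ⌈C₀⌉₊ * k := by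
  have hD := h.D_pos
  have hD' : (0 : ℝ) < (φ.1 : ℝ) * ψ.2 - φ.2 * ψ.1 := by exact_mod_cast hD
  have p1 := len_pos (u := φ) (.inr h.phi_quadrant.2)
  have p2 := len_pos (u := ψ) (.inl h.psi_quadrant.1)
  have hle : (φ.1 : ℝ) * ψ.2 - φ.2 * ψ.1 ≤ ψ.len * φ.len := by
    refine (abs_le_of_sq_le_sq' ?_ (by positivity)).2
    rw [mul_pow, len_sq, len_sq]
    nlinarith [sq_nonneg ((φ.1 : ℝ) * ψ.1 + φ.2 * ψ.2)]
  have hk : (0 : ℝ) < k := by exact_mod_cast hc.k_pos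
  have hQ : (0 : ℝ) < Q.card := by exact_mod_cast Finset.card_pos.2 hc.nonempty
  have hm : (0 : ℝ) ≤ m := by positivity
  have hnm : (m : ℝ) ≤ n := by exact_mod_cast hc.m_le
  have hnm2 : 2 * (n : ℝ) ≤ 3 * m := by exact_mod_cast hc.n_le
  have hfrac : ((n : ℝ) - m) ^ 2 / Q.card ≤ k := by
    rw [div_le_iff₀ hQ]
    have h1 := hc.large
    have h2 : (m : ℝ) ^ 2 / k ≤ Q.card := by linarith
    rw [div_le_iff₀ hk] at h2
    nlinarith
  have hfrac0 : 0 ≤ ((n : ℝ) - m) ^ 2 / Q.card := by positivity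
  have h3 := hle.trans h.len_mul_len
  -- Positivity of the constant is not assumed; it follows from that of the determinant.
  have hC : 0 < C₀ := by
    by_contra hneg
    have := mul_nonpos_of_nonpos_of_nonneg (not_lt.1 hneg) hfrac0
    linarith
  have h4 : (φ.1 : ℝ) * ψ.2 - φ.2 * ψ.1 ≤ ⌈C₀⌉₊ * k := by
    refine h3.trans ((mul_le_mul_of_nonneg_left hfrac hC.le).trans ?_)
    exact mul_le_mul_of_nonneg_right (Nat.le_ceil _) hk.le
  have h5 : φ.1 * ψ.2 - φ.2 * ψ.1 ≤ ((⌈C₀⌉₊ * k : ℕ) : ℤ) := by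
    have : ((φ.1 * ψ.2 - φ.2 * ψ.1 : ℤ) : ℝ) ≤ (((⌈C₀⌉₊ * k : ℕ) : ℤ) : ℝ) := by
      push_cast; exact h4
    exact_mod_cast this
  omega

theorem valid (h : BasisPair C₀ m n Q φ ψ) {k l : ℕ} {P T : Str}
    (hc : Candidates m n k P T Q) (hl : 0 < l) : Inst.Valid ⟨m, n, l, φ, ψ, T, Q⟩ := by
  have hd : ∀ δ : Point, (∃ u ∈ Q, ∃ v ∈ Q, δ = u - v) →
      (δ.1 + m ≤ n ∧ -δ.2 + m ≤ n) ∧ δ.2 + m ≤ n := by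
    rintro δ ⟨u, hu, v, hv, rfl⟩
    have := hc.Q_mem hu
    have := hc.Q_mem hv
    simp only [Prod.fst_sub, Prod.snd_sub]
    omega
  have h1 := hd φ h.phi_diff
  have h2 := hd ψ h.psi_diff
  exact ⟨hc.m_pos, hl, hc.m_le, hc.n_le, hc.n_even, h.phi_quadrant.1, h.phi_quadrant.2,
    h.psi_quadrant.1, h.psi_quadrant.2, h1.1.1, h1.1.2, h2.1.1, h2.2, fun q hq => hc.Q_mem hq,
    hc.dom_text, h.four_D⟩

end BasisPair

/-! ### Loops over the grid -/

instance : Add GExpr := ⟨.op .add⟩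
instance : Sub GExpr := ⟨.op .sub⟩
instance : Mul GExpr := ⟨.op .mul⟩

namespace GExpr

/-- Comparison of two expressions. -/
def lt (e f : GExpr) : GExpr := .op .slt e f

/-- Equality of two expressions. -/
def eqv (e f : GExpr) : GExpr := .op .eq e f

variable (w : ℕ) (L : Layout) (s : GState) (e f : GExpr)

@[simp] theorem val_lit (a : ℤ) : (lit a).val L s = a := rfl
@[simp] theorem val_reg (x : ℕ) : (reg x).val L s = s.reg x := rfl
@[simp] theorem val_add : (e + f).val L s = e.val L s + f.val L s := rfl
@[simp] theorem val_sub : (e - f).val L s = e.val L s - f.val L s := rfl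
@[simp] theorem val_mul : (e * f).val L s = e.val L s * f.val L s := rfl
@[simp] theorem val_div : (op .udiv e f).val L s = e.val L s / f.val L s := rfl
@[simp] theorem val_mod : (op .umod e f).val L s = e.val L s % f.val L s := rfl
@[simp] theorem val_lt : (lt e f).val L s = if e.val L s < f.val L s then 1 else 0 := rfl
@[simp] theorem val_eqv : (eqv e f).val L s = if e.val L s = f.val L s then 1 else 0 := rfl
@[simp] theorem val_get (i : ℕ) : (get i e f).val L s = s.fld i (e.val L s, f.val L s) := rfl
@[simp] theorem val_inp : (inp e).val L s = L.input (e.val L s).toNat := rfl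
@[simp] theorem ok_lit (a : ℤ) : (lit a).ok w L s := trivial
@[simp] theorem ok_reg (x : ℕ) : (reg x).ok w L s := trivial
@[simp] theorem ok_add : (e + f).ok w L s ↔ e.ok w L s ∧ f.ok w L s := by
  show _ ∧ _ ∧ True ↔ _; simp
@[simp] theorem ok_sub : (e - f).ok w L s ↔ e.ok w L s ∧ f.ok w L s := by
  show _ ∧ _ ∧ True ↔ _; simp
@[simp] theorem ok_mul : (e * f).ok w L s ↔ e.ok w L s ∧ f.ok w L s := by
  show _ ∧ _ ∧ True ↔ _; simp
@[simp] theorem ok_div : (op .udiv e f).ok w L s ↔ e.ok w L s ∧ f.ok w L s ∧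
    (0 ≤ e.val L s ∧ InRange w (e.val L s)) ∧ (0 ≤ f.val L s ∧ InRange w (f.val L s)) := Iff.rfl
@[simp] theorem ok_mod : (op .umod e f).ok w L s ↔ e.ok w L s ∧ f.ok w L s ∧
    (0 ≤ e.val L s ∧ InRange w (e.val L s)) ∧ (0 ≤ f.val L s ∧ InRange w (f.val L s)) := Iff.rfl
@[simp] theorem ok_lt : (lt e f).ok w L s ↔ e.ok w L s ∧ f.ok w L s ∧
    InRange w (e.val L s) ∧ InRange w (f.val L s) := Iff.rfl
@[simp] theorem ok_eqv : (eqv e f).ok w L s ↔ e.ok w L s ∧ f.ok w L s ∧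
    InRange w (e.val L s) ∧ InRange w (f.val L s) := Iff.rfl
@[simp] theorem ok_get (i : ℕ) : (get i e f).ok w L s ↔ i < 8 ∧ e.ok w L s ∧ f.ok w L s ∧
    (0 ≤ e.val L s ∧ e.val L s < L.side) ∧ (0 ≤ f.val L s ∧ f.val L s < L.side) := Iff.rfl
@[simp] theorem ok_inp : (inp e).ok w L s ↔ e.ok w L s ∧ 0 ≤ e.val L s ∧ e.val L s < L.base :=
  Iff.rfl

end GExpr

@[simp] theorem GState.setReg_fld (s : GState) (x : ℕ) (v : ℤ) : (s.setReg x v).fld = s.fld := rfl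
@[simp] theorem GState.setReg_out (s : GState) (x : ℕ) (v : ℤ) : (s.setReg x v).out = s.out := rfl
@[simp] theorem GState.putFld_reg (s : GState) (f : ℕ) (p : Point) (v : ℤ) :
    (s.putFld f p v).reg = s.reg := rfl
@[simp] theorem GState.emitVal_reg (s : GState) (v : ℤ) : (s.emitVal v).reg = s.reg := rfl
@[simp] theorem GState.emitVal_fld (s : GState) (v : ℤ) : (s.emitVal v).fld = s.fld := rfl
@[simp] theorem GState.emitVal_out (s : GState) (v : ℤ) :
    (s.emitVal v).out = s.out ++ [v] := rfl
@[simp] theorem GState.patchVal_reg (s : GState) (i : ℕ) (v : ℤ) :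
    (s.patchVal i v).reg = s.reg := rfl
@[simp] theorem GState.setReg_reg_self (s : GState) (x : ℕ) (v : ℤ) :
    (s.setReg x v).reg x = v := by simp [GState.setReg]

theorem GState.setReg_reg_ne (s : GState) {x y : ℕ} (v : ℤ) (h : y ≠ x) :
    (s.setReg x v).reg y = s.reg y := by simp [GState.setReg, h]

@[simp] theorem GState.setReg_reg (s : GState) (x y : ℕ) (v : ℤ) :
    (s.setReg x v).reg y = if y = x then v else s.reg y := by
  simp [GState.setReg, Function.update_apply]

/-- The offset of the grid. -/
def gridOffset (n : ℕ) : Point := (2 * n, 2 * n)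

/-- The work area, in the order in which it is processed. -/
def area (n : ℕ) : List Point :=
  (List.range (3 * n)).flatMap fun i : ℕ => (List.range (3 * n)).map fun j : ℕ =>
    ((2 * n - 1 - (i : ℤ) : ℤ), ((j : ℤ) - n : ℤ))

/-- `v` is processed before `u`. -/
def Before (v u : Point) : Prop := u.1 < v.1 ∨ (v.1 = u.1 ∧ v.2 < u.2)

theorem mem_area {n : ℕ} {u : Point} :
    u ∈ area n ↔ (-(n : ℤ) ≤ u.1 ∧ u.1 < 2 * n) ∧ -(n : ℤ) ≤ u.2 ∧ u.2 < 2 * n := by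
  simp only [area, List.mem_flatMap, List.mem_map, List.mem_range]
  constructor
  · rintro ⟨i, hi, j, hj, rfl⟩
    dsimp only
    omega
  · rintro h
    exact ⟨(2 * n - 1 - u.1).toNat, by omega, (u.2 + n).toNat, by omega, by
      ext <;> dsimp only <;> omega⟩

theorem area_pairwise (n : ℕ) : (area n).Pairwise Before := by
  unfold area
  rw [List.pairwise_flatMap]
  constructor
  · intro i hi
    rw [List.pairwise_map]
    refine List.Pairwise.imp ?_ List.pairwise_lt_range
    intro a b hab
    right
    exact ⟨rfl, by dsimp only; omega⟩
  · refine List.Pairwise.imp ?_ List.pairwise_lt_range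
    intro a b hab x hx y hy
    simp only [List.mem_map] at hx hy
    obtain ⟨_, _, rfl⟩ := hx
    obtain ⟨_, _, rfl⟩ := hy
    left
    dsimp only; omega

theorem Before.asymm {u v : Point} (h : Before u v) : ¬ Before v u := by
  unfold Before at *; omega

theorem Before.ne {u v : Point} (h : Before u v) : u ≠ v := by
  rintro rfl; unfold Before at h; omega

theorem area_nodup (n : ℕ) : (area n).Nodup :=
  (area_pairwise n).imp fun h => h.ne

theorem before_of_mem {n : ℕ} {pre post : List Point} {u v : Point}
    (h : area n = pre ++ u :: post) (hv : v ∈ pre) : Before v u := by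
  have := area_pairwise n
  rw [h, List.pairwise_append] at this
  exact this.2.2 v hv u (by simp)

theorem length_area (n : ℕ) : (area n).length = 9 * n ^ 2 := by
  simp [area, List.length_flatMap]; ring

/-! ### Invariants for sweeps over the work area. -/

namespace GCmd

/-- The loop over the work area. -/
def grid (c : GCmd) : GCmd :=
  .loop 20 (.lit 3 * .reg 0)
    (.seq (.set 22 (.lit 4 * .reg 0 - .lit 1 - .reg 20))
      (.loop 21 (.lit 3 * .reg 0) (.seq (.set 23 (.reg 0 + .reg 21)) c)))

/-- Indexing the invariant by the list of points already processed hides the two nested counters;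
`hst` asks that it ignore the registers 20 to 23 that control them. -/
theorem runs_grid {w : ℕ} {L : Layout} (hL : (L.outBase : ℤ) ≤ 2 ^ w) {n : ℕ}
    (hn : 0 < n) (hN : GExpr.InRange w ((3 * n : ℕ) : ℤ)) {c : GCmd} (T : Point → ℕ)
    (J : List Point → GState → Prop) {s : GState}
    (hreg : ∀ pre s', J pre s' → s'.reg 0 = n)
    (hst : ∀ pre s' x v, 20 ≤ x → x ≤ 23 → J pre s' → J pre (s'.setReg x v))
    (h0 : J [] s)
    (hc : ∀ pre u post s', area n = pre ++ u :: post → J pre s' → s'.reg 22 = u.1 + 2 * n →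
      s'.reg 23 = u.2 + 2 * n →
      c.Runs w L (T u) s' fun s'' => J (pre ++ [u]) s'' ∧ s''.reg 20 = s'.reg 20 ∧
        s''.reg 21 = s'.reg 21 ∧ s''.reg 22 = s'.reg 22) :
    (grid c).Runs w L (((area n).map T).sum + 212 * n ^ 2) s fun s' => J (area n) s' := by
  set pt : ℕ → ℕ → Point := fun i j => ((2 * n - 1 - i : ℤ), (j - n : ℤ)) with hpt
  set row : ℕ → List Point := fun i => (List.range (3 * n)).map (pt i) with hrow
  set pre : ℕ → List Point := fun i => (List.range i).flatMap row with hpre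
  have hpre' : ∀ i, pre (i + 1) = pre i ++ row i := by
    intro i; simp [hpre, List.range_succ, List.flatMap_append]
  have harea : area n = pre (3 * n) := rfl
  have hsplit : ∀ i j, i < 3 * n → j < 3 * n → ∃ post,
      area n = (pre i ++ (List.range j).map (pt i)) ++ pt i j :: post := by
    intro i j hi hj
    obtain ⟨d, hd⟩ : ∃ d, 3 * n = j + 1 + d := ⟨3 * n - (j + 1), by omega⟩
    obtain ⟨d', hd'⟩ : ∃ d', 3 * n = i + 1 + d' := ⟨3 * n - (i + 1), by omega⟩
    have e1 : row i = (List.range j).map (pt i) ++ pt i j ::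
        (List.range d).map (fun x => pt i (j + 1 + x)) := by
      simp only [hrow]
      rw [hd, List.range_add, List.map_append, List.range_succ, List.map_append, List.map_map]
      simp [Function.comp_def]
    have e2 : pre (3 * n) = pre (i + 1) ++
        (List.range d').flatMap (fun x => row (i + 1 + x)) := by
      simp only [hpre]
      rw [hd', List.range_add, List.flatMap_append, List.flatMap_map]
    rw [harea, e2, hpre', e1]
    exact ⟨(List.range d).map (fun x => pt i (j + 1 + x)) ++
      (List.range d').flatMap (fun x => row (i + 1 + x)), by simp⟩
  set Ti : ℕ → ℕ := fun i => (∑ j ∈ Finset.range (3 * n), (T (pt i j) + 14)) + 16 with hTi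
  have hsum : ((area n).map T).sum =
      ∑ i ∈ Finset.range (3 * n), ∑ j ∈ Finset.range (3 * n), T (pt i j) := by
    rw [harea]
    simp only [hpre, hrow, List.map_flatMap, List.map_map]
    rw [List.flatMap, List.sum_flatten, List.map_map, Finset.sum_range, ← List.sum_ofFn]
    congr 1
    rw [List.ofFn_eq_map, ← List.map_coe_finRange_eq_range, List.map_map]
    refine List.map_congr_left fun i _ => ?_
    simp only [Function.comp]
    rw [Finset.sum_range, ← List.sum_ofFn, List.ofFn_eq_map, List.map_map]
    rfl
  have hmain := Runs.loop hL (x := 20) (e := .lit 3 * .reg 0)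
    (c := .seq (.set 22 (.lit 4 * .reg 0 - .lit 1 - .reg 20))
      (.loop 21 (.lit 3 * .reg 0) (.seq (.set 23 (.reg 0 + .reg 21)) c))) hN Ti
    (fun i s' => J (pre i) s' ∧ s'.reg 20 = i) (s := s)
    ⟨hst _ _ _ _ (by norm_num) (by norm_num) h0, by simp⟩ (fun i s' h => h.2)
    (fun i s' _ h => ⟨by simp, by simp [hreg _ _ h.1]⟩) ?_
  · refine Runs.mono hmain ?_ fun s' h => h.1
    have hcost : (GExpr.lit 3 * GExpr.reg 0).comp.cost = 3 := rfl
    rw [hsum, hcost]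
    simp only [hTi, Finset.sum_add_distrib, Finset.sum_const, Finset.card_range, smul_eq_mul]
    -- The overhead is `126 n ^ 2 + 78 n + 8`, from 14 steps per point and 26 per column.
    nlinarith
  · rintro i s' hi ⟨hJ, hi20⟩
    refine Runs.mono (T := 8 + (∑ j ∈ Finset.range (3 * n), ((4 + T (pt i j)) + 10) + 8))
      (Q := fun s'' => s''.reg 20 = i ∧ J (pre (i + 1)) s'') ?_ ?_ ?_
    · refine Runs.seq (Q := fun s'' => J (pre i) s'' ∧ s''.reg 20 = i ∧
        s''.reg 22 = (pt i 0).1 + 2 * n) ?_ ?_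
      · refine runs_of_wp hL _ _ _ ?_
        simp only [wp]
        refine ⟨by simp, hst _ _ _ _ (by norm_num) (by norm_num) hJ, by simp [hi20], ?_⟩
        simp [hreg _ _ hJ, hi20, hpt]
        ring
      · rintro s1 ⟨hJ1, h20, h22⟩
        refine Runs.mono (Runs.loop hL (x := 21) (e := .lit 3 * .reg 0) hN
          (fun j => 4 + T (pt i j))
          (fun j s'' => J (pre i ++ (List.range j).map (pt i)) s'' ∧ s''.reg 20 = i ∧
            s''.reg 22 = (pt i 0).1 + 2 * n ∧ s''.reg 21 = j) (s := s1) ?_ ?_ ?_ ?_)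
          (le_of_eq rfl) ?_
        · refine ⟨by simpa using hst _ _ _ _ (by norm_num) (by norm_num) hJ1, by simp [h20],
            by simp [h22], by simp⟩
        · exact fun j s'' h => h.2.2.2
        · exact fun j s'' _ h => ⟨by simp, by simp [hreg _ _ h.1]⟩
        · rintro j s2 hj ⟨hJ2, g20, g22, g21⟩
          obtain ⟨post, hpost⟩ := hsplit i j hi hj
          refine Runs.seq (T := 4) (Q := fun s'' => J (pre i ++ (List.range j).map (pt i)) s'' ∧
            s''.reg 20 = i ∧ s''.reg 22 = (pt i j).1 + 2 * n ∧ s''.reg 21 = j ∧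
            s''.reg 23 = (pt i j).2 + 2 * n) ?_ ?_
          · refine runs_of_wp hL (.set 23 (.reg 0 + .reg 21)) _ _ ?_
            simp only [wp]
            refine ⟨by simp, hst _ _ _ _ (by norm_num) (by norm_num) hJ2, by simp [g20],
              by simp [g22, hpt], by simp [g21], ?_⟩
            simp [hreg _ _ hJ2, g21, hpt]
            ring
          · rintro s3 ⟨hJ3, k20, k22, k21, k23⟩
            refine Runs.mono (hc _ _ _ s3 hpost hJ3 k22 k23) le_rfl ?_
            rintro s4 ⟨hJ4, l20, l21, l22⟩
            refine ⟨by rw [l21, k21], hst _ _ _ _ (by norm_num) (by norm_num) ?_, ?_, ?_, ?_⟩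
            · rw [List.range_succ, List.map_append, ← List.append_assoc]
              exact hJ4
            · simp [l20, k20]
            · simp [l22, k22, hpt]
            · simp
        · rintro s2 ⟨hJ2, g20, -, -⟩
          exact ⟨g20, by rw [hpre']; exact hJ2⟩
    · simp only [hTi]
      rw [← add_assoc, add_comm 8, add_assoc]
      refine Nat.add_le_add (Finset.sum_le_sum fun j _ => ?_) (by norm_num)
      omega
    · rintro s'' ⟨h1, h2⟩
      exact ⟨h1, hst _ _ _ _ (by norm_num) (by norm_num) h2, by simp⟩

/-- The states agree, except for the field `f` and the registers that control the grid loop. -/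
structure Agree (f : ℕ) (s s' : GState) : Prop where
  reg : ∀ x, x < 20 ∨ 24 ≤ x → s'.reg x = s.reg x
  fld : ∀ g, g ≠ f → s'.fld g = s.fld g
  out : s'.out = s.out

/-- A pass over the work area that tabulates a function given by a recursion. -/
theorem runs_pass {w : ℕ} {L : Layout} (hL : (L.outBase : ℤ) ≤ 2 ^ w) {n : ℕ}
    (hn : 0 < n) (hN : GExpr.InRange w ((3 * n : ℕ) : ℤ)) (hside : L.side = 5 * n) {f : ℕ}
    (hf : f < 8) {e : GExpr} {s : GState} (hs : s.reg 0 = n) (Bd : ℤ → Prop)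
    (hBd : ∀ p, Bd (s.fld f p)) (E : (Point → ℤ) → Point → ℤ)
    (hE : ∀ s' u, u ∈ area n → Agree f s s' → (∀ p, Bd (s'.fld f p)) →
      s'.reg 22 = u.1 + 2 * n → s'.reg 23 = u.2 + 2 * n →
      e.ok w L s' ∧ e.val L s' = E (s'.fld f) u ∧ Bd (E (s'.fld f) u))
    (hloc : ∀ g g' u, u ∈ area n →
      (∀ p, (∀ v ∈ area n, p = v + gridOffset n → Before v u) → g p = g' p) → E g u = E g' u) :
    (grid (.put f (.reg 22) (.reg 23) e)).Runs w L
      ((9 * (GCmd.put f (.reg 22) (.reg 23) e).maxTime + 212) * n ^ 2) s fun s' => Agree f s s' ∧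
        (∀ p, Bd (s'.fld f p)) ∧
        (∀ p, (∀ v ∈ area n, p ≠ v + gridOffset n) → s'.fld f p = s.fld f p) ∧
        ∀ u ∈ area n, s'.fld f (u + gridOffset n) = E (s'.fld f) u := by
  refine Runs.mono (runs_grid hL hn hN
    (fun _ => (GCmd.put f (.reg 22) (.reg 23) e).maxTime)
    (fun pre s' => Agree f s s' ∧ (∀ p, Bd (s'.fld f p)) ∧
        (∀ p, (∀ v ∈ pre, p ≠ v + gridOffset n) → s'.fld f p = s.fld f p) ∧
        ∀ u ∈ pre, s'.fld f (u + gridOffset n) = E (s'.fld f) u) ?_ ?_ ?_ ?_) ?_ fun s' h => h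
  · rintro pre s' ⟨h, -⟩
    rw [h.reg 0 (by norm_num), hs]
  · rintro pre s' x v hx hx' ⟨h1, h2⟩
    refine ⟨⟨fun y hy => ?_, h1.fld, h1.out⟩, h2⟩
    rw [GState.setReg_reg_ne _ _ (by omega)]
    exact h1.reg y hy
  · exact ⟨⟨fun _ _ => rfl, fun _ _ => rfl, rfl⟩, hBd, fun _ _ => rfl, by simp⟩
  · rintro pre u post s' hsp ⟨hA, hB, hout, hpre⟩ h22 h23
    have hu : u ∈ area n := by rw [hsp]; simp
    obtain ⟨hok, hval, hbd⟩ := hE s' u hu hA hB h22 h23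
    refine runs_of_wp hL _ _ _ ?_
    have hu' := mem_area.1 hu
    have hp : (s'.reg 22, s'.reg 23) = u + gridOffset n := by
      rw [h22, h23]; rfl
    simp only [wp, GExpr.ok_get, GExpr.val_reg, GExpr.ok_reg, hp, hval]
    refine ⟨⟨hf, trivial, trivial, ?_, ?_⟩, hok, ⟨⟨?_, ?_, ?_⟩, ?_, ?_, ?_⟩, ?_⟩
    · rw [h22, hside]; push_cast; omega
    · rw [h23, hside]; push_cast; omega
    · exact hA.reg
    · intro g hg
      simp only [GState.putFld, Function.update_of_ne hg]
      exact hA.fld g hg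
    · exact hA.out
    · intro p
      simp only [GState.putFld, Function.update_self, Function.update_apply]
      split_ifs
      · exact hbd
      · exact hB p
    · intro p hp
      simp only [GState.putFld, Function.update_self]
      rw [Function.update_of_ne (hp u (by simp))]
      exact hout p fun v hv => hp v (by simp [hv])
    -- The value of `E` at `v` depends only on cells before `v` or outside the area, so entries
    -- tabulated earlier still solve the recursion after the write at `u`.
    · have hE' : ∀ v, v ∈ area n → ¬ Before u v →
          E (Function.update (s'.fld f) (u + gridOffset n) (E (s'.fld f) u)) v =
            E (s'.fld f) v := by
        intro v hv hb
        refine hloc _ _ v hv fun p hp => ?_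
        rw [Function.update_of_ne]
        intro hpu
        exact hb (hp u hu hpu)
      intro v hv
      simp only [GState.putFld, Function.update_self]
      rw [List.mem_append, List.mem_singleton] at hv
      rcases hv with hv | rfl
      · have hb := before_of_mem hsp hv
        have hva : v ∈ area n := by rw [hsp]; simp [hv]
        rw [hE' v hva hb.asymm, Function.update_of_ne]
        · exact hpre v hv
        · intro h; exact hb.ne (add_right_cancel h)
      · rw [hE' v hu fun h => h.ne rfl, Function.update_self]
    · exact ⟨rfl, rfl, rfl⟩
  · simp only [List.map_const', List.sum_replicate, smul_eq_mul, length_area]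
    exact le_of_eq (by ring)

end GCmd

/-! ### The program -/

namespace Prog

open GExpr GCmd

/-- The current grid coordinates. -/
def gx : GExpr := .reg 22
/-- The current grid coordinates. -/
def gy : GExpr := .reg 23

/-- Reading the parameters. -/
def setup : GCmd :=
  .seq (.set 0 (.inp (.lit 1))) <| .seq (.set 1 (.inp (.lit 0))) <|
  .seq (.set 2 (.inp (.lit 4))) <| .seq (.set 3 (.inp (.lit 5))) <|
  .seq (.set 4 (.inp (.lit 6))) <| .seq (.set 5 (.inp (.lit 7))) <|
  .seq (.set 6 (.reg 2 * .reg 5 - .reg 3 * .reg 4)) <|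
  .seq (.set 7 (.lit 1 + .op .udiv (.reg 1) (.lit 16 * .inp (.lit 3) * (.reg 2 - .reg 3)))) <|
  .seq (.set 8 (.lit 1 + .op .udiv (.reg 1) (.lit 16 * .inp (.lit 3) * (.reg 4 + .reg 5)))) <|
  .seq (.set 9 (.lit 2 * .op .udiv (.reg 1) (.lit 16 * .inp (.lit 3)))) <|
  .seq (.set 10 (.lit 9 + .lit 3 * .inp (.lit 8))) <|
  .set 11 (.reg 10 + .lit 1 + .lit 3 * .inp (.reg 10))

/-- Storing the text in the grid. -/
def loadText : GCmd :=
  .loop 20 (.inp (.reg 10))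
    (.put 0 (.inp (.reg 10 + .lit 1 + .lit 3 * .reg 20) + .lit 2 * .reg 0)
      (.inp (.reg 10 + .lit 2 + .lit 3 * .reg 20) + .lit 2 * .reg 0)
      (.inp (.reg 10 + .lit 3 + .lit 3 * .reg 20)))

/-- Marking the lower right corners of the squares. -/
def loadMarks : GCmd :=
  .loop 20 (.inp (.reg 11))
    (.put 1 (.inp (.reg 11 + .lit 1 + .lit 2 * .reg 20) + .lit 2 * .reg 0 + .reg 1 - .lit 1)
      (.inp (.reg 11 + .lit 2 + .lit 2 * .reg 20) + .lit 2 * .reg 0) (.lit 1))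

/-- One step of a timer: it is restarted at marks. -/
def timer (mark prev : GExpr) : GExpr :=
  mark * .reg 1 + (.lit 1 - mark) * (lt (.lit 0) prev * (prev - .lit 1))

/-- Spreading the marks horizontally. -/
def spreadX : GCmd := grid (.put 2 gx gy (timer (.get 1 gx gy) (.get 2 (gx + .lit 1) gy)))

/-- Spreading the marks vertically. -/
def spreadY : GCmd :=
  grid (.put 3 gx gy (timer (lt (.lit 0) (.get 2 gx gy)) (.get 3 gx (gy - .lit 1))))

/-- The index of the current point in its block along `φ`. -/
def idxS : GExpr :=
  .op .umod (.op .udiv (gx * .reg 5 + (.lit 5 * .reg 0 - gy) * .reg 4) (.reg 6)) (.reg 7)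

/-- The index of the current point in its block along `ψ`. -/
def idxR : GExpr := .op .umod (.op .udiv (gy * .reg 2 - gx * .reg 3) (.reg 6)) (.reg 8)

/-- The reference point of the current point. -/
def refX : GExpr := gx - idxS * .reg 2 - idxR * .reg 4
/-- The reference point of the current point. -/
def refY : GExpr := gy - idxS * .reg 3 - idxR * .reg 5

/-- Whether the current point is deep. -/
def deepE : GExpr := lt (.lit 0) (.get 3 (gx + .reg 9) gy) * lt (.lit 0) (.get 3 (gx - .reg 9) gy)

/-- Marking the bad blocks. -/
def markBad : GCmd :=
  grid (.put 4 refX refY (.lit 1 - (.lit 1 - .get 4 refX refY) * deepE))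

/-- Computing the labels. -/
def labels : GCmd :=
  grid (.put 5 gx gy ((.lit 1 - .get 4 refX refY) *
    (.lit 1 + (.lit 1 - lt (.lit 2 * refX) (.lit 5 * .reg 0)) +
      .lit 2 * (.lit 1 - lt (.lit 2 * refY) (.lit 5 * .reg 0)))))

end Prog

/-- The input of the program, and the assumptions on the word size. -/
structure Ctx (w : ℕ) (L : Layout) (I : Inst) (LT : List (Point × ℤ)) (LQ : List Point)
    (tb qb : ℕ) : Prop where
  valid : I.Valid
  side : L.side = 5 * I.n
  size : (2 * (L.outBase + 1000 * (I.n + I.l) ^ 2) : ℤ) ≤ 2 ^ w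
  inp0 : L.input 0 = I.m
  inp1 : L.input 1 = I.n
  inp3 : L.input 3 = I.l
  inp4 : L.input 4 = I.φ.1
  inp5 : L.input 5 = I.φ.2
  inp6 : L.input 6 = I.ψ.1
  inp7 : L.input 7 = I.ψ.2
  inp8 : 9 + 3 * L.input 8 = tb
  inpT : L.input tb = LT.length
  qb_eq : qb = tb + 1 + 3 * LT.length
  inpTi : ∀ i (h : i < LT.length), L.input (tb + 1 + 3 * i) = LT[i].1.1 ∧
    L.input (tb + 2 + 3 * i) = LT[i].1.2 ∧ L.input (tb + 3 + 3 * i) = LT[i].2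
  inpQ : L.input qb = LQ.length
  inpQi : ∀ i (h : i < LQ.length), L.input (qb + 1 + 2 * i) = LQ[i].1 ∧
    L.input (qb + 2 + 2 * i) = LQ[i].2
  base_eq : L.base = qb + 1 + 2 * LQ.length
  tb_ge : 9 ≤ tb
  repT : Represents LT I.T
  lenT : LT.length ≤ I.n ^ 2
  fits : I.T.FitsWord w
  memQ : ∀ q, q ∈ LQ ↔ q ∈ I.Q
  lenQ : LQ.length ≤ I.n ^ 2

/-- The parameters are in their registers. -/
structure Env (I : Inst) (tb qb : ℕ) (s : GState) : Prop where
  r0 : s.reg 0 = I.n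
  r1 : s.reg 1 = I.m
  r2 : s.reg 2 = I.φ.1
  r3 : s.reg 3 = I.φ.2
  r4 : s.reg 4 = I.ψ.1
  r5 : s.reg 5 = I.ψ.2
  r6 : s.reg 6 = I.D
  r7 : s.reg 7 = I.a
  r8 : s.reg 8 = I.b
  r9 : s.reg 9 = 2 * I.W
  r10 : s.reg 10 = tb
  r11 : s.reg 11 = qb

theorem Env.congr {I : Inst} {tb qb : ℕ} {s s' : GState} (h : Env I tb qb s)
    (hs : ∀ x, x < 20 → s'.reg x = s.reg x) : Env I tb qb s' := by
  constructor <;> (rw [hs _ (by norm_num)])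
  exacts [h.r0, h.r1, h.r2, h.r3, h.r4, h.r5, h.r6, h.r7, h.r8, h.r9, h.r10, h.r11]

namespace Ctx

open GExpr GCmd Prog

variable {w : ℕ} {L : Layout} {I : Inst} {LT : List (Point × ℤ)} {LQ : List Point} {tb qb : ℕ}

theorem n_pos (h : Ctx w L I LT LQ tb qb) : 0 < I.n := h.valid.m_pos.trans_le h.valid.m_le

theorem outBase_le (h : Ctx w L I LT LQ tb qb) : (L.outBase : ℤ) ≤ 2 ^ w := by
  have h1 := h.size
  have : (0 : ℤ) ≤ 1000 * (I.n + I.l) ^ 2 := by positivity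
  have : (0 : ℤ) ≤ L.outBase := by positivity
  linarith

theorem inRange (h : Ctx w L I LT LQ tb qb) {v : ℤ} (h1 : -(1000 * (I.n + I.l) ^ 2) ≤ v)
    (h2 : v < 1000 * (I.n + I.l) ^ 2) : InRange w v := by
  have h1 := h.size
  have : (0 : ℤ) ≤ L.outBase := by positivity
  constructor <;> linarith

theorem inRange_sq (h : Ctx w L I LT LQ tb qb) {v : ℤ} (h1 : -(900 * (I.n : ℤ) ^ 2) ≤ v)
    (h2 : v ≤ 900 * (I.n : ℤ) ^ 2) : InRange w v := by
  have h3 : (1 : ℤ) ≤ I.l := by exact_mod_cast h.valid.l_pos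
  have h4 : (1 : ℤ) ≤ I.n := by exact_mod_cast h.n_pos
  apply h.inRange <;> nlinarith

theorem inRange_lin (h : Ctx w L I LT LQ tb qb) {v : ℤ} (h1 : -(900 * (I.n : ℤ)) ≤ v)
    (h2 : v ≤ 900 * (I.n : ℤ)) : InRange w v := by
  have h4 : (1 : ℤ) ≤ I.n := by exact_mod_cast h.n_pos
  apply h.inRange_sq <;> nlinarith

theorem inRange_col (h : Ctx w L I LT LQ tb qb) (u : Point) : InRange w (I.col u) := by
  unfold Inst.col
  cases hu : I.T u with
  | none => exact h.inRange_lin (by simp) (by simp)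
  | some a => exact h.fits u a hu

theorem runs_setup (h : Ctx w L I LT LQ tb qb) (s : GState) :
    setup.Runs w L setup.maxTime s fun s' =>
      Env I tb qb s' ∧ s'.fld = s.fld ∧ s'.out = s.out := by
  have hv := h.valid
  have hb : 9 < L.base := by have := h.base_eq; have := h.qb_eq; have := h.tb_ge; omega
  have hbt : tb < L.base := by have := h.base_eq; have := h.qb_eq; omega
  have hl : (1 : ℤ) ≤ I.l := by exact_mod_cast hv.l_pos
  have hn : (1 : ℤ) ≤ I.n := by exact_mod_cast h.n_pos
  have hm : (I.m : ℤ) ≤ I.n := by exact_mod_cast hv.m_le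
  have p1 := hv.phi1
  have p2 := hv.phi2
  have p3 := hv.psi1
  have p4 := hv.psi2
  have b1 := hv.phi1_le
  have b2 := hv.phi2_le
  have b3 := hv.psi1_le
  have b4 := hv.psi2_le
  have e1 : (9 + 3 * L.input 8).toNat = tb := by rw [h.inp8]; rfl
  have k1 : (0 : ℤ) ≤ I.m ∧ InRange w I.m := ⟨by positivity, h.inRange_lin (by omega) (by omega)⟩
  -- The divisors `16 l v` mix `l` with lengths; on their account the size bound in `Ctx` involves
  -- `l`.
  have k2 : ∀ v : ℤ, 0 ≤ v → v ≤ 2 * I.n →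
      0 ≤ 16 * (I.l : ℤ) * v ∧ InRange w (16 * (I.l : ℤ) * v) := by
    intro v h0 h1
    have h2 : 0 ≤ 16 * (I.l : ℤ) * v := by positivity
    refine ⟨h2, h.inRange (by nlinarith) ?_⟩
    have : 16 * (I.l : ℤ) * v ≤ 16 * I.l * (2 * I.n) := mul_le_mul_of_nonneg_left h1 (by positivity)
    nlinarith
  have k3 := k2 (I.φ.1 - I.φ.2) (by omega) (by omega)
  have k4 := k2 (I.ψ.1 + I.ψ.2) (by omega) (by omega)
  have k5 := k2 1 (by omega) (by omega)
  rw [mul_one] at k5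
  have t3 : Int.toNat 3 = 3 := rfl
  have t4 : Int.toNat 4 = 4 := rfl
  have t5 : Int.toNat 5 = 5 := rfl
  have t6 : Int.toNat 6 = 6 := rfl
  have t7 : Int.toNat 7 = 7 := rfl
  have t8 : Int.toNat 8 = 8 := rfl
  refine runs_of_wp h.outBase_le _ _ _ ?_
  simp only [setup, wp, val_inp, val_lit, ok_inp, ok_lit, ok_add, ok_sub, ok_mul, ok_div, val_add,
    val_sub, val_mul, val_div, val_reg, ok_reg, GState.setReg_reg]
  norm_num [t3, t4, t5, t6, t7, t8]
  simp only [h.inp0, h.inp1, h.inp3, h.inp4, h.inp5, h.inp6, h.inp7, h.inp8,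
    Int.toNat_natCast, h.inpT]
  refine ⟨by omega, by omega, by omega, by omega, by omega, by omega,
    ⟨by omega, k1, k3⟩, ⟨by omega, k1, k4⟩, ⟨by omega, k1, by omega, k5.2⟩, by omega, by omega, ?_⟩
  constructor <;> norm_num [t3, t4, t5, t6, t7, t8, h.qb_eq, Inst.D, Inst.a, Inst.b, Inst.W, h.inp0, h.inp1, h.inp3, h.inp4,
    h.inp5, h.inp6, h.inp7, h.inp8, e1, h.inpT]

end Ctx

/-! ### Filling the grid -/

/-- The recursion of a timer that is restarted at marks. -/
theorem timer_spec {m : ℕ} {mark : ℕ → Prop} {v : ℕ → ℤ} {N : ℕ}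
    (h1 : ∀ t < N, mark t → v t = m)
    (h2 : ∀ t < N, ¬ mark t → v t = if 0 < v (t + 1) then v (t + 1) - 1 else 0)
    (hN : v N = 0) (hm : ∀ t, N ≤ t → ¬ mark t) :
    0 < v 0 ↔ ∃ j < m, mark j := by
  -- The strengthened claim: `v t` exceeds `i` exactly if a mark occurs among the next `m - i`
  -- places. Only `t = 0` and `i = 0` are needed in the end.
  have key : ∀ d t, t + d = N → 0 ≤ v t ∧ ∀ i : ℕ, i < v t ↔ ∃ j, j + i < m ∧ mark (t + j) := by
    intro d
    induction d with
    | zero =>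
      intro t ht
      obtain rfl : t = N := by omega
      rw [hN]
      refine ⟨le_rfl, fun i => ⟨fun h => by omega, ?_⟩⟩
      rintro ⟨j, -, hj⟩
      exact (hm _ (by omega) hj).elim
    | succ d ih =>
      intro t ht
      obtain ⟨h0, hi⟩ := ih (t + 1) (by omega)
      by_cases hmk : mark t
      · rw [h1 t (by omega) hmk]
        refine ⟨by positivity, fun i => ⟨fun h => ⟨0, by omega, hmk⟩, ?_⟩⟩
        rintro ⟨j, hj, -⟩
        omega
      · rw [h2 t (by omega) hmk]
        constructor
        · split_ifs <;> omega
        · intro i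
          have h3 : (i : ℤ) < (if 0 < v (t + 1) then v (t + 1) - 1 else 0) ↔
              ((i + 1 : ℕ) : ℤ) < v (t + 1) := by
            push_cast
            split_ifs <;> omega
          rw [h3, hi]
          constructor
          · rintro ⟨j, hj, hj'⟩
            exact ⟨j + 1, by omega, by rwa [← add_assoc, add_right_comm]⟩
          · rintro ⟨j, hj, hj'⟩
            cases j with
            | zero => exact (hmk hj').elim
            | succ j => exact ⟨j, by omega, by rwa [← add_assoc, add_right_comm] at hj'⟩
  have := (key N 0 (by omega)).2 0
  simpa using this

namespace GCmd.Agree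

theorem env {f : ℕ} {s s' : GState} (h : Agree f s s') {I : Inst} {tb qb : ℕ}
    (hE : Env I tb qb s) : Env I tb qb s' := hE.congr fun x hx => h.reg x (.inl hx)

theorem setReg {f : ℕ} {s s' : GState} (h : Agree f s s') {x : ℕ} (hx : 20 ≤ x) (hx' : x ≤ 23)
    (v : ℤ) : Agree f s (s'.setReg x v) :=
  ⟨fun y hy => by rw [GState.setReg_reg_ne _ _ (by omega)]; exact h.reg y hy, h.fld, h.out⟩

theorem putFld {f : ℕ} {s s' : GState} (h : Agree f s s') (p : Point) (v : ℤ) :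
    Agree f s (s'.putFld f p v) :=
  ⟨h.reg, fun g hg => by
    simp only [GState.putFld, Function.update_of_ne hg]; exact h.fld g hg, h.out⟩

theorem refl (f : ℕ) (s : GState) : Agree f s s := ⟨fun _ _ => rfl, fun _ _ => rfl, rfl⟩

end GCmd.Agree

namespace Ctx

open GExpr GCmd Prog

variable {w : ℕ} {L : Layout} {I : Inst} {LT : List (Point × ℤ)} {LQ : List Point} {tb qb : ℕ}

theorem mem_text (h : Ctx w L I LT LQ tb qb) {u : Point} {c : ℤ} (hu : I.T u = some c) :
    (0 ≤ u.1 ∧ u.1 < I.n) ∧ 0 ≤ u.2 ∧ u.2 < I.n := by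
  have : u ∈ I.T.dom := ⟨c, hu⟩
  rw [h.valid.dom] at this
  exact this

theorem runs_loadText (h : Ctx w L I LT LQ tb qb) (s : GState) (hs : Env I tb qb s)
    (h0 : ∀ p, s.fld 0 p = 0) : ∃ K : ℕ, K = 200 ∧
    loadText.Runs w L (K * I.n ^ 2) s fun s' =>
      Agree 0 s s' ∧ ∀ u, s'.fld 0 (u + gridOffset I.n) = I.col u := by
  classical
  refine ⟨200, rfl, ?_⟩
  have hn := h.n_pos
  have hlen : GExpr.InRange w ((LT.length : ℕ) : ℤ) := by
    have : (LT.length : ℤ) ≤ (I.n : ℤ) ^ 2 := by exact_mod_cast h.lenT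
    apply h.inRange_sq
    · nlinarith
    · nlinarith
  have hb := h.base_eq
  have hq := h.qb_eq
  refine Runs.mono (Runs.loop h.outBase_le (x := 20) (N := LT.length) hlen
    (fun _ => (GCmd.put 0 (.inp (.reg 10 + .lit 1 + .lit 3 * .reg 20) + .lit 2 * .reg 0)
      (.inp (.reg 10 + .lit 2 + .lit 3 * .reg 20) + .lit 2 * .reg 0)
      (.inp (.reg 10 + .lit 3 + .lit 3 * .reg 20))).maxTime)
    (fun i s' => s'.reg 20 = i ∧ Agree 0 s s' ∧ ∀ u, s'.fld 0 (u + gridOffset I.n) =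
      if ∃ c, (u, c) ∈ LT.take i then I.col u else 0) ?_ (fun _ _ hI => hI.1) ?_ ?_) ?_ ?_
  · exact ⟨by simp, (Agree.refl 0 s).setReg (by norm_num) (by norm_num) _, by simp [h0]⟩
  · rintro i s' - ⟨-, hA, -⟩
    have hE := hA.env hs
    simp only [ok_inp, ok_reg, val_reg, val_inp, hE.r10, Int.toNat_natCast, h.inpT, true_and,
      and_true]
    omega
  · rintro i s' hi ⟨h20, hA, hT⟩
    have hE := hA.env hs
    obtain ⟨i1, i2, i3⟩ := h.inpTi i hi
    set u := LT[i].1 with hu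
    set c := LT[i].2 with hc
    have hmem : (u, c) ∈ LT := List.getElem_mem hi
    have hTu : I.T u = some c := (h.repT.2 u c).1 hmem
    have htx := h.mem_text hTu
    have t1 : ((tb : ℤ) + 1 + 3 * i).toNat = tb + 1 + 3 * i := by omega
    have t2 : ((tb : ℤ) + 2 + 3 * i).toNat = tb + 2 + 3 * i := by omega
    have t3 : ((tb : ℤ) + 3 + 3 * i).toNat = tb + 3 + 3 * i := by omega
    have hp : (u.1 + 2 * (I.n : ℤ), u.2 + 2 * (I.n : ℤ)) = u + gridOffset I.n := rfl
    refine runs_of_wp h.outBase_le _ _ _ ?_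
    simp only [wp, ok_get, ok_add, ok_inp, ok_mul, ok_reg, ok_lit, val_add, val_mul, val_reg,
      val_lit, val_inp, hE.r10, h20, hE.r0, t1, t2, t3, i1, i2, i3, h.side, hp]
    refine ⟨⟨by norm_num, by simp; omega, by simp; omega, by push_cast; omega,
      by push_cast; omega⟩, ⟨by simp, by omega, by omega⟩, by simpa using h20, by simp,
      (hA.putFld _ _).setReg (by norm_num) (by norm_num) _, ?_⟩
    intro v
    simp only [GState.setReg_fld, GState.putFld, Function.update_self, Function.update_apply,
      add_left_inj]
    have htake : LT.take (i + 1) = LT.take i ++ [LT[i]] := List.take_succ_eq_append_getElem hi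
    by_cases hv : v = u
    · subst hv
      have : I.col u = c := by simp [Inst.col, hTu]
      rw [if_pos rfl, if_pos ⟨c, by rw [htake]; exact List.mem_append.2 (.inr (List.mem_singleton.2 rfl))⟩, this]
    · rw [if_neg hv, hT]
      congr 1
      rw [htake]
      simp only [List.mem_append, List.mem_singleton]
      rw [eq_iff_iff]
      constructor
      · rintro ⟨d, hd⟩; exact ⟨d, .inl hd⟩
      · rintro ⟨d, hd | hd⟩
        · exact ⟨d, hd⟩
        · exact (hv (by rw [hu, ← hd])).elim
  · have hk : (GCmd.put 0 (.inp (.reg 10 + .lit 1 + .lit 3 * .reg 20) + .lit 2 * .reg 0)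
      (.inp (.reg 10 + .lit 2 + .lit 3 * .reg 20) + .lit 2 * .reg 0)
      (.inp (.reg 10 + .lit 3 + .lit 3 * .reg 20))).maxTime ≤ 100 := by decide
    have hk' : (GExpr.inp (.reg 10)).comp.cost ≤ 10 := by decide
    simp only [Finset.sum_const, Finset.card_range, smul_eq_mul]
    have hl := h.lenT
    have : 1 ≤ I.n ^ 2 := Nat.one_le_pow _ _ hn
    have := Nat.mul_le_mul hl (add_le_add hk (add_le_add_left hk' 7))
    nlinarith
  · rintro s' ⟨-, hA, hT⟩
    refine ⟨hA, fun u => ?_⟩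
    rw [hT, List.take_length]
    split_ifs with hc
    · rfl
    · unfold Inst.col
      cases hu : I.T u with
      | none => rfl
      | some c => exact (hc ⟨c, (h.repT.2 u c).2 hu⟩).elim

/-- `u` is the lower right corner of a square. -/
def Corner (I : Inst) (u : Point) : Prop := (u.1 + 1 - I.m, u.2) ∈ I.Q

theorem runs_loadMarks (h : Ctx w L I LT LQ tb qb) (s : GState) (hs : Env I tb qb s)
    (h0 : ∀ p, s.fld 1 p = 0) : ∃ K : ℕ, K = 200 ∧
    loadMarks.Runs w L (K * I.n ^ 2) s fun s' =>
      Agree 1 s s' ∧ ∀ u, (s'.fld 1 (u + gridOffset I.n) = 1 ∧ Corner I u) ∨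
        (s'.fld 1 (u + gridOffset I.n) = 0 ∧ ¬ Corner I u) := by
  classical
  refine ⟨200, rfl, ?_⟩
  have hn := h.n_pos
  have hlen : GExpr.InRange w ((LQ.length : ℕ) : ℤ) := by
    have : (LQ.length : ℤ) ≤ (I.n : ℤ) ^ 2 := by exact_mod_cast h.lenQ
    apply h.inRange_sq
    · nlinarith
    · nlinarith
  have hb := h.base_eq
  refine Runs.mono (Runs.loop h.outBase_le (x := 20) (N := LQ.length) hlen
    (fun _ => (GCmd.put 1 (.inp (.reg 11 + .lit 1 + .lit 2 * .reg 20) + .lit 2 * .reg 0 +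
        .reg 1 - .lit 1)
      (.inp (.reg 11 + .lit 2 + .lit 2 * .reg 20) + .lit 2 * .reg 0) (.lit 1)).maxTime)
    (fun i s' => s'.reg 20 = i ∧ Agree 1 s s' ∧ ∀ u : Point,
      s'.fld 1 (u + gridOffset I.n) =
        if (u.1 + 1 - I.m, u.2) ∈ LQ.take i then 1 else 0) ?_ (fun _ _ hI => hI.1) ?_ ?_) ?_ ?_
  · exact ⟨by simp, (Agree.refl 1 s).setReg (by norm_num) (by norm_num) _, by simp [h0]⟩
  · rintro i s' - ⟨-, hA, -⟩
    have hE := hA.env hs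
    simp only [ok_inp, ok_reg, val_reg, val_inp, hE.r11, Int.toNat_natCast, h.inpQ, true_and,
      and_true]
    omega
  · rintro i s' hi ⟨h20, hA, hT⟩
    have hE := hA.env hs
    obtain ⟨i1, i2⟩ := h.inpQi i hi
    set u := LQ[i] with hu
    have hmem : u ∈ I.Q := (h.memQ u).1 (List.getElem_mem hi)
    have htx := h.valid.Q_mem u hmem
    have t1 : ((qb : ℤ) + 1 + 2 * i).toNat = qb + 1 + 2 * i := by omega
    have t2 : ((qb : ℤ) + 2 + 2 * i).toNat = qb + 2 + 2 * i := by omega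
    have hp : (u.1 + 2 * (I.n : ℤ) + I.m - 1, u.2 + 2 * (I.n : ℤ)) =
        (u.1 + I.m - 1, u.2) + gridOffset I.n := by
      ext <;> simp [gridOffset]; ring
    have hm := h.valid.m_pos
    refine runs_of_wp h.outBase_le _ _ _ ?_
    simp only [wp, ok_get, ok_add, ok_sub, ok_inp, ok_mul, ok_reg, ok_lit, val_add, val_mul,
      val_reg, val_sub, val_lit, val_inp, hE.r11, h20, hE.r0, hE.r1, t1, t2, i1, i2, h.side, hp]
    refine ⟨⟨by norm_num, by simp; omega, by simp; omega, by push_cast; omega,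
      by push_cast; omega⟩, trivial, by simpa using h20, by simp,
      (hA.putFld _ _).setReg (by norm_num) (by norm_num) _, ?_⟩
    intro v
    simp only [GState.setReg_fld, GState.putFld, Function.update_self, Function.update_apply,
      add_left_inj]
    have htake : LQ.take (i + 1) = LQ.take i ++ [LQ[i]] := List.take_succ_eq_append_getElem hi
    have hiff : v = (u.1 + (I.m : ℤ) - 1, u.2) ↔ (v.1 + 1 - (I.m : ℤ), v.2) = u := by
      constructor
      · rintro rfl; ext <;> simp
      · intro e; rw [← e]; ext <;> simp
    simp only [htake, List.mem_append, List.mem_singleton, ← hu, ← hiff, hT]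
    split_ifs <;> tauto
  · have hk : (GCmd.put 1 (.inp (.reg 11 + .lit 1 + .lit 2 * .reg 20) + .lit 2 * .reg 0 +
        .reg 1 - .lit 1)
      (.inp (.reg 11 + .lit 2 + .lit 2 * .reg 20) + .lit 2 * .reg 0) (.lit 1)).maxTime ≤ 100 := by decide
    have hk' : (GExpr.inp (.reg 11)).comp.cost ≤ 10 := by decide
    simp only [Finset.sum_const, Finset.card_range, smul_eq_mul]
    have hl := h.lenQ
    have : 1 ≤ I.n ^ 2 := Nat.one_le_pow _ _ hn
    have := Nat.mul_le_mul hl (add_le_add hk (add_le_add_left hk' 7))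
    nlinarith
  · rintro s' ⟨-, hA, hT⟩
    refine ⟨hA, fun u => ?_⟩
    rw [hT, List.take_length]
    simp only [h.memQ]
    by_cases hc : (u.1 + 1 - (I.m : ℤ), u.2) ∈ I.Q
    · exact .inl ⟨if_pos hc, hc⟩
    · exact .inr ⟨if_neg hc, hc⟩

theorem inRange_3n (h : Ctx w L I LT LQ tb qb) : InRange w ((3 * I.n : ℕ) : ℤ) :=
  h.inRange_lin (by push_cast; omega) (by push_cast; omega)

theorem corner_text (h : Ctx w L I LT LQ tb qb) {u : Point} (hu : Corner I u) :
    (0 ≤ u.1 ∧ u.1 < I.n) ∧ 0 ≤ u.2 ∧ u.2 < I.n := by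
  have := h.valid.Q_mem _ hu
  have := h.valid.m_pos
  omega

/-- The sweep meets the right neighbour first, so a timer restarted with `m` at every lower right
corner is positive exactly on the bottom edges of the squares. All squares have the same side, so
restarting loses nothing when they overlap. -/
theorem runs_spreadX (h : Ctx w L I LT LQ tb qb) (s : GState) (hs : Env I tb qb s)
    (h0 : ∀ p, s.fld 2 p = 0)
    (h1 : ∀ u, (s.fld 1 (u + gridOffset I.n) = 1 ∧ Corner I u) ∨
        (s.fld 1 (u + gridOffset I.n) = 0 ∧ ¬ Corner I u)) : ∃ K : ℕ, K = 2000 ∧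
    spreadX.Runs w L (K * I.n ^ 2) s fun s' =>
      Agree 2 s s' ∧ (∀ p, 0 ≤ s'.fld 2 p ∧ s'.fld 2 p ≤ I.m) ∧
      ∀ u, 0 < s'.fld 2 (u + gridOffset I.n) ↔ ∃ j : ℕ, j < I.m ∧ Corner I (u.1 + j, u.2) := by
  classical
  refine ⟨2000, rfl, ?_⟩
  have hm : (I.m : ℤ) ≤ I.n := by exact_mod_cast h.valid.m_le
  have hm0 := h.valid.m_pos
  refine Runs.mono (runs_pass h.outBase_le h.n_pos h.inRange_3n h.side (by norm_num) hs.r0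
    (fun v => 0 ≤ v ∧ v ≤ I.m) (by simp [h0])
    (fun g u => if Corner I u then (I.m : ℤ) else
      if 0 < g ((u.1 + 1, u.2) + gridOffset I.n) then
        g ((u.1 + 1, u.2) + gridOffset I.n) - 1 else 0) ?_ ?_) ?_ ?_
  · intro s' u hu hA hB h22 h23
    have hE := hA.env hs
    have hu' := mem_area.1 hu
    have hp : (u.1 + 2 * (I.n : ℤ), u.2 + 2 * (I.n : ℤ)) = u + gridOffset I.n := rfl
    have hp' : (u.1 + 2 * (I.n : ℤ) + 1, u.2 + 2 * (I.n : ℤ)) =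
        (u.1 + 1, u.2) + gridOffset I.n := by ext <;> simp [gridOffset]; ring
    have hb := hB ((u.1 + 1, u.2) + gridOffset I.n)
    simp only [timer, gx, gy, ok_add, ok_sub, ok_mul, ok_get, ok_reg, ok_lit, ok_lt, val_add,
      val_sub, val_mul, val_get, val_reg, val_lit, val_lt, h22, h23, h.side, hp, hp', hE.r1,
      hA.fld 1 (by norm_num)]
    refine ⟨?_, ?_, ?_⟩
    · have r0 : InRange w 0 := h.inRange_lin (by omega) (by omega)
      have r1 := h.inRange_lin (v := s'.fld 2 ((u.1 + 1, u.2) + gridOffset I.n)) (by omega)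
        (by omega)
      simp only [true_and, and_true, r0, r1]
      push_cast
      simp only [true_and]
      omega
    · rcases h1 u with ⟨e, hc⟩ | ⟨e, hc⟩
      · simp [e, hc]
      · simp [e, hc]
    · split_ifs <;> omega
  · intro g g' u hu hg
    have : g ((u.1 + 1, u.2) + gridOffset I.n) = g' ((u.1 + 1, u.2) + gridOffset I.n) := by
      apply hg
      intro v hv he
      rw [← add_right_cancel he]
      left; simp
    simp only [this]
  · have hk : (GCmd.put 2 gx gy (timer (.get 1 gx gy) (.get 2 (gx + .lit 1) gy))).maxTime ≤ 190 := by
      decide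
    exact Nat.mul_le_mul_right _ (show 9 * (GCmd.put 2 gx gy _).maxTime + 212 ≤ 2000 by omega)
  · rintro s' ⟨hA, hB, hout, hrec⟩
    refine ⟨hA, hB, fun u => ?_⟩
    have houtside : ∀ u, u ∉ area I.n → s'.fld 2 (u + gridOffset I.n) = 0 := by
      intro u hu
      rw [hout, h0]
      intro v hv he
      exact hu (add_right_cancel he ▸ hv)
    by_cases hu : u ∈ area I.n
    · have hu' := mem_area.1 hu
      -- After `N` steps to the right the area is left; there the table is still 0 and no corners
      -- remain.
      have := timer_spec (m := I.m) (mark := fun t => Corner I (u.1 + t, u.2))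
        (v := fun t => s'.fld 2 ((u.1 + t, u.2) + gridOffset I.n)) (N := (2 * I.n - u.1).toNat)
        ?_ ?_ ?_ ?_
      · simpa using this
      · intro t ht hmk
        rw [hrec _ (mem_area.2 (by dsimp only; omega)), if_pos hmk]
      · intro t ht hmk
        rw [hrec _ (mem_area.2 (by dsimp only; omega)), if_neg hmk]
        simp only [Nat.cast_add, Nat.cast_one, add_assoc]
      · exact houtside _ fun hc => by have := mem_area.1 hc; dsimp only at this; omega
      · intro t ht hc
        have := h.corner_text hc
        dsimp only at this
        omega
    · rw [houtside u hu]
      refine ⟨fun hc => by omega, ?_⟩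
      rintro ⟨j, hj, hc⟩
      exfalso
      have := h.corner_text hc
      dsimp only at this
      exact hu (mem_area.2 (by omega))

/-- The same timer in the vertical direction, restarted on bottom edges: it is positive exactly if a
bottom edge lies fewer than `m` places below, that is, inside some square. -/
theorem runs_spreadY (h : Ctx w L I LT LQ tb qb) (s : GState) (hs : Env I tb qb s)
    (h0 : ∀ p, s.fld 3 p = 0) (h2 : ∀ p, 0 ≤ s.fld 2 p ∧ s.fld 2 p ≤ I.m)
    (h1 : ∀ u, 0 < s.fld 2 (u + gridOffset I.n) ↔
      ∃ j : ℕ, j < I.m ∧ Corner I (u.1 + j, u.2)) : ∃ K : ℕ, K = 2000 ∧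
    spreadY.Runs w L (K * I.n ^ 2) s fun s' =>
      Agree 3 s s' ∧ (∀ p, 0 ≤ s'.fld 3 p ∧ s'.fld 3 p ≤ I.m) ∧
      ∀ u, 0 < s'.fld 3 (u + gridOffset I.n) ↔ I.Act u := by
  classical
  refine ⟨2000, rfl, ?_⟩
  have hm : (I.m : ℤ) ≤ I.n := by exact_mod_cast h.valid.m_le
  have hm0 := h.valid.m_pos
  have hact : ∀ u, I.Act u ↔ ∃ i : ℕ, i < I.m ∧
      ∃ j : ℕ, j < I.m ∧ Corner I (u.1 + j, u.2 - i) := by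
    intro u
    constructor
    · rintro ⟨q, hq, hs⟩
      unfold Inst.InSquare at hs
      refine ⟨(u.2 - q.2).toNat, by omega, (q.1 + I.m - 1 - u.1).toNat, by omega, ?_⟩
      have e : ((u.1 + ((q.1 + I.m - 1 - u.1).toNat : ℤ) + 1 - I.m : ℤ),
          (u.2 - ((u.2 - q.2).toNat : ℤ) : ℤ)) = q := by ext <;> dsimp only <;> omega
      unfold Corner
      rw [e]; exact hq
    · rintro ⟨i, hi, j, hj, hc⟩
      refine ⟨_, hc, ?_⟩
      unfold Inst.InSquare
      dsimp only
      omega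
  refine Runs.mono (runs_pass h.outBase_le h.n_pos h.inRange_3n h.side (by norm_num) hs.r0
    (fun v => 0 ≤ v ∧ v ≤ I.m) (by simp [h0])
    (fun g u => if 0 < s.fld 2 (u + gridOffset I.n) then (I.m : ℤ) else
      if 0 < g ((u.1, u.2 - 1) + gridOffset I.n) then
        g ((u.1, u.2 - 1) + gridOffset I.n) - 1 else 0) ?_ ?_) ?_ ?_
  · intro s' u hu hA hB h22 h23
    have hE := hA.env hs
    have hu' := mem_area.1 hu
    have hp : (u.1 + 2 * (I.n : ℤ), u.2 + 2 * (I.n : ℤ)) = u + gridOffset I.n := rfl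
    have hp' : (u.1 + 2 * (I.n : ℤ), u.2 + 2 * (I.n : ℤ) - 1) =
        (u.1, u.2 - 1) + gridOffset I.n := by ext <;> simp [gridOffset]; ring
    have hb := hB ((u.1, u.2 - 1) + gridOffset I.n)
    have hb2 := h2 (u + gridOffset I.n)
    simp only [timer, gx, gy, ok_add, ok_sub, ok_mul, ok_get, ok_reg, ok_lit, ok_lt, val_add,
      val_sub, val_mul, val_get, val_reg, val_lit, val_lt, h22, h23, h.side, hp, hp', hE.r1,
      hA.fld 2 (by norm_num)]
    refine ⟨?_, ?_, ?_⟩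
    · have r0 : InRange w 0 := h.inRange_lin (by omega) (by omega)
      have r1 := h.inRange_lin (v := s'.fld 3 ((u.1, u.2 - 1) + gridOffset I.n)) (by omega)
        (by omega)
      have r2 := h.inRange_lin (v := s.fld 2 (u + gridOffset I.n)) (by omega) (by omega)
      simp only [true_and, and_true, r0, r1, r2]
      push_cast
      simp only [true_and]
      omega
    · split_ifs <;> simp
    · split_ifs <;> omega
  · intro g g' u hu hg
    have : g ((u.1, u.2 - 1) + gridOffset I.n) = g' ((u.1, u.2 - 1) + gridOffset I.n) := by
      apply hg
      intro v hv he
      rw [← add_right_cancel he]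
      right; simp
    simp only [this]
  · have hk : (GCmd.put 3 gx gy (timer (lt (.lit 0) (.get 2 gx gy))
      (.get 3 gx (gy - .lit 1)))).maxTime ≤ 190 := by decide
    exact Nat.mul_le_mul_right _ (show 9 * (GCmd.put 3 gx gy _).maxTime + 212 ≤ 2000 by omega)
  · rintro s' ⟨hA, hB, hout, hrec⟩
    refine ⟨hA, hB, fun u => ?_⟩
    have houtside : ∀ u, u ∉ area I.n → s'.fld 3 (u + gridOffset I.n) = 0 := by
      intro u hu
      rw [hout, h0]
      intro v hv he
      exact hu (add_right_cancel he ▸ hv)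
    by_cases hu : u ∈ area I.n
    · have hu' := mem_area.1 hu
      have := timer_spec (m := I.m)
        (mark := fun t => ∃ j : ℕ, j < I.m ∧ Corner I (u.1 + j, u.2 - t))
        (v := fun t => s'.fld 3 ((u.1, u.2 - t) + gridOffset I.n)) (N := (u.2 + I.n + 1).toNat)
        ?_ ?_ ?_ ?_
      · rw [hact]; simpa using this
      · intro t ht hmk
        rw [hrec _ (mem_area.2 (by dsimp only; omega)), if_pos ((h1 _).2 hmk)]
      · intro t ht hmk
        rw [hrec _ (mem_area.2 (by dsimp only; omega)), if_neg fun hc => hmk ((h1 _).1 hc)]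
        simp only [Nat.cast_add, Nat.cast_one, sub_sub]
      · exact houtside _ fun hc => by have := mem_area.1 hc; dsimp only at this; omega
      · rintro t ht ⟨j, hj, hc⟩
        have := h.corner_text hc
        dsimp only at this
        omega
    · rw [houtside u hu]
      refine ⟨fun hc => by omega, fun hc => ?_⟩
      exfalso
      have := hc.mem_text h.valid
      exact hu (mem_area.2 (by omega))

end Ctx

/-! ### Blocks, depth and labels on the grid. -/

namespace Ctx

open GExpr GCmd Prog

variable {w : ℕ} {L : Layout} {I : Inst} {LT : List (Point × ℤ)} {LQ : List Point} {tb qb : ℕ}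

-- On the work area the dividends are sums of products of non-negative factors of size O(n), hence
-- non-negative and at most `900 n ^ 2`. This gives the range conditions for all four divisions.
set_option maxHeartbeats 1000000 in
theorem index_spec (h : Ctx w L I LT LQ tb qb) {s : GState} (hE : Env I tb qb s) {u : Point}
    (hu : u ∈ area I.n) (h22 : s.reg 22 = u.1 + 2 * I.n) (h23 : s.reg 23 = u.2 + 2 * I.n) :
    (idxS.ok w L s ∧ idxS.val L s = I.S u % I.a) ∧ idxR.ok w L s ∧ idxR.val L s = I.R u % I.b := by
  have hv := h.valid
  have hu' := mem_area.1 hu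
  have hn : (1 : ℤ) ≤ I.n := by exact_mod_cast h.n_pos
  have hm : (I.m : ℤ) ≤ I.n := by exact_mod_cast hv.m_le
  have hm0 : (1 : ℤ) ≤ I.m := by exact_mod_cast hv.m_pos
  have p1 := hv.phi1
  have p2 := hv.phi2
  have p3 := hv.psi1
  have p4 := hv.psi2
  have b1 := hv.phi1_le
  have b2 := hv.phi2_le
  have b3 := hv.psi1_le
  have b4 := hv.psi2_le
  have hl : (1 : ℤ) ≤ I.l := by exact_mod_cast hv.l_pos
  have hD := hv.D_pos
  have hn2 : (0 : ℤ) ≤ (I.n : ℤ) ^ 2 := by positivity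
  have hD2 : I.D ≤ 2 * (I.n : ℤ) ^ 2 := by
    have e1 : I.φ.1 * I.ψ.2 ≤ I.n * I.n := mul_le_mul (by omega) (by omega) p4 (by omega)
    have e2 : -I.φ.2 * I.ψ.1 ≤ I.n * I.n :=
      mul_le_mul (by omega) (by omega) p3.le (by omega)
    unfold Inst.D
    linarith
  have ha := hv.a_pos
  have hb := hv.b_pos
  have ha' : I.a ≤ 1 + I.n := by
    have := Int.ediv_le_self (16 * I.l * (I.φ.1 - I.φ.2)) (by omega : (0 : ℤ) ≤ I.m)
    unfold Inst.a; omega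
  have hb' : I.b ≤ 1 + I.n := by
    have := Int.ediv_le_self (16 * I.l * (I.ψ.1 + I.ψ.2)) (by omega : (0 : ℤ) ≤ I.m)
    unfold Inst.b; omega
  have bd : ∀ x y X Y : ℤ, 0 ≤ x → x ≤ 5 * I.n → 0 ≤ y → y ≤ 5 * I.n → 0 ≤ X → X ≤ I.n →
      0 ≤ Y → Y ≤ I.n → 0 ≤ x * X + y * Y ∧ x * X + y * Y ≤ 900 * (I.n : ℤ) ^ 2 := by
    intro x y X Y h1 h2 h3 h4 h5 h6 h7 h8
    have e1 : x * X ≤ 5 * I.n * I.n := mul_le_mul h2 h6 h5 (by omega)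
    have e2 : y * Y ≤ 5 * I.n * I.n := mul_le_mul h4 h8 h7 (by omega)
    have := mul_nonneg h1 h5
    have := mul_nonneg h3 h7
    constructor <;> linarith
  have s1 := bd (u.1 + 2 * I.n) (3 * I.n - u.2) I.ψ.2 I.ψ.1 (by omega) (by omega) (by omega)
    (by omega) (by omega) (by omega) (by omega) (by omega)
  have s2 := bd (u.2 + 2 * I.n) (u.1 + 2 * I.n) I.φ.1 (-I.φ.2) (by omega) (by omega) (by omega)
    (by omega) (by omega) (by omega) (by omega) (by omega)
  have e5 : (5 * I.n : ℤ) - (u.2 + 2 * I.n) = 3 * I.n - u.2 := by ring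
  have e2 : (u.2 + 2 * I.n) * I.φ.1 + (u.1 + 2 * I.n) * -I.φ.2 =
    (u.2 + 2 * I.n) * I.φ.1 - (u.1 + 2 * I.n) * I.φ.2 := by ring
  rw [e2] at s2
  have q1 := Int.ediv_le_self I.D s1.1
  have q2 := Int.ediv_le_self I.D s2.1
  have r1 := Int.ediv_nonneg s1.1 hD.le
  have r2 := Int.ediv_nonneg s2.1 hD.le
  simp only [idxS, idxR, gx, gy, ok_mod, ok_div, ok_add, ok_mul, ok_sub, ok_reg, ok_lit, val_add,
    val_sub, val_mul, val_reg, val_lit, val_div, val_mod, h22, h23, hE.r0, hE.r2, hE.r3, hE.r4,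
    hE.r5, hE.r6, hE.r7, hE.r8, true_and, e5]
  refine ⟨⟨⟨⟨⟨s1.1, h.inRange_sq (by linarith) (by linarith)⟩, hD.le, h.inRange_sq (by linarith)
    (by linarith)⟩, ⟨r1, h.inRange_sq (by linarith) (by linarith)⟩, ha.le, h.inRange_lin (by omega)
    (by omega)⟩, rfl⟩, ⟨⟨⟨s2.1, h.inRange_sq (by linarith) (by linarith)⟩, hD.le,
    h.inRange_sq (by linarith) (by linarith)⟩, ⟨r2, h.inRange_sq (by linarith) (by linarith)⟩, hb.le,
    h.inRange_lin (by omega) (by omega)⟩, rfl⟩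

theorem ref_spec (h : Ctx w L I LT LQ tb qb) {s : GState} (hE : Env I tb qb s) {u : Point}
    (hu : u ∈ area I.n) (h22 : s.reg 22 = u.1 + 2 * I.n) (h23 : s.reg 23 = u.2 + 2 * I.n) :
    (refX.ok w L s ∧ refX.val L s = (I.ref u).1 + 2 * I.n) ∧
      refY.ok w L s ∧ refY.val L s = (I.ref u).2 + 2 * I.n := by
  obtain ⟨⟨o1, v1⟩, o2, v2⟩ := h.index_spec hE hu h22 h23
  simp only [refX, refY, gx, gy, ok_mul, ok_sub, ok_reg, val_sub, val_mul, val_reg, h22, h23,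
    hE.r2, hE.r3, hE.r4, hE.r5, o1, o2, v1, v2, Inst.ref, and_self, true_and]
  constructor <;> ring

theorem W_small (h : Ctx w L I LT LQ tb qb) : 0 ≤ I.W ∧ 16 * I.W ≤ I.n := by
  have hm : (I.m : ℤ) ≤ I.n := by exact_mod_cast h.valid.m_le
  exact ⟨h.valid.W_nonneg, h.valid.W_le.trans hm⟩

open Classical in
theorem deepE_spec (h : Ctx w L I LT LQ tb qb) {s : GState} (hE : Env I tb qb s) {u : Point}
    (hu : u ∈ area I.n) (h22 : s.reg 22 = u.1 + 2 * I.n) (h23 : s.reg 23 = u.2 + 2 * I.n)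
    (hb : ∀ p, 0 ≤ s.fld 3 p ∧ s.fld 3 p ≤ I.m)
    (hact : ∀ u, 0 < s.fld 3 (u + gridOffset I.n) ↔ I.Act u) :
    deepE.ok w L s ∧ deepE.val L s = if I.Deep u then 1 else 0 := by
  have hu' := mem_area.1 hu
  have hW := h.W_small
  have hm : (I.m : ℤ) ≤ I.n := by exact_mod_cast h.valid.m_le
  have hp : (u.1 + 2 * (I.n : ℤ) + 2 * I.W, u.2 + 2 * (I.n : ℤ)) =
      (u.1 + 2 * I.W, u.2) + gridOffset I.n := by ext <;> simp [gridOffset]; ring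
  have hp' : (u.1 + 2 * (I.n : ℤ) - 2 * I.W, u.2 + 2 * (I.n : ℤ)) =
      (u.1 - 2 * I.W, u.2) + gridOffset I.n := by ext <;> simp [gridOffset]; ring
  have r0 : InRange w 0 := h.inRange_lin (by omega) (by omega)
  have r1 : ∀ p, InRange w (s.fld 3 p) := fun p => by
    have := hb p
    exact h.inRange_lin (by omega) (by omega)
  simp only [deepE, gx, gy, ok_add, ok_sub, ok_mul, ok_get, ok_reg, ok_lit, ok_lt, val_add,
      val_sub, val_mul, val_get, val_reg, val_lit, val_lt, h22, h23, h.side, hp, hp', hE.r9,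
      hact, r0, r1, Inst.Deep]
  push_cast
  constructor
  · simp only [true_and, and_true]
    omega
  · by_cases h1 : I.Act (u.1 + 2 * I.W, u.2) <;> by_cases h2 : I.Act (u.1 - 2 * I.W, u.2) <;>
      simp [h1, h2]

/-- A reference point leaves the work area by at most `2 W ≤ n / 8`, well inside the margin of `n`
that the grid keeps on each side. -/
theorem ref_in_grid (h : Ctx w L I LT LQ tb qb) {u : Point} (hu : u ∈ area I.n) :
    (0 ≤ (I.ref u).1 + 2 * I.n ∧ (I.ref u).1 + 2 * I.n < 5 * I.n) ∧
      0 ≤ (I.ref u).2 + 2 * I.n ∧ (I.ref u).2 + 2 * I.n < 5 * I.n := by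
  have hu' := mem_area.1 hu
  have hW := h.W_small
  have hn := h.n_pos
  have := (Inst.frame_psi h.valid).ref_near u
  omega

/-- The stored value is a disjunction in arithmetical form: the old mark, or the current point is
not deep. A block accumulates its mark in the cell of its reference point, so marks are final only
after the whole sweep, and labels need another one. -/
theorem runs_markBad (h : Ctx w L I LT LQ tb qb) (s : GState) (hs : Env I tb qb s)
    (h0 : ∀ p, s.fld 4 p = 0) (hb : ∀ p, 0 ≤ s.fld 3 p ∧ s.fld 3 p ≤ I.m)
    (hact : ∀ u, 0 < s.fld 3 (u + gridOffset I.n) ↔ I.Act u) : ∃ K : ℕ, K = 5000 ∧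
    markBad.Runs w L (K * I.n ^ 2) s fun s' =>
      Agree 4 s s' ∧ ∀ p, ((∃ v ∈ area I.n, p = I.ref v + gridOffset I.n ∧ ¬ I.Deep v) ∧
        s'.fld 4 p = 1) ∨ ((¬ ∃ v ∈ area I.n, p = I.ref v + gridOffset I.n ∧ ¬ I.Deep v) ∧
        s'.fld 4 p = 0) := by
  classical
  refine ⟨5000, rfl, ?_⟩
  refine Runs.mono (runs_grid h.outBase_le h.n_pos h.inRange_3n
    (fun _ => (GCmd.put 4 refX refY (.lit 1 - (.lit 1 - .get 4 refX refY) * deepE)).maxTime)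
    (fun pre s' => Agree 4 s s' ∧ ∀ p, s'.fld 4 p =
      if ∃ v ∈ pre, p = I.ref v + gridOffset I.n ∧ ¬ I.Deep v then 1 else 0) ?_ ?_ ?_ ?_) ?_ ?_
  · rintro pre s' ⟨hA, -⟩
    exact (hA.env hs).r0
  · rintro pre s' x v hx hx' ⟨hA, hT⟩
    exact ⟨hA.setReg hx hx' _, hT⟩
  · exact ⟨Agree.refl 4 s, by simp [h0]⟩
  · rintro pre u post s' hsp ⟨hA, hT⟩ h22 h23
    have hu : u ∈ area I.n := by rw [hsp]; simp
    have hE := hA.env hs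
    obtain ⟨⟨o1, v1⟩, o2, v2⟩ := h.ref_spec hE hu h22 h23
    obtain ⟨o3, v3⟩ := h.deepE_spec hE hu h22 h23
      (fun p => by rw [hA.fld 3 (by norm_num)]; exact hb p)
      (fun p => by rw [hA.fld 3 (by norm_num)]; exact hact p)
    have hg := h.ref_in_grid hu
    have hp : ((I.ref u).1 + 2 * (I.n : ℤ), (I.ref u).2 + 2 * (I.n : ℤ)) =
      I.ref u + gridOffset I.n := rfl
    refine runs_of_wp h.outBase_le _ _ _ ?_
    simp only [wp, ok_get, o1, o2, o3, v1, v2, v3, ok_sub, ok_mul, ok_lit, val_sub, val_mul,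
      val_lit, val_get, h.side, hp]
    push_cast
    refine ⟨⟨by norm_num, trivial, trivial, hg⟩, ⟨trivial, ⟨trivial, by norm_num, trivial, trivial,
      hg⟩, trivial⟩, ⟨hA.putFld _ _, ?_⟩, rfl, rfl, rfl⟩
    intro p
    simp only [GState.putFld, Function.update_self, Function.update_apply, List.mem_append,
      List.mem_singleton, or_and_right, exists_or, exists_eq_left, hT]
    by_cases hpu : p = I.ref u + gridOffset I.n
    · subst hpu
      by_cases hd : I.Deep u <;> simp [hd]
    · simp [hpu]
  · have hk : (GCmd.put 4 refX refY (.lit 1 - (.lit 1 - .get 4 refX refY) * deepE)).maxTime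
      ≤ 500 := by decide
    simp only [List.map_const', List.sum_replicate, smul_eq_mul, length_area]
    nlinarith
  · rintro s' ⟨hA, hT⟩
    refine ⟨hA, fun p => ?_⟩
    by_cases hc : ∃ v ∈ area I.n, p = I.ref v + gridOffset I.n ∧ ¬ I.Deep v
    · exact .inl ⟨hc, by rw [hT, if_pos hc]⟩
    · exact .inr ⟨hc, by rw [hT, if_neg hc]⟩

theorem lab_outside (h : Ctx w L I LT LQ tb qb) {u : Point} (hu : u ∉ area I.n) :
    I.lab u = 0 := by
  by_contra hc
  have := (Inst.deep_of_lab u hc).mem_text h.valid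
  exact hu (mem_area.2 (by omega))

/-- Goodness quantifies over all points of the plane, but a sweep sees only the area. If `u` is
deep, its whole block is within `4 W` of the text and hence in the area; otherwise `u` itself is a
bad member. -/
theorem good_iff (h : Ctx w L I LT LQ tb qb) {u : Point} (hu : u ∈ area I.n) :
    I.Good (I.ref u) ↔ ¬ ∃ v ∈ area I.n, I.ref u + gridOffset I.n = I.ref v + gridOffset I.n ∧
      ¬ I.Deep v := by
  constructor
  · rintro hg ⟨v, hv, he, hd⟩
    exact hd (hg v (add_right_cancel he).symm)
  · intro hg v hv
    by_contra hd
    by_cases hva : v ∈ area I.n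
    · exact hg ⟨v, hva, by rw [hv], hd⟩
    · have hdu : I.Deep u := by
        by_contra hdu
        exact hg ⟨u, hu, rfl, hdu⟩
      have ht := hdu.mem_text h.valid
      have h1 := (Inst.frame_psi h.valid).ref_near u
      have h2 := (Inst.frame_psi h.valid).ref_near v
      rw [hv] at h2
      have hW := h.W_small
      exact hva (mem_area.2 (by omega))

/-- The tabulated function does not read its own table. Comparing twice a grid coordinate with `5 n`
compensates for the offset `2 n` and decides the side of the centre. -/
theorem runs_labels (h : Ctx w L I LT LQ tb qb) (s : GState) (hs : Env I tb qb s)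
    (h0 : ∀ p, s.fld 5 p = 0)
    (hbad : ∀ p, ((∃ v ∈ area I.n, p = I.ref v + gridOffset I.n ∧ ¬ I.Deep v) ∧
        s.fld 4 p = 1) ∨ ((¬ ∃ v ∈ area I.n, p = I.ref v + gridOffset I.n ∧ ¬ I.Deep v) ∧
        s.fld 4 p = 0)) : ∃ K : ℕ, K = 6000 ∧
    labels.Runs w L (K * I.n ^ 2) s fun s' =>
      Agree 5 s s' ∧ ∀ u, s'.fld 5 (u + gridOffset I.n) = I.lab u := by
  refine ⟨6000, rfl, ?_⟩
  refine Runs.mono (runs_pass h.outBase_le h.n_pos h.inRange_3n h.side (by norm_num) hs.r0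
    (fun v => True) (by simp) (fun _ u => I.lab u) ?_ ?_) ?_ ?_
  · intro s' u hu hA hB h22 h23
    have hE := hA.env hs
    obtain ⟨⟨o1, v1⟩, o2, v2⟩ := h.ref_spec hE hu h22 h23
    have hg := h.ref_in_grid hu
    have hp : ((I.ref u).1 + 2 * (I.n : ℤ), (I.ref u).2 + 2 * (I.n : ℤ)) =
      I.ref u + gridOffset I.n := rfl
    simp only [ok_add, ok_sub, ok_mul, ok_get, ok_reg, ok_lit, ok_lt, val_add,
      val_sub, val_mul, val_get, val_reg, val_lit, val_lt, o1, o2, v1, v2, hE.r0, h.side, hp,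
      hA.fld 4 (by norm_num)]
    push_cast
    have i1 : InRange w (2 * ((I.ref u).1 + 2 * I.n)) := h.inRange_lin (by omega) (by omega)
    have i2 : InRange w (2 * ((I.ref u).2 + 2 * I.n)) := h.inRange_lin (by omega) (by omega)
    have i3 : InRange w (5 * (I.n : ℤ)) := h.inRange_lin (by omega) (by omega)
    refine ⟨?_, ?_, trivial⟩
    · simp only [and_true, i1, i2, i3, hg]
    have hgood := h.good_iff hu
    rcases hbad (I.ref u + gridOffset I.n) with ⟨e1, e2⟩ | ⟨e1, e2⟩
    · rw [e2]
      unfold Inst.lab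
      rw [if_neg (c := I.Good (I.ref u)) (by rw [hgood]; exact not_not.2 e1)]
      ring
    · rw [e2]
      unfold Inst.lab
      rw [if_pos (c := I.Good (I.ref u)) (hgood.2 e1)]
      split_ifs <;> omega
  · intros; rfl
  · have hk : (GCmd.put 5 gx gy ((.lit 1 - .get 4 refX refY) *
    (.lit 1 + (.lit 1 - lt (.lit 2 * refX) (.lit 5 * .reg 0)) +
      .lit 2 * (.lit 1 - lt (.lit 2 * refY) (.lit 5 * .reg 0))))).maxTime ≤ 640 := by
      decide
    exact Nat.mul_le_mul_right _ (show 9 * (GCmd.put 5 gx gy _).maxTime + 212 ≤ 6000 by omega)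
  · rintro s' ⟨hA, hB, hout, hrec⟩
    refine ⟨hA, fun u => ?_⟩
    by_cases hu : u ∈ area I.n
    · exact hrec u hu
    · rw [h.lab_outside hu, hout, h0]
      intro v hv he
      exact hu (add_right_cancel he ▸ hv)

end Ctx

/-! ### Tabulating runs and stacks -/

namespace Prog

open GExpr GCmd

/-- Whether two points carry the same non-zero label and the same character. -/
def sameE (x y x' y' : GExpr) : GExpr :=
  lt (.lit 0) (.get 5 x y) * (eqv (.get 5 x y) (.get 5 x' y') * eqv (.get 0 x y) (.get 0 x' y'))

/-- Whether the runs that start at two points are merged; `(a, b)` are the registers that hold the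
direction of the runs. -/
def mergeE (a b : ℕ) (x y x' y' : GExpr) : GExpr :=
  sameE x y x' y' * ((.lit 1 - sameE (x - .reg a) (y - .reg b) x y) *
    ((.lit 1 - sameE (x' - .reg a) (y' - .reg b) x' y') * eqv (.get 6 x y) (.get 6 x' y')))

/-- Tabulating the lengths of chains. -/
def chain (f a b : ℕ) (rel : GExpr) : GCmd :=
  grid (.put f gx gy (.lit 1 + rel * .get f (gx + .reg a) (gy + .reg b)))

/-- Tabulating the lengths of runs. -/
def lengths (a b : ℕ) : GCmd := chain 6 a b (sameE gx gy (gx + .reg a) (gy + .reg b))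

/-- Tabulating the heights of stacks. -/
def heights (a b c d : ℕ) : GCmd := chain 7 c d (mergeE a b gx gy (gx + .reg c) (gy + .reg d))

end Prog

namespace Ctx

open GExpr GCmd Prog

variable {w : ℕ} {L : Layout} {I : Inst} {LT : List (Point × ℤ)} {LQ : List Point} {tb qb : ℕ}

/-- Differences of candidates have coordinates of size at most n - m ≤ n/3, which keeps neighbours
inside the grid. The last alternative says that `u + d` is processed before `u`. -/
theorem step_bounds (h : Ctx w L I LT LQ tb qb) {d : Point} (hd : d = I.φ ∨ d = I.ψ) :
    (0 ≤ d.1 ∧ 3 * d.1 ≤ I.n) ∧ (-(I.n : ℤ) ≤ 3 * d.2 ∧ 3 * d.2 ≤ I.n) ∧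
      (0 < d.1 ∨ d.1 = 0 ∧ d.2 < 0) := by
  have hv := h.valid
  have := hv.phi1
  have := hv.phi2
  have := hv.psi1
  have := hv.psi2
  have := hv.phi1_le
  have := hv.phi2_le
  have := hv.psi1_le
  have := hv.psi2_le
  have := hv.n_le
  rcases hd with rfl | rfl <;> omega

/-- The coordinates of `p` are valid grid coordinates. -/
def InGrid (n : ℕ) (p : Point) : Prop :=
  (-(2 * n : ℤ) ≤ p.1 ∧ p.1 < 3 * n) ∧ -(2 * n : ℤ) ≤ p.2 ∧ p.2 < 3 * n

/-- The expressions evaluate to the grid coordinates of `p`. -/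
def Coord (w : ℕ) (L : Layout) (n : ℕ) (s : GState) (x y : GExpr) (p : Point) : Prop :=
  (x.ok w L s ∧ x.val L s = p.1 + 2 * n) ∧ (y.ok w L s ∧ y.val L s = p.2 + 2 * n) ∧ InGrid n p

theorem get_spec (h : Ctx w L I LT LQ tb qb) {s : GState} {x y : GExpr} {p : Point}
    (hc : Coord w L I.n s x y p) {f : ℕ} (hf : f < 8) :
    (GExpr.get f x y).ok w L s ∧ (GExpr.get f x y).val L s = s.fld f (p + gridOffset I.n) := by
  obtain ⟨⟨o1, v1⟩, ⟨o2, v2⟩, hp⟩ := hc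
  unfold InGrid at hp
  rw [ok_get, val_get, v1, v2, h.side]
  push_cast
  exact ⟨⟨hf, o1, o2, by omega, by omega⟩, rfl⟩

/-- The text and the labels are stored in the grid. -/
structure Stored (I : Inst) (s : GState) : Prop where
  col : ∀ u, s.fld 0 (u + gridOffset I.n) = I.col u
  lab : ∀ u, s.fld 5 (u + gridOffset I.n) = I.lab u

theorem lab_range (u : Point) : 0 ≤ I.lab u ∧ I.lab u ≤ 4 := by
  unfold Inst.lab
  split_ifs <;> norm_num

theorem inRange_lab (h : Ctx w L I LT LQ tb qb) (u : Point) : InRange w (I.lab u) := by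
  have := h.n_pos
  have := lab_range (I := I) u
  exact h.inRange_lin (by omega) (by omega)

theorem inRange_small (h : Ctx w L I LT LQ tb qb) {v : ℤ} (h0 : -900 ≤ v) (h1 : v ≤ 900) :
    InRange w v := by
  have := h.n_pos
  exact h.inRange_lin (by omega) (by omega)

open Classical in
theorem same_spec (h : Ctx w L I LT LQ tb qb) {s : GState} (hs : Stored I s)
    {x y x' y' : GExpr} {p q : Point} (hp : Coord w L I.n s x y p)
    (hq : Coord w L I.n s x' y' q) :
    (sameE x y x' y').ok w L s ∧
      (sameE x y x' y').val L s = if SameCell I.lab I.col p q then 1 else 0 := by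
  obtain ⟨o1, v1⟩ := h.get_spec hp (f := 0) (by norm_num)
  obtain ⟨o2, v2⟩ := h.get_spec hp (f := 5) (by norm_num)
  obtain ⟨o3, v3⟩ := h.get_spec hq (f := 0) (by norm_num)
  obtain ⟨o4, v4⟩ := h.get_spec hq (f := 5) (by norm_num)
  rw [hs.col] at v1 v3
  rw [hs.lab] at v2 v4
  simp only [sameE, ok_mul, ok_lt, ok_eqv, ok_lit, o1, o2, o3, o4, v1, v2, v3, v4, val_lit,
    val_mul, val_lt, val_eqv, h.inRange_lab, h.inRange_col,
    h.inRange_small (show -900 ≤ (0 : ℤ) by norm_num) (by norm_num), and_self, true_and]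
  have h0 := (lab_range (I := I) p).1
  have : 0 < I.lab p ↔ I.lab p ≠ 0 := by omega
  simp only [SameCell, this]
  by_cases h1 : I.lab p = 0 <;> by_cases h2 : I.lab p = I.lab q <;>
    by_cases h3 : I.col p = I.col q <;> simp [h1, h2, h3]

open Classical in
theorem merge_spec (h : Ctx w L I LT LQ tb qb) {s : GState} (hs : Stored I s)
    (hb : ∀ p, 0 ≤ s.fld 6 p ∧ s.fld 6 p ≤ 9 * (I.n : ℤ) ^ 2) {a b : ℕ} {ρ : Point}
    (ha : s.reg a = ρ.1) (hb' : s.reg b = ρ.2)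
    {x y x' y' : GExpr} {p q : Point} (hp : Coord w L I.n s x y p)
    (hq : Coord w L I.n s x' y' q) (hp' : InGrid I.n (p - ρ)) (hq' : InGrid I.n (q - ρ)) :
    (mergeE a b x y x' y').ok w L s ∧
      (mergeE a b x y x' y').val L s =
        if MergeRuns I.lab I.col ρ (fun u => (s.fld 6 (u + gridOffset I.n)).toNat) p q
          then 1 else 0 := by
  have hpc : Coord w L I.n s (x - .reg a) (y - .reg b) (p - ρ) := by
    refine ⟨?_, ?_, hp'⟩
    · simp only [ok_sub, ok_reg, hp.1.1, val_sub, hp.1.2, val_reg, ha, Prod.fst_sub, true_and]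
      ring
    · simp only [ok_sub, ok_reg, hp.2.1.1, val_sub, hp.2.1.2, val_reg, hb', Prod.snd_sub, true_and]
      ring
  have hqc : Coord w L I.n s (x' - .reg a) (y' - .reg b) (q - ρ) := by
    refine ⟨?_, ?_, hq'⟩
    · simp only [ok_sub, ok_reg, hq.1.1, val_sub, hq.1.2, val_reg, ha, Prod.fst_sub, true_and]
      ring
    · simp only [ok_sub, ok_reg, hq.2.1.1, val_sub, hq.2.1.2, val_reg, hb', Prod.snd_sub, true_and]
      ring
  obtain ⟨o1, v1⟩ := h.same_spec hs hp hq
  obtain ⟨o2, v2⟩ := h.same_spec hs hpc hp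
  obtain ⟨o3, v3⟩ := h.same_spec hs hqc hq
  obtain ⟨o4, v4⟩ := h.get_spec hp (f := 6) (by norm_num)
  obtain ⟨o5, v5⟩ := h.get_spec hq (f := 6) (by norm_num)
  have b1 := hb (p + gridOffset I.n)
  have b2 := hb (q + gridOffset I.n)
  have hn2 : (0 : ℤ) ≤ (I.n : ℤ) ^ 2 := by positivity
  have i1 : InRange w (s.fld 6 (p + gridOffset I.n)) :=
    h.inRange_sq (by linarith) (by linarith)
  have i2 : InRange w (s.fld 6 (q + gridOffset I.n)) :=
    h.inRange_sq (by linarith) (by linarith)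
  simp only [mergeE, ok_mul, ok_sub, ok_eqv, ok_lit, o1, o2, o3, o4, o5, v1, v2, v3, v4, v5,
    val_lit, val_mul, val_sub, val_eqv, i1, i2, and_self, true_and]
  have he : s.fld 6 (p + gridOffset I.n) = s.fld 6 (q + gridOffset I.n) ↔
    (s.fld 6 (p + gridOffset I.n)).toNat = (s.fld 6 (q + gridOffset I.n)).toNat := by omega
  simp only [MergeRuns, he]
  by_cases h1 : SameCell I.lab I.col p q <;> by_cases h2 : SameCell I.lab I.col (p - ρ) p <;>
    by_cases h3 : SameCell I.lab I.col (q - ρ) q <;>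
    by_cases h4 : (s.fld 6 (p + gridOffset I.n)).toNat = (s.fld 6 (q + gridOffset I.n)).toNat <;>
    simp [h1, h2, h3, h4]

/-- A linear order that is compatible with the lattice vectors. -/
def key (I : Inst) (u : Point) : ℤ := I.n * u.1 - u.2 + I.n

theorem key_sub (h : Ctx w L I LT LQ tb qb) {d : Point} (hd : d = I.φ ∨ d = I.ψ) (u : Point) :
    key I (u - d) < key I u := by
  obtain ⟨h1, h2, h3⟩ := h.step_bounds hd
  have hn := h.n_pos
  simp only [key, Prod.fst_sub, Prod.snd_sub]
  rcases h3 with h3 | ⟨h3, h4⟩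
  · have : (I.n : ℤ) * 1 ≤ I.n * d.1 := mul_le_mul_of_nonneg_left h3 (by positivity)
    have : d.2 < I.n := by omega
    nlinarith
  · rw [h3]; linarith

theorem key_bounds (h : Ctx w L I LT LQ tb qb) {u : Point} (hu : I.lab u ≠ 0) :
    0 ≤ key I u ∧ key I u ≤ 2 * (I.n : ℤ) ^ 2 := by
  have := (Inst.deep_of_lab u hu).mem_text h.valid
  have hn : (1 : ℤ) ≤ I.n := by exact_mod_cast h.n_pos
  have h1 : (I.n : ℤ) * u.1 ≤ I.n * (I.n - 1) :=
    mul_le_mul_of_nonneg_left (by omega) (by positivity)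
  have h2 : 0 ≤ (I.n : ℤ) * u.1 := mul_nonneg (by positivity) this.1.1
  unfold key
  constructor <;> nlinarith

/-- The key grows by at least one per step and stays between 0 and `2 n ^ 2` on labelled points. The
bound keeps the table entries in the range where they can be compared. -/
theorem chain_le (h : Ctx w L I LT LQ tb qb) {d : Point} (hd : d = I.φ ∨ d = I.ψ)
    {R : Point → Prop} {F : Point → ℕ} (hF : IsChainLength d {u | I.lab u ≠ 0} R F) {u : Point}
    (hu : I.lab u ≠ 0) : (F u : ℤ) ≤ 9 * (I.n : ℤ) ^ 2 := by
  have hpos := hF.pos hu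
  have h1 := (hF.forward hu (F u - 1) (by omega)).1
  have h2 := h.key_bounds h1
  have h3 := h.key_bounds hu
  have hstep : ∀ i : ℕ, key I u + i ≤ key I (u + (i : ℤ) • d) := by
    intro i
    induction i with
    | zero => simp
    | succ i ih =>
      have := h.key_sub hd (u + ((i + 1 : ℕ) : ℤ) • d)
      rw [add_succ_smul, add_sub_cancel_right] at this
      rw [add_succ_smul]
      push_cast
      omega
  have h4 := hstep (F u - 1)
  have hn : (1 : ℤ) ≤ (I.n : ℤ) ^ 2 := by
    have : (1 : ℤ) ≤ I.n := by exact_mod_cast h.n_pos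
    nlinarith
  have h5 : ((F u - 1 : ℕ) : ℤ) = F u - 1 := by omega
  have h6 := h2.2
  have h7 := h3.1
  linarith

/-- During the sweep only non-negativity is maintained, which is enough since sums and products need
no range condition. The upper bound is derived afterwards, when the finished table is known to count
chain lengths. -/
theorem runs_chain (h : Ctx w L I LT LQ tb qb) {s : GState} (hs : Env I tb qb s) {f : ℕ}
    (hf : f < 8) {a b : ℕ} (ha : a < 20) (hb : b < 20) {d : Point} (hd : d = I.φ ∨ d = I.ψ)
    (hra : s.reg a = d.1) (hrb : s.reg b = d.2) {rel : GExpr} {R : Point → Prop}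
    [DecidablePred R]
    (hbd : ∀ p, 0 ≤ s.fld f p ∧ s.fld f p ≤ 9 * (I.n : ℤ) ^ 2)
    (hR : ∀ u, R u → I.lab u ≠ 0 ∧ I.lab (u + d) ≠ 0)
    (hrel : ∀ s' u, u ∈ area I.n → Agree f s s' → s'.reg 22 = u.1 + 2 * I.n →
      s'.reg 23 = u.2 + 2 * I.n → rel.ok w L s' ∧ rel.val L s' = if R u then 1 else 0) :
    (chain f a b rel).Runs w L ((9 * (GCmd.put f (.reg 22) (.reg 23)
        (.lit 1 + rel * .get f (gx + .reg a) (gy + .reg b))).maxTime + 212) * I.n ^ 2) s fun s' =>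
      Agree f s s' ∧ (∀ p, 0 ≤ s'.fld f p ∧ s'.fld f p ≤ 9 * (I.n : ℤ) ^ 2) ∧
        IsChainLength d {u | I.lab u ≠ 0} R fun u => (s'.fld f (u + gridOffset I.n)).toNat := by
  obtain ⟨d1, d2, d3⟩ := h.step_bounds hd
  have harea : ∀ u, I.lab u ≠ 0 → u ∈ area I.n := fun u hu => by
    by_contra hc; exact hu (h.lab_outside hc)
  refine Runs.mono (runs_pass h.outBase_le h.n_pos h.inRange_3n h.side hf hs.r0
    (fun v => 0 ≤ v) (fun p => (hbd p).1)
    (fun g u => 1 + if R u then g (u + d + gridOffset I.n) else 0) ?_ ?_) le_rfl ?_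
  · intro s' u hu hA hB h22 h23
    have hu' := mem_area.1 hu
    obtain ⟨o1, v1⟩ := hrel s' u hu hA h22 h23
    have hc : Coord w L I.n s' (gx + .reg a) (gy + .reg b) (u + d) := by
      refine ⟨⟨⟨trivial, trivial, trivial⟩, ?_⟩, ⟨⟨trivial, trivial, trivial⟩, ?_⟩, ?_⟩
      · simp only [gx, val_add, val_reg, h22, hA.reg a (.inl ha), hra, Prod.fst_add]; ring
      · simp only [gy, val_add, val_reg, h23, hA.reg b (.inl hb), hrb, Prod.snd_add]; ring
      · simp only [InGrid, Prod.fst_add, Prod.snd_add]; omega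
    obtain ⟨o2, v2⟩ := h.get_spec hc hf
    have := hB (u + d + gridOffset I.n)
    simp only [ok_add, ok_mul, ok_lit, o1, o2, val_add, val_mul, val_lit, v1, v2, and_self,
      true_and]
    split_ifs <;> simp
    omega
  · intro g g' u hu hg
    split_ifs with hRu
    · rw [hg]
      intro v hv he
      rw [← add_right_cancel he]
      unfold Before
      simp only [Prod.fst_add, Prod.snd_add]
      omega
    · rfl
  · rintro s' ⟨hA, hB, hout, hrec⟩
    have hF : IsChainLength d {u | I.lab u ≠ 0} R
        fun u => (s'.fld f (u + gridOffset I.n)).toNat := by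
      refine ⟨hR, fun u hu => ?_⟩
      have := hB (u + d + gridOffset I.n)
      rw [hrec u (harea u hu)]
      split_ifs <;> omega
    refine ⟨hA, fun p => ⟨hB p, ?_⟩, hF⟩
    by_cases hp : ∃ v ∈ area I.n, p = v + gridOffset I.n
    · obtain ⟨v, hv, rfl⟩ := hp
      by_cases hl : I.lab v = 0
      · rw [hrec v hv, if_neg fun hc => (hR v hc).1 hl]
        have : 1 ≤ I.n ^ 2 := Nat.one_le_pow _ _ h.n_pos
        have : (1 : ℤ) ≤ (I.n : ℤ) ^ 2 := by exact_mod_cast this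
        linarith
      · have := h.chain_le hd hF hl
        exact (Int.self_le_toNat _).trans this
    · rw [hout p fun v hv hc => hp ⟨v, hv, hc⟩]
      exact (hbd p).2

end Ctx

/-! ### Writing the output -/

/-- The numbers that represent a point with its character. -/
def enc (p : Point × ℤ) : List ℤ := [p.1.1, p.1.2, p.2]

/-- The numbers that represent a string. -/
def encStr (l : List (Point × ℤ)) : List ℤ := (l.length : ℤ) :: l.flatMap enc

theorem length_flatMap_enc (l : List (Point × ℤ)) : (l.flatMap enc).length = 3 * l.length := by
  induction l with
  | nil => rfl
  | cons p l ih => simp only [List.flatMap_cons, List.length_append, ih, enc, List.length_cons,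
      List.length_nil]; ring

theorem length_encStr (l : List (Point × ℤ)) : (encStr l).length = 1 + 3 * l.length := by
  rw [encStr, List.length_cons, length_flatMap_enc]; ring

/-- The points of a piece, with their characters. -/
def pieceList (col : Point → ℤ) (ρ τ : Point) (L H : Point → ℕ) (u : Point) : List (Point × ℤ) :=
  (List.range (H u)).flatMap fun j : ℕ => (List.range (L u)).map fun i : ℕ =>
    (u + (j : ℤ) • τ + (i : ℤ) • ρ, col (u + (j : ℤ) • τ + (i : ℤ) • ρ))

theorem mem_pieceList {col : Point → ℤ} {ρ τ : Point} {L H : Point → ℕ} {u v : Point} {c : ℤ} :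
    (v, c) ∈ pieceList col ρ τ L H u ↔
      (∃ i j : ℕ, j < H u ∧ i < L u ∧ v = u + (j : ℤ) • τ + (i : ℤ) • ρ) ∧ c = col v := by
  simp only [pieceList, List.mem_flatMap, List.mem_map, List.mem_range, Prod.mk.injEq]
  constructor
  · rintro ⟨j, hj, i, hi, rfl, rfl⟩
    exact ⟨⟨i, j, hj, hi, rfl⟩, rfl⟩
  · rintro ⟨⟨i, j, hj, hi, rfl⟩, rfl⟩
    exact ⟨j, hj, i, hi, rfl, rfl⟩

theorem length_pieceList (col : Point → ℤ) (ρ τ : Point) (L H : Point → ℕ) (u : Point) :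
    (pieceList col ρ τ L H u).length = H u * L u := by
  simp [pieceList, List.length_flatMap]

theorem IsRunTable.pieces_nodup {lab col : Point → ℤ} {ρ τ : Point} {L H : Point → ℕ}
    (h : IsRunTable lab col ρ τ L H) {l : List Point} (hl : l.Nodup)
    (hs : ∀ u ∈ l, IsStart lab col ρ τ L u) :
    ((l.flatMap (pieceList col ρ τ L H)).map Prod.fst).Nodup := by
  rw [List.map_flatMap, List.nodup_flatMap]
  constructor
  · intro u hu
    rw [pieceList, List.map_flatMap, List.nodup_flatMap]
    constructor
    · intro j hj
      rw [List.map_map]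
      refine List.Nodup.map_on ?_ List.nodup_range
      intro i hi i' hi' he
      exact (h.piece_unique (hs u hu) (hs u hu) (List.mem_range.1 hj) (List.mem_range.1 hi)
        (List.mem_range.1 hj) (List.mem_range.1 hi') he).2.1
    · refine List.nodup_range.imp_of_mem ?_
      intro j j' hj hj' hne p hp hp'
      simp only [List.map_map, List.mem_map, List.mem_range, Function.comp] at hp hp'
      obtain ⟨i, hi, rfl⟩ := hp
      obtain ⟨i', hi', he⟩ := hp'
      exact hne (h.piece_unique (hs u hu) (hs u hu) (List.mem_range.1 hj) hi
        (List.mem_range.1 hj') hi' he.symm).2.2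
  · refine hl.imp_of_mem ?_
    intro u u' hu hu' hne p hp hp'
    obtain ⟨⟨q, c⟩, hq, rfl⟩ := List.mem_map.1 hp
    obtain ⟨⟨q', c'⟩, hq', he⟩ := List.mem_map.1 hp'
    obtain ⟨⟨i, j, hj, hi, hv⟩, -⟩ := mem_pieceList.1 hq
    obtain ⟨⟨i', j', hj', hi', hv'⟩, -⟩ := mem_pieceList.1 hq'
    exact hne (h.piece_unique (hs u hu) (hs u' hu') hj hi hj' hi'
      (hv.symm.trans (he.symm.trans hv'))).1

/-- The final state has the same contents, with `l` appended to the output; registers from `x` on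
may have changed. -/
structure Emit (x : ℕ) (l : List ℤ) (s s' : GState) : Prop where
  reg : ∀ y < x, s'.reg y = s.reg y
  fld : s'.fld = s.fld
  out : s'.out = s.out ++ l

namespace GCmd

/-- A command of level `x` may change only registers from `x` on, so the nested loops on registers
40 and 41 do not disturb each other. -/
theorem runs_emit_loop {w : ℕ} {L : Layout} (hL : (L.outBase : ℤ) ≤ 2 ^ w) {x : ℕ} {e : GExpr}
    {c : GCmd} {N : ℕ} (hN : GExpr.InRange w N) (T : ℕ) (g : ℕ → List ℤ) {s : GState}
    (he : ∀ s' i, Emit x ((List.range i).flatMap g) s s' → e.ok w L s' ∧ e.val L s' = N)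
    (hc : ∀ i s', i < N → Emit x ((List.range i).flatMap g) s s' → s'.reg x = i →
      c.Runs w L T s' (Emit (x + 1) (g i) s')) :
    (GCmd.loop x e c).Runs w L (N * (T + (e.comp.cost + 7)) + (e.comp.cost + 5)) s
      (Emit x ((List.range N).flatMap g) s) := by
  refine Runs.mono (Runs.loop hL hN (fun _ => T)
    (fun i s' => s'.reg x = i ∧ Emit x ((List.range i).flatMap g) s s') ?_ (fun _ _ hI => hI.1)
    (fun i s' _ hI => he s' i hI.2) ?_) ?_ fun s' h => h.2
  · refine ⟨by simp, ⟨fun y hy => ?_, rfl, by simp⟩⟩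
    rw [GState.setReg_reg_ne _ _ hy.ne]
  · rintro i s' hi ⟨hx, hE⟩
    refine Runs.mono (hc i s' hi hE hx) le_rfl ?_
    rintro s'' ⟨h1, h2, h3⟩
    refine ⟨(h1 x (by omega)).trans hx, by simp, ⟨fun y hy => ?_, ?_, ?_⟩⟩
    · rw [GState.setReg_reg_ne _ _ hy.ne, h1 y (by omega), hE.reg y hy]
    · exact h2.trans hE.fld
    · rw [GState.setReg_out, h3, hE.out, List.range_succ, List.flatMap_append]
      simp
  · simp

/-- The states agree, except for the output and the registers used by output commands. -/
structure Sim (s s' : GState) : Prop where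
  reg : ∀ x, x < 20 ∨ (25 ≤ x ∧ x < 40 ∧ x ≠ 36) → s'.reg x = s.reg x
  fld : s'.fld = s.fld

/-- The bound `cap` on the total output is known in advance, so every single emission can conclude
that its addresses still fit into a word. -/
theorem runs_grid_emit {w : ℕ} {L : Layout} (hL : (L.outBase : ℤ) ≤ 2 ^ w) {n : ℕ}
    (hn : 0 < n) (hN : GExpr.InRange w ((3 * n : ℕ) : ℤ)) (h1 : GExpr.InRange w 1) {s : GState}
    (hs : s.reg 0 = n) {e : GExpr} {c : GCmd} (T : Point → ℕ) (P : Point → Prop)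
    [DecidablePred P] (g : Point → List ℤ) (cap : ℕ)
    (hcap : s.out.length + (((area n).filter P).flatMap g).length ≤ cap)
    (he : ∀ s' u, u ∈ area n → Sim s s' → s'.reg 22 = u.1 + 2 * n → s'.reg 23 = u.2 + 2 * n →
      e.ok w L s' ∧ e.val L s' = if P u then 1 else 0)
    (hc : ∀ s' u, u ∈ area n → P u → Sim s s' → s'.reg 22 = u.1 + 2 * n →
      s'.reg 23 = u.2 + 2 * n → s'.out.length + (g u).length ≤ cap →
      c.Runs w L (T u) s' fun s'' => (∀ x < 40, x ≠ 36 → s''.reg x = s'.reg x) ∧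
        s''.reg 36 = s'.reg 36 + 1 ∧ s''.fld = s'.fld ∧ s''.out = s'.out ++ g u) :
    (grid (.ite e c (.set 24 (.lit 0)))).Runs w L
      (9 * n ^ 2 * (e.comp.cost + 3) + (((area n).filter P).map T).sum + 212 * n ^ 2) s
      fun s' => Sim s s' ∧ s'.reg 36 = s.reg 36 + ((area n).filter P).length ∧
        s'.out = s.out ++ ((area n).filter P).flatMap g := by
  refine Runs.mono (runs_grid hL hn hN (fun u => e.comp.cost + 3 + if P u then T u else 0)
    (fun pre s' => Sim s s' ∧ s'.reg 36 = s.reg 36 + (pre.filter P).length ∧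
        s'.out = s.out ++ (pre.filter P).flatMap g) ?_ ?_ ?_ ?_) ?_ fun s' h => h
  · rintro pre s' ⟨hS, -⟩
    rw [hS.reg 0 (by norm_num), hs]
  · rintro pre s' x v hx hx' ⟨hS, h36, hout⟩
    refine ⟨⟨fun y hy => ?_, hS.fld⟩, ?_, hout⟩
    · rw [GState.setReg_reg_ne _ _ (by omega)]; exact hS.reg y hy
    · rw [GState.setReg_reg_ne _ _ (by omega)]; exact h36
  · exact ⟨⟨fun _ _ => rfl, rfl⟩, by simp, by simp⟩
  · rintro pre u post s' hsp ⟨hS, h36, hout⟩ h22 h23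
    have hu : u ∈ area n := by rw [hsp]; simp
    obtain ⟨o, v⟩ := he s' u hu hS h22 h23
    have h0 : GExpr.InRange w 0 := by
      have : (0 : ℤ) < 2 ^ w := by positivity
      exact ⟨by linarith, by linarith⟩
    refine Runs.mono (Runs.ite hL (T := T u) (T' := 2) o (by rw [v]; split_ifs <;> assumption)
      ?_ ?_) ?_ fun s' h => h
    · intro hv
      have hP : P u := by by_contra hP; exact hv (by rw [v, if_neg hP])
      have hf : (pre ++ [u]).filter P = pre.filter P ++ [u] := by
        simp [List.filter_append, hP]
      have hlen : s'.out.length + (g u).length ≤ cap := by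
        refine le_trans ?_ hcap
        rw [hout, hsp]
        simp only [List.filter_append, List.filter_cons, hP, decide_true, if_true,
          List.flatMap_append, List.flatMap_cons, List.length_append]
        omega
      refine Runs.mono (hc s' u hu hP hS h22 h23 hlen) le_rfl ?_
      rintro s'' ⟨k1, k2, k3, k4⟩
      refine ⟨⟨⟨fun x hx => ?_, k3.trans hS.fld⟩, ?_, ?_⟩, k1 20 (by norm_num) (by norm_num),
        k1 21 (by norm_num) (by norm_num), k1 22 (by norm_num) (by norm_num)⟩
      · rw [k1 x (by omega) (by omega), hS.reg x hx]
      · rw [hf, k2, h36]; simp; ring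
      · rw [hf, k4, hout]; simp
    · intro hv
      have hP : ¬ P u := by intro hP; rw [v, if_pos hP] at hv; norm_num at hv
      have hf : (pre ++ [u]).filter P = pre.filter P := by simp [List.filter_append, hP]
      refine runs_of_wp hL (.set 24 (.lit 0)) _ _ ?_
      simp only [wp]
      rw [hf]
      refine ⟨trivial, ⟨⟨fun x hx => ?_, hS.fld⟩, ?_, hout⟩, ?_, ?_, ?_⟩
      · rw [GState.setReg_reg_ne _ _ (by omega)]; exact hS.reg x hx
      · rw [GState.setReg_reg_ne _ _ (by omega)]; exact h36
      all_goals rw [GState.setReg_reg_ne _ _ (by omega)]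
    · rw [v]
      by_cases hP : P u
      · simp [hP]
      · simp [hP]
  · have : ∀ l : List Point, (l.map fun u => e.comp.cost + 3 + if P u then T u else 0).sum =
        l.length * (e.comp.cost + 3) + ((l.filter P).map T).sum := by
      intro l
      induction l with
      | nil => simp
      | cons u l ih =>
        rw [List.map_cons, List.sum_cons, ih, List.filter_cons]
        by_cases hP : P u <;> simp [hP] <;> ring
    rw [this, length_area]

end GCmd

/-! ### Emission of the pieces and of the peripheral string. -/

namespace Prog

open GExpr GCmd

/-- Whether a piece with one of the labels `p`, `q` starts at the current point. -/
def startE (a b c d : ℕ) (p q : ℤ) : GExpr :=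
  (eqv (.get 5 gx gy) (.lit p) + eqv (.get 5 gx gy) (.lit q)) *
    ((.lit 1 - sameE (gx - .reg a) (gy - .reg b) gx gy) *
      (.lit 1 - mergeE a b (gx - .reg c) (gy - .reg d) gx gy))

/-- The coordinates of a point of a piece. -/
def pieceX (a c : ℕ) : GExpr := gx + .reg 40 * .reg c + .reg 41 * .reg a

/-- The coordinates of a point of a piece. -/
def pieceY (b d : ℕ) : GExpr := gy + .reg 40 * .reg d + .reg 41 * .reg b

/-- Writing a point with its character. -/
def emitPoint (x y : GExpr) : GCmd :=
  .seq (.emit (x - .lit 2 * .reg 0)) (.seq (.emit (y - .lit 2 * .reg 0)) (.emit (.get 0 x y)))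

/-- Writing a piece. -/
def emitPiece (a b c d : ℕ) : GCmd :=
  .seq (.seq (.emit (.get 7 gx gy * .get 6 gx gy)) (.set 36 (.reg 36 + .lit 1)))
    (.loop 40 (.get 7 gx gy) (.loop 41 (.get 6 gx gy) (emitPoint (pieceX a c) (pieceY b d))))

/-- Writing all pieces with one of the labels `p`, `q`. -/
def pieces (a b c d : ℕ) (p q : ℤ) : GCmd :=
  grid (.ite (startE a b c d p q) (emitPiece a b c d) (.set 24 (.lit 0)))

/-- Writing the points without label. -/
def emitRest : GCmd :=
  grid (.ite (lt (.lit 0) (.get 3 gx gy) * (.lit 1 - lt (.lit 0) (.get 5 gx gy)))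
    (.seq (emitPoint gx gy) (.set 36 (.reg 36 + .lit 1))) (.set 24 (.lit 0)))

/-- Finding and writing the pieces with one of the labels `p`, `q`. -/
def stage (a b c d : ℕ) (p q : ℤ) : GCmd :=
  .seq (lengths a b) (.seq (heights a b c d) (pieces a b c d p q))

end Prog

namespace Ctx

open GExpr GCmd Prog

variable {w : ℕ} {L : Layout} {I : Inst} {LT : List (Point × ℤ)} {LQ : List Point} {tb qb : ℕ}

theorem runs_emitPoint (h : Ctx w L I LT LQ tb qb) {s : GState} (hs : s.reg 0 = I.n)
    (hcol : ∀ u, s.fld 0 (u + gridOffset I.n) = I.col u) {x y : GExpr} {p : Point}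
    (hc : ∀ s' : GState, s'.reg = s.reg → s'.fld = s.fld → Coord w L I.n s' x y p)
    (hcap : (L.outBase + s.out.length + 3 : ℤ) ≤ 2 ^ w) :
    (emitPoint x y).Runs w L (emitPoint x y).maxTime s (Emit 42 (enc (p, I.col p)) s) := by
  refine runs_of_wp h.outBase_le _ _ _ ?_
  have c1 := hc s rfl rfl
  have c2 := hc (s.emitVal p.1) rfl rfl
  have c3 := hc ((s.emitVal p.1).emitVal p.2) rfl rfl
  obtain ⟨o3, v3⟩ := h.get_spec c3 (f := 0) (by norm_num)
  have e1 : (x - .lit 2 * .reg 0).val L s = p.1 := by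
    simp only [val_sub, val_mul, val_lit, val_reg, hs, c1.1.2]; ring
  have e2 : (y - .lit 2 * .reg 0).val L (s.emitVal p.1) = p.2 := by
    simp only [val_sub, val_mul, val_lit, val_reg, GState.emitVal_reg, hs, c2.2.1.2]; ring
  simp only [emitPoint, wp, e1, e2, o3, v3, ok_sub, ok_mul, ok_lit, ok_reg, c1.1.1, c2.2.1.1]
  simp only [GState.emitVal_out, GState.emitVal_fld, List.length_append, List.length_singleton,
    hcol]
  push_cast
  refine ⟨by norm_num, by linarith, by norm_num, by linarith, trivial, by linarith, ⟨?_, ?_, ?_⟩⟩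
  · intros; rfl
  · rfl
  · simp [enc]

@[simp] theorem cost_add (e f : GExpr) :
    (e + f).comp.cost = e.comp.cost + f.comp.cost + 1 := rfl
@[simp] theorem cost_sub (e f : GExpr) :
    (e - f).comp.cost = e.comp.cost + f.comp.cost + 1 := rfl
@[simp] theorem cost_mul (e f : GExpr) :
    (e * f).comp.cost = e.comp.cost + f.comp.cost + 1 := rfl
@[simp] theorem cost_lt (e f : GExpr) :
    (lt e f).comp.cost = e.comp.cost + f.comp.cost + 1 := rfl
@[simp] theorem cost_eqv (e f : GExpr) :
    (eqv e f).comp.cost = e.comp.cost + f.comp.cost + 1 := rfl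
/-- The tables are filled. -/
structure Ready (I : Inst) (tb qb : ℕ) (s : GState) : Prop where
  env : Env I tb qb s
  stored : Stored I s
  bound6 : ∀ p, 0 ≤ s.fld 6 p ∧ s.fld 6 p ≤ 9 * (I.n : ℤ) ^ 2
  bound7 : ∀ p, 0 ≤ s.fld 7 p ∧ s.fld 7 p ≤ 9 * (I.n : ℤ) ^ 2

theorem Ready.congr {s s' : GState} (h : Ready I tb qb s)
    (hreg : ∀ x < 20, s'.reg x = s.reg x) (hfld : s'.fld = s.fld) : Ready I tb qb s' where
  env := h.env.congr hreg
  stored := ⟨by rw [hfld]; exact h.stored.col, by rw [hfld]; exact h.stored.lab⟩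
  bound6 := by rw [hfld]; exact h.bound6
  bound7 := by rw [hfld]; exact h.bound7

theorem Ready.sim {s s' : GState} (h : Ready I tb qb s) (hS : Sim s s') : Ready I tb qb s' :=
  h.congr (fun x hx => hS.reg x (.inl hx)) hS.fld

/-- The entry of a table, as a natural number. -/
def table (n f : ℕ) (s : GState) (u : Point) : ℕ := (s.fld f (u + gridOffset n)).toNat

theorem coord_self {n : ℕ} {s : GState} {u : Point} (hu : u ∈ area n)
    (h22 : s.reg 22 = u.1 + 2 * n) (h23 : s.reg 23 = u.2 + 2 * n) :
    Coord w L n s gx gy u := by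
  have := mem_area.1 hu
  exact ⟨⟨trivial, h22⟩, ⟨trivial, h23⟩, by unfold InGrid; omega⟩

/-- The registers `a`, `b`, `c`, `d` hold the lattice vectors `ρ` and `τ`. -/
structure Dirs (I : Inst) (ρ τ : Point) (a b c d : ℕ) : Prop where
  eq : (ρ = I.ψ ∧ τ = I.φ) ∨ (ρ = I.φ ∧ τ = I.ψ)
  lt : a < 20 ∧ b < 20 ∧ c < 20 ∧ d < 20
  reg : ∀ {tb qb s}, Env I tb qb s →
    (s.reg a = ρ.1 ∧ s.reg b = ρ.2) ∧ s.reg c = τ.1 ∧ s.reg d = τ.2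

theorem dirs_psi (I : Inst) : Dirs I I.ψ I.φ 4 5 2 3 :=
  ⟨.inl ⟨rfl, rfl⟩, by norm_num, fun h => ⟨⟨h.r4, h.r5⟩, h.r2, h.r3⟩⟩

theorem dirs_phi (I : Inst) : Dirs I I.φ I.ψ 2 3 4 5 :=
  ⟨.inr ⟨rfl, rfl⟩, by norm_num, fun h => ⟨⟨h.r2, h.r3⟩, h.r4, h.r5⟩⟩

variable {ρ τ : Point} {a b c d : ℕ}

theorem Dirs.rho (hd : Dirs I ρ τ a b c d) : ρ = I.φ ∨ ρ = I.ψ := by have := hd.eq; tauto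

theorem Dirs.tau (hd : Dirs I ρ τ a b c d) : τ = I.φ ∨ τ = I.ψ := by have := hd.eq; tauto

theorem runs_lengths (h : Ctx w L I LT LQ tb qb) {s : GState} (hs : Ready I tb qb s)
    (hd : Dirs I ρ τ a b c d) : ∃ K : ℕ, K = 3000 ∧
    (lengths a b).Runs w L (K * I.n ^ 2) s fun s' =>
      Agree 6 s s' ∧ Ready I tb qb s' ∧ IsChainLength ρ {u | I.lab u ≠ 0}
        (fun u => SameCell I.lab I.col u (u + ρ)) (table I.n 6 s') := by
  classical
  refine ⟨3000, rfl, ?_⟩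
  obtain ⟨⟨ra, rb⟩, -, -⟩ := hd.reg hs.env
  obtain ⟨s1, s2, s3⟩ := h.step_bounds hd.rho
  refine Runs.mono (h.runs_chain hs.env (f := 6) (by norm_num) hd.lt.1 hd.lt.2.1 hd.rho ra rb
    (R := fun u => SameCell I.lab I.col u (u + ρ)) hs.bound6 ?_ ?_) ?_ ?_
  · rintro u ⟨h1, h2, -⟩
    exact ⟨h1, h2 ▸ h1⟩
  · intro s' u hu hA h22 h23
    have hu' := mem_area.1 hu
    obtain ⟨⟨ra', rb'⟩, -, -⟩ := hd.reg (hA.env hs.env)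
    refine h.same_spec ⟨?_, ?_⟩ (coord_self hu h22 h23) ⟨⟨?_, ?_⟩, ⟨?_, ?_⟩, ?_⟩
    · rw [hA.fld 0 (by norm_num)]; exact hs.stored.col
    · rw [hA.fld 5 (by norm_num)]; exact hs.stored.lab
    · simp [gx]
    · simp [gx, h22, ra']; ring
    · simp [gy]
    · simp [gy, h23, rb']; ring
    · simp only [InGrid, Prod.fst_add, Prod.snd_add]; omega
  · have hk : (GCmd.put 6 (.reg 22) (.reg 23) (.lit 1 + sameE gx gy (gx + .reg a) (gy + .reg b) *
        .get 6 (gx + .reg a) (gy + .reg b))).maxTime ≤ 300 := Nat.le_of_ble_eq_true rfl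
    exact Nat.mul_le_mul_right _ (by omega)
  · rintro s' ⟨hA, hB, hF⟩
    refine ⟨hA, ⟨hA.env hs.env, ⟨?_, ?_⟩, hB, ?_⟩, hF⟩
    · rw [hA.fld 0 (by norm_num)]; exact hs.stored.col
    · rw [hA.fld 5 (by norm_num)]; exact hs.stored.lab
    · rw [hA.fld 7 (by norm_num)]; exact hs.bound7

theorem runs_heights (h : Ctx w L I LT LQ tb qb) {s : GState} (hs : Ready I tb qb s)
    (hd : Dirs I ρ τ a b c d) : ∃ K : ℕ, K = 6000 ∧
    (heights a b c d).Runs w L (K * I.n ^ 2) s fun s' =>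
      Agree 7 s s' ∧ Ready I tb qb s' ∧ IsChainLength τ {u | I.lab u ≠ 0}
        (fun u => MergeRuns I.lab I.col ρ (table I.n 6 s) u (u + τ)) (table I.n 7 s') := by
  classical
  refine ⟨6000, rfl, ?_⟩
  obtain ⟨⟨ra, rb⟩, rc, rd⟩ := hd.reg hs.env
  obtain ⟨s1, s2, s3⟩ := h.step_bounds hd.rho
  obtain ⟨s4, s5, s6⟩ := h.step_bounds hd.tau
  refine Runs.mono (h.runs_chain hs.env (f := 7) (by norm_num) hd.lt.2.2.1 hd.lt.2.2.2 hd.tau rc rd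
    (R := fun u => MergeRuns I.lab I.col ρ (table I.n 6 s) u (u + τ)) hs.bound7 ?_ ?_) ?_ ?_
  · rintro u ⟨⟨h1, h2, -⟩, -⟩
    exact ⟨h1, h2 ▸ h1⟩
  · intro s' u hu hA h22 h23
    have hu' := mem_area.1 hu
    obtain ⟨⟨ra', rb'⟩, rc', rd'⟩ := hd.reg (hA.env hs.env)
    have h6 : s'.fld 6 = s.fld 6 := hA.fld 6 (by norm_num)
    have := h.merge_spec (s := s') (x := gx) (y := gy) (x' := gx + .reg c) (y' := gy + .reg d)
      (p := u) (q := u + τ) (ρ := ρ) (a := a) (b := b) ⟨?_, ?_⟩ ?_ ra' rb'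
      (coord_self hu h22 h23) ⟨⟨?_, ?_⟩, ⟨?_, ?_⟩, ?_⟩ ?_ ?_
    · rw [h6] at this
      exact this
    · rw [hA.fld 0 (by norm_num)]; exact hs.stored.col
    · rw [hA.fld 5 (by norm_num)]; exact hs.stored.lab
    · rw [h6]; exact hs.bound6
    · simp [gx]
    · simp [gx, h22, rc']; ring
    · simp [gy]
    · simp [gy, h23, rd']; ring
    · simp only [InGrid, Prod.fst_add, Prod.snd_add]; omega
    · simp only [InGrid, Prod.fst_sub, Prod.snd_sub]; omega
    · simp only [InGrid, Prod.fst_sub, Prod.snd_sub, Prod.fst_add, Prod.snd_add]; omega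
  · have hk : (GCmd.put 7 (.reg 22) (.reg 23)
        (.lit 1 + mergeE a b gx gy (gx + .reg c) (gy + .reg d) *
          .get 7 (gx + .reg c) (gy + .reg d))).maxTime ≤ 640 := by
      simp [maxTime, mergeE, sameE, GExpr.address, GExpr.comp, RamExpr.cost, gx, gy]
    exact Nat.mul_le_mul_right _ (by omega)
  · rintro s' ⟨hA, hB, hF⟩
    refine ⟨hA, ⟨hA.env hs.env, ⟨?_, ?_⟩, ?_, hB⟩, hF⟩
    · rw [hA.fld 0 (by norm_num)]; exact hs.stored.col
    · rw [hA.fld 5 (by norm_num)]; exact hs.stored.lab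
    · rw [hA.fld 6 (by norm_num)]; exact hs.bound6

theorem isRunTable (h : Ctx w L I LT LQ tb qb) (hd : Dirs I ρ τ a b c d) {F G : Point → ℕ}
    (hF : IsChainLength ρ {u | I.lab u ≠ 0} (fun u => SameCell I.lab I.col u (u + ρ)) F)
    (hG : IsChainLength τ {u | I.lab u ≠ 0} (fun u => MergeRuns I.lab I.col ρ F u (u + τ)) G) :
    IsRunTable I.lab I.col ρ τ F G :=
  ⟨hF, hG, key I, h.key_sub hd.rho, h.key_sub hd.tau, fun _ hu => (h.key_bounds hu).1⟩

/-- The number of points is height times length and is known before the first point is written, so a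
piece needs no later patch. -/
theorem runs_emitPiece (h : Ctx w L I LT LQ tb qb) {s : GState} (hs : Ready I tb qb s)
    (hd : Dirs I ρ τ a b c d)
    (hrun : IsRunTable I.lab I.col ρ τ (table I.n 6 s) (table I.n 7 s)) {u : Point}
    (hu : IsStart I.lab I.col ρ τ (table I.n 6 s) u) (h22 : s.reg 22 = u.1 + 2 * I.n)
    (h23 : s.reg 23 = u.2 + 2 * I.n)
    (hcap : (L.outBase + s.out.length + (1 + 3 * (table I.n 7 s u * table I.n 6 s u)) : ℤ)
      ≤ 2 ^ w) :
    (emitPiece a b c d).Runs w L (500 * (table I.n 7 s u * table I.n 6 s u)) s fun s' =>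
      (∀ x < 40, x ≠ 36 → s'.reg x = s.reg x) ∧ s'.reg 36 = s.reg 36 + 1 ∧ s'.fld = s.fld ∧
        s'.out = s.out ++
          encStr (pieceList I.col ρ τ (table I.n 6 s) (table I.n 7 s) u) := by
  set p := table I.n 6 s u with hp
  set q := table I.n 7 s u with hq
  have hua : u ∈ area I.n := by
    by_contra hc; exact hu.1 (h.lab_outside hc)
  have hn2 : (0 : ℤ) ≤ (I.n : ℤ) ^ 2 := by positivity
  have b6 := hs.bound6 (u + gridOffset I.n)
  have b7 := hs.bound7 (u + gridOffset I.n)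
  have hpe : s.fld 6 (u + gridOffset I.n) = p := (Int.toNat_of_nonneg b6.1).symm
  have hqe : s.fld 7 (u + gridOffset I.n) = q := (Int.toNat_of_nonneg b7.1).symm
  have hp0 : 0 < p := hrun.run.pos hu.1
  have hq0 : 0 < q := hrun.stack.pos hu.1
  have hpr : InRange w (p : ℤ) := by
    rw [← hpe]; exact h.inRange_sq (by linarith) (by linarith)
  have hqr : InRange w (q : ℤ) := by
    rw [← hqe]; exact h.inRange_sq (by linarith) (by linarith)
  have hget : ∀ s' : GState, s'.reg 22 = s.reg 22 → s'.reg 23 = s.reg 23 → s'.fld = s.fld →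
      ((GExpr.get 6 gx gy).ok w L s' ∧ (GExpr.get 6 gx gy).val L s' = p) ∧
      (GExpr.get 7 gx gy).ok w L s' ∧ (GExpr.get 7 gx gy).val L s' = q := by
    intro s' e1 e2 e3
    have hc : Coord w L I.n s' gx gy u := coord_self hua (e1.trans h22) (e2.trans h23)
    have g6 := h.get_spec hc (f := 6) (by norm_num)
    have g7 := h.get_spec hc (f := 7) (by norm_num)
    rw [e3, hpe] at g6
    rw [e3, hqe] at g7
    exact ⟨g6, g7⟩
  set g : ℕ → ℕ → List ℤ := fun j i =>
    enc (u + (j : ℤ) • τ + (i : ℤ) • ρ, I.col (u + (j : ℤ) • τ + (i : ℤ) • ρ)) with hg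
  have hlen : ∀ j k, ((List.range k).flatMap (g j)).length = 3 * k := by
    intro j k
    simp [List.length_flatMap, hg, enc]; ring
  have hlen2 : ∀ k, ((List.range k).flatMap fun j => (List.range p).flatMap (g j)).length =
      3 * (k * p) := by
    intro k
    rw [List.length_flatMap]
    simp only [hlen]
    simp; ring
  refine Runs.mono (Runs.seq (T := 40) (Q := fun s' => (∀ x < 40, x ≠ 36 → s'.reg x = s.reg x) ∧
      s'.reg 36 = s.reg 36 + 1 ∧ s'.fld = s.fld ∧ s'.out = s.out ++ [(q * p : ℤ)])
      (R := fun s' => (∀ x < 40, x ≠ 36 → s'.reg x = s.reg x) ∧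
        s'.reg 36 = s.reg 36 + 1 ∧ s'.fld = s.fld ∧ s'.out = s.out ++ [(q * p : ℤ)] ++
          (List.range q).flatMap fun j => (List.range p).flatMap (g j))
      (T' := q * (p * (100 + (20 + 7)) + (20 + 5) + (20 + 7)) + (20 + 5)) ?_ ?_) ?_ ?_
  · obtain ⟨⟨o1, v1⟩, o2, v2⟩ := hget s rfl rfl rfl
    refine Runs.mono (runs_of_wp h.outBase_le _ _ _ ?_)
      (show _ ≤ 40 from Nat.le_of_ble_eq_true rfl) fun s' h => h
    simp only [wp, ok_mul, o1, o2, val_mul, v1, v2, ok_add, ok_reg, ok_lit, val_add, val_reg,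
      val_lit]
    refine ⟨by simp, ?_, by simp, ?_, by simp, rfl, rfl⟩
    · have : (0 : ℤ) ≤ (q : ℤ) * p := by positivity
      linarith
    · intro x hx hx'
      rw [GState.setReg_reg_ne _ _ hx']; rfl
  · rintro s1 ⟨k1, k2, k3, k4⟩
    have hc40 : (GExpr.get 7 gx gy).comp.cost ≤ 20 := by decide
    have hc41 : (GExpr.get 6 gx gy).comp.cost ≤ 20 := by decide
    have hmain := runs_emit_loop h.outBase_le (x := 40) (e := .get 7 gx gy)
      (c := .loop 41 (.get 6 gx gy) (emitPoint (pieceX a c) (pieceY b d))) hqr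
      (p * (100 + (20 + 7)) + (20 + 5)) (fun j => (List.range p).flatMap (g j)) (s := s1) ?_ ?_
    · refine Runs.mono hmain (by gcongr) ?_
      rintro s' ⟨j1, j2, j3⟩
      refine ⟨fun x hx hx' => by rw [j1 x hx, k1 x hx hx'], by rw [j1 36 (by norm_num), k2],
        j2.trans k3, by rw [j3, k4]⟩
    · rintro s' i ⟨j1, j2, -⟩
      exact (hget s' (by rw [j1 _ (by norm_num), k1 _ (by norm_num) (by norm_num)])
        (by rw [j1 _ (by norm_num), k1 _ (by norm_num) (by norm_num)]) (j2.trans k3)).2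
    · rintro j s2 hj ⟨j1, j2, j3⟩ h40
      have hmain2 := runs_emit_loop h.outBase_le (x := 41) (e := .get 6 gx gy)
        (c := emitPoint (pieceX a c) (pieceY b d)) hpr 100 (g j) (s := s2) ?_ ?_
      · exact Runs.mono hmain2 (by gcongr) fun s' h => h
      · rintro s' i ⟨l1, l2, -⟩
        exact (hget s' (by rw [l1 _ (by norm_num), j1 _ (by norm_num), k1 _ (by norm_num) (by norm_num)])
          (by rw [l1 _ (by norm_num), j1 _ (by norm_num), k1 _ (by norm_num) (by norm_num)])
          (l2.trans (j2.trans k3))).1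
      · rintro i s3 hi ⟨l1, l2, l3⟩ h41
        have hreg : ∀ x < 40, x ≠ 36 → s3.reg x = s.reg x := fun x hx hx' => by
          rw [l1 x (by omega), j1 x hx, k1 x hx hx']
        have hfld : s3.fld = s.fld := l2.trans (j2.trans k3)
        have hE : Env I tb qb s3 := hs.env.congr fun x hx => hreg x (by omega) (by omega)
        obtain ⟨⟨ra, rb⟩, rc, rd⟩ := hd.reg hE
        have h40' : s3.reg 40 = j := by rw [l1 40 (by norm_num), h40]
        refine Runs.mono (h.runs_emitPoint (p := u + (j : ℤ) • τ + (i : ℤ) • ρ) hE.r0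
          (by rw [hfld]; exact hs.stored.col) ?_ ?_)
          (show _ ≤ 100 from Nat.le_of_ble_eq_true rfl) fun s' h => h
        · intro s' e1 e2
          refine ⟨⟨by simp [pieceX, gx], ?_⟩, ⟨by simp [pieceY, gy], ?_⟩, ?_⟩
          · simp [pieceX, gx, e1, h40', h41, ra, rc, hreg 22 (by norm_num) (by norm_num), h22]
            ring
          · simp [pieceY, gy, e1, h40', h41, rb, rd, hreg 23 (by norm_num) (by norm_num), h23]
            ring
          · have hl := (hrun.piece_spec hu hj hi).1
            have := (Inst.deep_of_lab _ (by rw [hl]; exact hu.1)).mem_text h.valid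
            unfold InGrid
            omega
        · have e : s3.out.length = s.out.length + 1 + 3 * (j * p) + 3 * i := by
            rw [l3, j3, k4]
            simp only [List.length_append, hlen, hlen2, List.length_singleton]
          have h1 : j * p + i + 1 ≤ q * p := by
            have : (j + 1) * p ≤ q * p := Nat.mul_le_mul_right _ hj
            linarith
          have h2 : (s3.out.length : ℤ) + 3 ≤ s.out.length + (1 + 3 * (q * p)) := by
            rw [e]; push_cast; exact_mod_cast (by omega)
          linarith
  -- A piece is non-empty, so the overhead per piece and per run is absorbed by the number of its
  -- points.
  · have : 1 ≤ q * p := Nat.mul_pos hq0 hp0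
    have : q ≤ q * p := Nat.le_mul_of_pos_right _ hp0
    nlinarith
  · rintro s' ⟨k1, k2, k3, k4⟩
    refine ⟨k1, k2, k3, ?_⟩
    rw [k4, encStr, length_pieceList, ← hp, ← hq, List.append_assoc, pieceList, List.flatMap_assoc]
    simp only [List.flatMap_map, ← hp, ← hq, hg]
    push_cast
    rfl

end Ctx

/-- A piece with label `p` or `q` starts at `u`. -/
def StartOf (I : Inst) (ρ τ : Point) (F : Point → ℕ) (p q : ℤ) (u : Point) : Prop :=
  IsStart I.lab I.col ρ τ F u ∧ (I.lab u = p ∨ I.lab u = q)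

open Classical in
/-- The active points without label, with their characters. -/
noncomputable def restList (I : Inst) : List (Point × ℤ) :=
  ((area I.n).filter fun u => I.Act u ∧ I.lab u = 0).map fun u => (u, I.col u)

open Classical in
/-- The pieces with label `p` or `q`. -/
noncomputable def pieceLists (I : Inst) (ρ τ : Point) (F G : Point → ℕ) (p q : ℤ) :
    List (List (Point × ℤ)) :=
  ((area I.n).filter (StartOf I ρ τ F p q)).map (pieceList I.col ρ τ F G)

theorem length_flatMap_encStr {α : Type*} (f : α → List (Point × ℤ)) (l : List α) :
    (l.flatMap fun u => encStr (f u)).length = l.length + 3 * (l.flatMap f).length := by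
  induction l with
  | nil => rfl
  | cons u l ih =>
    simp only [List.flatMap_cons, List.length_append, ih, length_encStr, List.length_cons]
    ring

namespace Prog

open GExpr GCmd

/-- The whole program. -/
def main : GCmd :=
  .seq setup <| .seq loadText <| .seq loadMarks <| .seq spreadX <| .seq spreadY <|
  .seq markBad <| .seq labels <| .seq (.seq (.emit (.lit 0)) (.set 36 (.lit 0))) <|
  .seq emitRest <|
  .seq (.seq (.patch (.lit 0) (.reg 36)) (.seq (.set 38 (.lit 1 + .lit 3 * .reg 36))
    (.seq (.emit (.lit 0)) (.set 36 (.lit 0))))) <|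
  .seq (stage 4 5 2 3 1 4) <| .seq (stage 2 3 4 5 2 3) <| .patch (.reg 38) (.reg 36)

end Prog

namespace Ctx

open GExpr GCmd Prog

variable {w : ℕ} {L : Layout} {I : Inst} {LT : List (Point × ℤ)} {LQ : List Point} {tb qb : ℕ}
  {ρ τ : Point} {a b c d : ℕ}

theorem mem_area_of_lab (h : Ctx w L I LT LQ tb qb) {u : Point} (hu : I.lab u ≠ 0) :
    u ∈ area I.n := by
  by_contra hc; exact hu (h.lab_outside hc)

/-- Pieces are disjoint and consist of labelled points, all of which lie in the work area. This
makes both the time and the size of the output O(n²). -/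
theorem length_pieces_le (h : Ctx w L I LT LQ tb qb) {F G : Point → ℕ}
    (hrun : IsRunTable I.lab I.col ρ τ F G) {l : List Point} (hl : l.Nodup)
    (hs : ∀ u ∈ l, IsStart I.lab I.col ρ τ F u) :
    (l.flatMap (pieceList I.col ρ τ F G)).length ≤ 9 * I.n ^ 2 := by
  rw [← length_area, ← List.length_map (f := Prod.fst)]
  refine (List.subperm_of_subset (hrun.pieces_nodup hl hs) ?_).length_le
  intro v hv
  obtain ⟨⟨v, c⟩, hv', rfl⟩ := List.mem_map.1 hv
  obtain ⟨u, hu, hv''⟩ := List.mem_flatMap.1 hv'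
  obtain ⟨⟨i, j, hj, hi, he⟩, -⟩ := mem_pieceList.1 hv''
  refine h.mem_area_of_lab ?_
  rw [he, (hrun.piece_spec (hs u hu) hj hi).1]
  exact (hs u hu).1

/-- Since `p ≠ q`, the sum of the two equality tests is the truth value of their disjunction. -/
theorem runs_pieces (h : Ctx w L I LT LQ tb qb) {s : GState} (hs : Ready I tb qb s)
    (hd : Dirs I ρ τ a b c d) {F G : Point → ℕ} (hF : table I.n 6 s = F) (hG : table I.n 7 s = G)
    (hrun : IsRunTable I.lab I.col ρ τ F G) {p q : ℤ} (hp : 0 < p ∧ p ≤ 4) (hq : 0 < q ∧ q ≤ 4)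
    (hpq : p ≠ q) (hcap : (L.outBase + (s.out.length + 36 * I.n ^ 2) : ℤ) ≤ 2 ^ w) :
    ∃ K : ℕ, K = 10000 ∧ (pieces a b c d p q).Runs w L (K * I.n ^ 2) s fun s' =>
      Sim s s' ∧ s'.reg 36 = s.reg 36 + (pieceLists I ρ τ F G p q).length ∧
        s'.out = s.out ++ (pieceLists I ρ τ F G p q).flatMap encStr := by
  classical
  refine ⟨10000, rfl, ?_⟩
  set l := (area I.n).filter (StartOf I ρ τ F p q) with hl
  have hnd : l.Nodup := (area_nodup _).filter _
  have hst : ∀ u ∈ l, IsStart I.lab I.col ρ τ F u := fun u hu => by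
    have := (List.mem_filter.1 hu).2
    simp only [decide_eq_true_eq] at this
    exact this.1
  have hlen1 := h.length_pieces_le hrun hnd hst
  have hlen2 : l.length ≤ 9 * I.n ^ 2 := by
    rw [← length_area]; exact List.length_filter_le _ _
  obtain ⟨s1, s2, s3⟩ := h.step_bounds hd.rho
  obtain ⟨s4, s5, s6⟩ := h.step_bounds hd.tau
  have hmain := runs_grid_emit h.outBase_le h.n_pos h.inRange_3n
    (h.inRange_small (by norm_num) (by norm_num)) hs.env.r0 (e := startE a b c d p q)
    (c := emitPiece a b c d) (fun u => 500 * (G u * F u)) (StartOf I ρ τ F p q)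
    (fun u => encStr (pieceList I.col ρ τ F G u)) (s.out.length + 36 * I.n ^ 2)
    -- At most `9 n ^ 2` length words, and three words for each of at most `9 n ^ 2` points.
    (by rw [length_flatMap_encStr, ← hl]; omega) ?_ ?_
  · refine Runs.mono hmain ?_ ?_
    · have hc : (startE a b c d p q).comp.cost ≤ 500 := by
        simp [startE, mergeE, sameE, GExpr.address, GExpr.comp, RamExpr.cost, gx, gy]
      have hsum : (l.map fun u => 500 * (G u * F u)).sum =
          500 * (l.flatMap (pieceList I.col ρ τ F G)).length := by
        rw [List.length_flatMap, ← List.sum_map_mul_left]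
        simp only [length_pieceList]
      rw [hsum]
      nlinarith
    · rintro s' ⟨k1, k2, k3⟩
      refine ⟨k1, ?_, ?_⟩
      · rw [k2, pieceLists, List.length_map]
      · rw [k3, pieceLists, List.flatMap_map]
  · intro s' u hu hS h22 h23
    have hR := hs.sim hS
    have hu' := mem_area.1 hu
    obtain ⟨⟨ra', rb'⟩, rc', rd'⟩ := hd.reg hR.env
    have hc0 := coord_self (w := w) (L := L) hu h22 h23
    obtain ⟨o1, v1⟩ := h.get_spec hc0 (f := 5) (by norm_num)
    rw [hR.stored.lab] at v1
    have hc1 : Coord w L I.n s' (gx - .reg a) (gy - .reg b) (u - ρ) := by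
      refine ⟨⟨by simp [gx], ?_⟩, ⟨by simp [gy], ?_⟩, ?_⟩
      · simp [gx, h22, ra']; ring
      · simp [gy, h23, rb']; ring
      · simp only [InGrid, Prod.fst_sub, Prod.snd_sub]; omega
    have hc2 : Coord w L I.n s' (gx - .reg c) (gy - .reg d) (u - τ) := by
      refine ⟨⟨by simp [gx], ?_⟩, ⟨by simp [gy], ?_⟩, ?_⟩
      · simp [gx, h22, rc']; ring
      · simp [gy, h23, rd']; ring
      · simp only [InGrid, Prod.fst_sub, Prod.snd_sub]; omega
    obtain ⟨o2, v2⟩ := h.same_spec hR.stored hc1 hc0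
    obtain ⟨o3, v3⟩ := h.merge_spec hR.stored hR.bound6 ra' rb' hc2 hc0
      (by simp only [InGrid, Prod.fst_sub, Prod.snd_sub]; omega) hc1.2.2
    have hF' : (fun u => (s'.fld 6 (u + gridOffset I.n)).toNat) = F := by
      rw [← hF, hS.fld]; rfl
    rw [hF'] at v3
    have ip : InRange w p := h.inRange_small (by omega) (by omega)
    have iq : InRange w q := h.inRange_small (by omega) (by omega)
    simp only [startE, ok_mul, ok_add, ok_sub, ok_lit, ok_eqv, o1, o2, o3, val_mul, val_add,
      val_sub, val_lit, val_eqv, v1, v2, v3, h.inRange_lab, ip, iq, and_self, true_and]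
    unfold StartOf IsStart
    by_cases e1 : I.lab u = p
    · have e2 : I.lab u ≠ q := e1 ▸ hpq
      have e3 : p ≠ 0 := by omega
      have e4 : p ≠ q := hpq
      by_cases e5 : SameCell I.lab I.col (u - ρ) u <;>
        by_cases e6 : MergeRuns I.lab I.col ρ F (u - τ) u <;> simp [e1, e3, e4, e5, e6]
    · by_cases e2 : I.lab u = q
      · have e3 : q ≠ 0 := by omega
        have e4 : q ≠ p := hpq.symm
        by_cases e5 : SameCell I.lab I.col (u - ρ) u <;>
          by_cases e6 : MergeRuns I.lab I.col ρ F (u - τ) u <;> simp [e2, e3, e4, e5, e6]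
      · simp [e1, e2]
  · intro s' u hu hP hS h22 h23 hlen
    have e6 : table I.n 6 s' = F := by rw [← hF]; unfold table; rw [hS.fld]
    have e7 : table I.n 7 s' = G := by rw [← hG]; unfold table; rw [hS.fld]
    have := h.runs_emitPiece (hs.sim hS) hd (by rw [e6, e7]; exact hrun) (u := u)
      (by rw [e6]; exact hP.1) h22 h23 ?_
    · rw [e6, e7] at this
      exact this
    · rw [e6, e7]
      rw [length_encStr, length_pieceList] at hlen
      have : (s'.out.length : ℤ) + (1 + 3 * (G u * F u)) ≤ s.out.length + 36 * I.n ^ 2 := by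
        exact_mod_cast hlen
      linarith

theorem runs_stage (h : Ctx w L I LT LQ tb qb) {s : GState} (hs : Ready I tb qb s)
    (hd : Dirs I ρ τ a b c d) {p q : ℤ} (hp : 0 < p ∧ p ≤ 4) (hq : 0 < q ∧ q ≤ 4)
    (hpq : p ≠ q) (hcap : (L.outBase + (s.out.length + 36 * I.n ^ 2) : ℤ) ≤ 2 ^ w) :
    ∃ K : ℕ, K = 19000 ∧ (stage a b c d p q).Runs w L (K * I.n ^ 2) s fun s' =>
      Ready I tb qb s' ∧ s'.reg 38 = s.reg 38 ∧ ∃ F G, IsRunTable I.lab I.col ρ τ F G ∧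
        (pieceLists I ρ τ F G p q).length ≤ 9 * I.n ^ 2 ∧
        ((pieceLists I ρ τ F G p q).flatMap encStr).length ≤ 36 * I.n ^ 2 ∧
        s'.reg 36 = s.reg 36 + (pieceLists I ρ τ F G p q).length ∧
        s'.out = s.out ++ (pieceLists I ρ τ F G p q).flatMap encStr := by
  classical
  refine ⟨19000, rfl, ?_⟩
  obtain ⟨K1, rfl, h1⟩ := h.runs_lengths hs hd
  refine Runs.mono (Runs.seq h1 (T' := 16000 * I.n ^ 2) ?_) (by linarith) fun s' h => h
  rintro s1 ⟨hA1, hR1, hF1⟩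
  obtain ⟨K2, rfl, h2⟩ := h.runs_heights hR1 hd
  refine Runs.mono (Runs.seq h2 (T' := 10000 * I.n ^ 2) ?_) (by linarith) fun s' h => h
  rintro s2 ⟨hA2, hR2, hG2⟩
  have hrun := h.isRunTable hd hF1 hG2
  have e6 : table I.n 6 s2 = table I.n 6 s1 := by
    unfold table; rw [hA2.fld 6 (by norm_num)]
  obtain ⟨K3, rfl, h3⟩ := h.runs_pieces hR2 hd e6 rfl hrun hp hq hpq
    (by rw [hA2.out, hA1.out]; exact hcap)
  refine Runs.mono h3 le_rfl ?_
  rintro s3 ⟨hS, h36, hout⟩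
  set l := (area I.n).filter (StartOf I ρ τ (table I.n 6 s1) p q) with hl
  have hnd : l.Nodup := (area_nodup _).filter _
  have hst : ∀ u ∈ l, IsStart I.lab I.col ρ τ (table I.n 6 s1) u := fun u hu => by
    have := (List.mem_filter.1 hu).2
    simp only [decide_eq_true_eq] at this
    exact this.1
  have hlen1 := h.length_pieces_le hrun hnd hst
  have hlen2 : l.length ≤ 9 * I.n ^ 2 := by
    rw [← length_area]; exact List.length_filter_le _ _
  refine ⟨hR2.sim hS, ?_, _, _, hrun, ?_, ?_, ?_, ?_⟩
  · rw [hS.reg 38 (by norm_num), hA2.reg 38 (by norm_num), hA1.reg 38 (by norm_num)]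
  · rw [pieceLists, List.length_map]; exact hlen2
  · rw [pieceLists, List.flatMap_map, length_flatMap_encStr, ← hl]; omega
  · rw [h36, hA2.reg 36 (by norm_num), hA1.reg 36 (by norm_num)]
  · rw [hout, hA2.out, hA1.out]

theorem runs_emitRest (h : Ctx w L I LT LQ tb qb) {s : GState} (hs : Ready I tb qb s)
    (hb : ∀ p, 0 ≤ s.fld 3 p ∧ s.fld 3 p ≤ I.m)
    (hact : ∀ u, 0 < s.fld 3 (u + gridOffset I.n) ↔ I.Act u)
    (hcap : (L.outBase + (s.out.length + 27 * I.n ^ 2) : ℤ) ≤ 2 ^ w) :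
    ∃ K : ℕ, K = 3000 ∧ emitRest.Runs w L (K * I.n ^ 2) s fun s' =>
      Sim s s' ∧ (restList I).length ≤ 9 * I.n ^ 2 ∧
        s'.reg 36 = s.reg 36 + (restList I).length ∧
        s'.out = s.out ++ (restList I).flatMap enc := by
  classical
  refine ⟨3000, rfl, ?_⟩
  set l := (area I.n).filter (fun u => I.Act u ∧ I.lab u = 0) with hl
  have hlen : l.length ≤ 9 * I.n ^ 2 := by
    rw [← length_area]; exact List.length_filter_le _ _
  have hmn : (I.m : ℤ) ≤ I.n := by exact_mod_cast h.valid.m_le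
  have hlen2 : (l.flatMap fun u => enc (u, I.col u)).length = 3 * l.length := by
    have := length_flatMap_enc (l.map fun u => (u, I.col u))
    rwa [List.flatMap_map, List.length_map] at this
  have hmain := runs_grid_emit h.outBase_le h.n_pos h.inRange_3n
    (h.inRange_small (by norm_num) (by norm_num)) hs.env.r0
    (e := lt (.lit 0) (.get 3 gx gy) * (.lit 1 - lt (.lit 0) (.get 5 gx gy)))
    (c := .seq (emitPoint gx gy) (.set 36 (.reg 36 + .lit 1))) (fun u => 110)
    (fun u => I.Act u ∧ I.lab u = 0)
    (fun u => enc (u, I.col u)) (s.out.length + 27 * I.n ^ 2) (by rw [← hl, hlen2]; omega) ?_ ?_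
  · refine Runs.mono hmain ?_ ?_
    · have hc : (lt (.lit 0) (.get 3 gx gy) *
        (.lit 1 - lt (.lit 0) (.get 5 gx gy))).comp.cost ≤ 100 := by decide
      have hsum : (l.map fun _ => 110).sum = 110 * l.length := by
        simp; ring
      rw [hsum]
      nlinarith
    · rintro s' ⟨k1, k2, k3⟩
      refine ⟨k1, ?_, ?_, ?_⟩
      · rw [restList, List.length_map]; exact hlen
      · rw [k2, restList, List.length_map]
      · rw [k3, restList, List.flatMap_map]
  · intro s' u hu hS h22 h23
    have hR := hs.sim hS
    have hc0 := coord_self (w := w) (L := L) hu h22 h23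
    obtain ⟨o1, v1⟩ := h.get_spec hc0 (f := 5) (by norm_num)
    obtain ⟨o2, v2⟩ := h.get_spec hc0 (f := 3) (by norm_num)
    rw [hR.stored.lab] at v1
    rw [hS.fld] at v2
    have b := hb (u + gridOffset I.n)
    have i3 : InRange w (s.fld 3 (u + gridOffset I.n)) := h.inRange_lin (by omega) (by omega)
    have hl0 := (lab_range (I := I) u).1
    have hl1 : 0 < I.lab u ↔ ¬ I.lab u = 0 := by omega
    simp only [ok_mul, ok_sub, ok_lit, ok_lt, o1, o2, val_mul,
      val_sub, val_lit, val_lt, v1, v2, h.inRange_lab, i3,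
      h.inRange_small (show -900 ≤ (0 : ℤ) by norm_num) (by norm_num), and_self, true_and, hact,
      hl1]
    by_cases e1 : I.Act u <;> by_cases e2 : I.lab u = 0 <;> simp [e1, e2]
  · intro s' u hu hP hS h22 h23 hlen'
    have hR := hs.sim hS
    have e3 : (enc (u, I.col u)).length = 3 := rfl
    rw [e3] at hlen'
    have hcap' : (L.outBase + s'.out.length + 3 : ℤ) ≤ 2 ^ w := by
      have : (s'.out.length : ℤ) + 3 ≤ s.out.length + 27 * I.n ^ 2 := by exact_mod_cast hlen'
      linarith
    refine Runs.mono (Runs.seq (h.runs_emitPoint hR.env.r0 hR.stored.col (p := u) ?_ hcap')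
      (T' := 10) (R := fun s'' => (∀ x < 40, x ≠ 36 → s''.reg x = s'.reg x) ∧
        s''.reg 36 = s'.reg 36 + 1 ∧ s''.fld = s'.fld ∧ s''.out = s'.out ++ enc (u, I.col u)) ?_)
      (by decide) fun s' h => h
    · intro s'' e1 e2
      exact coord_self hu (by rw [e1, h22]) (by rw [e1, h23])
    · rintro s1 ⟨k1, k2, k3⟩
      refine Runs.mono (runs_of_wp h.outBase_le (.set 36 (.reg 36 + .lit 1)) _ _ ?_)
        (by decide) fun s' h => h
      simp only [wp]
      refine ⟨by simp, ?_, ?_, k2, k3⟩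
      · intro x hx hx'
        rw [GState.setReg_reg_ne _ _ hx', k1 x (by omega)]
      · simp [k1]

end Ctx

/-! ### The run of the whole program. -/

namespace Ctx

open GExpr GCmd Prog

variable {w : ℕ} {L : Layout} {I : Inst} {LT : List (Point × ℤ)} {LQ : List Point} {tb qb : ℕ}

theorem runs_main (h : Ctx w L I LT LQ tb qb) {s : GState} (h0 : ∀ f p, s.fld f p = 0)
    (hout : s.out = []) : main.Runs w L (60000 * I.n ^ 2) s fun s' =>
      ∃ FA GA FB GB, IsRunTable I.lab I.col I.ψ I.φ FA GA ∧ IsRunTable I.lab I.col I.φ I.ψ FB GB ∧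
        s'.out = encStr (restList I) ++
          (((pieceLists I I.ψ I.φ FA GA 1 4 ++ pieceLists I I.φ I.ψ FB GB 2 3).length : ℕ) : ℤ) ::
          (pieceLists I I.ψ I.φ FA GA 1 4 ++ pieceLists I I.φ I.ψ FB GB 2 3).flatMap encStr ∧
        (L.outBase + s'.out.length : ℤ) ≤ 2 ^ w := by
  have hn : 1 ≤ I.n ^ 2 := Nat.one_le_pow _ _ h.n_pos
  have hcap : (L.outBase + 1000 * I.n ^ 2 : ℤ) ≤ 2 ^ w := by
    have h1 := h.size
    have h2 : (0 : ℤ) ≤ L.outBase := by positivity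
    have h3 : (I.n : ℤ) ^ 2 ≤ (I.n + I.l) ^ 2 := by
      have : (0 : ℤ) ≤ I.l := by positivity
      have : (0 : ℤ) ≤ I.n := by positivity
      nlinarith
    nlinarith
  have hnz : (1 : ℤ) ≤ (I.n : ℤ) ^ 2 := by exact_mod_cast hn
  have hset : setup.maxTime ≤ 300 := by decide
  refine Runs.mono (Runs.seq (h.runs_setup s) (T' := 59000 * I.n ^ 2) ?_)
    (by nlinarith) fun s' h => h
  rintro s1 ⟨hE1, hf1, ho1⟩
  obtain ⟨K, rfl, hr⟩ := h.runs_loadText s1 hE1 (by simp [hf1, h0])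
  refine Runs.mono (Runs.seq hr (T' := 58000 * I.n ^ 2) ?_) (by linarith) fun s' h => h
  rintro s2 ⟨hA2, hT2⟩
  have hE2 := hA2.env hE1
  obtain ⟨K, rfl, hr⟩ := h.runs_loadMarks s2 hE2 (by simp [hA2.fld 1, hf1, h0])
  refine Runs.mono (Runs.seq hr (T' := 57000 * I.n ^ 2) ?_) (by linarith) fun s' h => h
  rintro s3 ⟨hA3, hT3⟩
  have hE3 := hA3.env hE2
  obtain ⟨K, rfl, hr⟩ := h.runs_spreadX s3 hE3 (by simp [hA3.fld 2, hA2.fld 2, hf1, h0]) hT3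
  refine Runs.mono (Runs.seq hr (T' := 55000 * I.n ^ 2) ?_) (by linarith) fun s' h => h
  rintro s4 ⟨hA4, hB4, hT4⟩
  have hE4 := hA4.env hE3
  obtain ⟨K, rfl, hr⟩ := h.runs_spreadY s4 hE4
    (by simp [hA4.fld 3, hA3.fld 3, hA2.fld 3, hf1, h0]) hB4 hT4
  refine Runs.mono (Runs.seq hr (T' := 53000 * I.n ^ 2) ?_) (by linarith) fun s' h => h
  rintro s5 ⟨hA5, hB5, hT5⟩
  have hE5 := hA5.env hE4
  obtain ⟨K, rfl, hr⟩ := h.runs_markBad s5 hE5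
    (by simp [hA5.fld 4, hA4.fld 4, hA3.fld 4, hA2.fld 4, hf1, h0]) hB5 hT5
  refine Runs.mono (Runs.seq hr (T' := 48000 * I.n ^ 2) ?_) (by linarith) fun s' h => h
  rintro s6 ⟨hA6, hT6⟩
  have hE6 := hA6.env hE5
  obtain ⟨K, rfl, hr⟩ := h.runs_labels s6 hE6
    (by simp [hA6.fld 5, hA5.fld 5, hA4.fld 5, hA3.fld 5, hA2.fld 5, hf1, h0]) hT6
  refine Runs.mono (Runs.seq hr (T' := 42000 * I.n ^ 2) ?_) (by linarith) fun s' h => h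
  rintro s7 ⟨hA7, hT7⟩
  have hE7 := hA7.env hE6
  have hR7 : Ready I tb qb s7 := by
    refine ⟨hE7, ⟨?_, hT7⟩, ?_, ?_⟩
    · rw [hA7.fld 0 (by norm_num), hA6.fld 0 (by norm_num), hA5.fld 0 (by norm_num),
        hA4.fld 0 (by norm_num), hA3.fld 0 (by norm_num)]
      exact hT2
    · rw [hA7.fld 6 (by norm_num), hA6.fld 6 (by norm_num), hA5.fld 6 (by norm_num),
        hA4.fld 6 (by norm_num), hA3.fld 6 (by norm_num), hA2.fld 6 (by norm_num), hf1]
      simp only [h0]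
      intro _; constructor <;> linarith
    · rw [hA7.fld 7 (by norm_num), hA6.fld 7 (by norm_num), hA5.fld 7 (by norm_num),
        hA4.fld 7 (by norm_num), hA3.fld 7 (by norm_num), hA2.fld 7 (by norm_num), hf1]
      simp only [h0]
      intro _; constructor <;> linarith
  have ho7 : s7.out = [] := by
    rw [hA7.out, hA6.out, hA5.out, hA4.out, hA3.out, hA2.out, ho1, hout]
  have hf7 : s7.fld 3 = s5.fld 3 := by
    rw [hA7.fld 3 (by norm_num), hA6.fld 3 (by norm_num)]
  refine Runs.mono (Runs.seq (T := 20) (Q := fun s' => Sim s7 s' ∧ s'.out = [0] ∧ s'.reg 36 = 0)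
    (Runs.mono (runs_of_wp h.outBase_le _ _ _ ?_) (by decide) fun s' h => h)
    (T' := 41980 * I.n ^ 2) ?_) (by linarith) fun s' h => h
  · simp only [wp]
    refine ⟨by simp, ?_, by simp, ⟨fun x hx => ?_, rfl⟩, ?_, by simp⟩
    · rw [ho7]; push_cast [List.length_nil]; linarith
    · rw [GState.setReg_reg_ne _ _ (by omega)]; rfl
    · simp [ho7]
  rintro s8 ⟨hS8, ho8, h368⟩
  have hR8 := hR7.sim hS8
  obtain ⟨K, rfl, hr⟩ := h.runs_emitRest hR8 (by rw [hS8.fld, hf7]; exact hB5)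
    (by rw [hS8.fld, hf7]; exact hT5) (by rw [ho8]; push_cast [List.length_singleton]; linarith)
  refine Runs.mono (Runs.seq hr (T' := 38900 * I.n ^ 2) ?_) (by linarith) fun s' h => h
  rintro s9 ⟨hS9, hlen9, h369, ho9⟩
  have hR9 := hR8.sim hS9
  rw [h368, zero_add] at h369
  set n₁ := (restList I).length with hn₁
  have hl9 : s9.out.length = 1 + 3 * n₁ := by
    rw [ho9, ho8, List.length_append, length_flatMap_enc]; rfl
  have hn₁' : (n₁ : ℤ) ≤ 9 * (I.n : ℤ) ^ 2 := by exact_mod_cast hlen9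
  refine Runs.mono (Runs.seq (T := 60) (Q := fun s' => Ready I tb qb s' ∧
      s'.out = encStr (restList I) ++ [0] ∧ s'.reg 36 = 0 ∧ s'.reg 38 = 1 + 3 * n₁)
    (Runs.mono (runs_of_wp h.outBase_le _ _ _ ?_) (by decide) fun s' h => h)
    (T' := 38800 * I.n ^ 2) ?_) (by linarith) fun s' h => h
  · simp only [wp, ok_lit, ok_reg, val_lit, val_reg, ok_add, ok_mul, val_add, val_mul]
    refine ⟨trivial, trivial, ?_, ⟨by norm_num, ?_⟩, ?_, trivial, ?_, trivial, ?_, ?_, ?_, ?_⟩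
    · rw [hl9]; push_cast; linarith
    · rw [hl9]; push_cast; linarith
    · simp
    · simp only [GState.setReg_out, GState.patchVal, List.length_set, hl9]; push_cast; linarith
    · refine hR9.congr (fun x hx => ?_) rfl
      rw [GState.setReg_reg_ne _ _ (by omega), GState.emitVal_reg,
        GState.setReg_reg_ne _ _ (by omega)]
      rfl
    · simp only [GState.setReg_out, GState.emitVal_out, GState.patchVal, Int.toNat_zero, ho9, ho8,
        h369]
      rfl
    · simp
    · simp [h369]
  rintro s10 ⟨hR10, ho10, h3610, h3810⟩
  have hl10 : s10.out.length = 1 + 3 * n₁ + 1 := by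
    rw [ho10, List.length_append, length_encStr]; rfl
  obtain ⟨K, rfl, hr⟩ := h.runs_stage hR10 (dirs_psi I) (p := 1) (q := 4) (by norm_num)
    (by norm_num) (by norm_num) (by rw [hl10]; push_cast; linarith)
  refine Runs.mono (Runs.seq hr (T' := 19700 * I.n ^ 2) ?_) (by linarith) fun s' h => h
  rintro s11 ⟨hR11, h3811, FA, GA, hrunA, hcA, hlA, h3611, ho11⟩
  have hl11 : s11.out.length ≤ 1 + 3 * n₁ + 1 + 36 * I.n ^ 2 := by
    rw [ho11, List.length_append, hl10]; omega
  have hl11' : (s11.out.length : ℤ) ≤ 1 + 3 * n₁ + 1 + 36 * (I.n : ℤ) ^ 2 := by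
    exact_mod_cast hl11
  -- The second stage overwrites the tables of the first. They need not be cleared, because `Ready`
  -- asks only for bounded entries.
  obtain ⟨K, rfl, hr⟩ := h.runs_stage hR11 (dirs_phi I) (p := 2) (q := 3) (by norm_num)
    (by norm_num) (by norm_num) (by linarith)
  refine Runs.mono (Runs.seq hr (T' := 700 * I.n ^ 2) ?_) (by linarith) fun s' h => h
  rintro s12 ⟨hR12, h3812, FB, GB, hrunB, hcB, hlB, h3612, ho12⟩
  have hl12 : s12.out.length ≤ 1 + 3 * n₁ + 1 + 72 * I.n ^ 2 := by
    rw [ho12, List.length_append]; omega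
  have hl12' : (s12.out.length : ℤ) ≤ 1 + 3 * n₁ + 1 + 72 * (I.n : ℤ) ^ 2 := by
    exact_mod_cast hl12
  have hge : 1 + 3 * n₁ + 1 ≤ s12.out.length := by
    rw [ho12, ho11, List.length_append, List.length_append, hl10]; omega
  refine Runs.mono (runs_of_wp h.outBase_le (.patch (.reg 38) (.reg 36)) _ _ ?_)
    (T' := 700 * I.n ^ 2) ?_ fun s' h => h
  · rw [h3811, h3810] at h3812
    rw [h3611, h3610] at h3612
    simp only [wp, ok_reg, val_reg, h3812]
    refine ⟨trivial, trivial, by linarith, ⟨by positivity, by omega⟩, FA, GA, FB, GB, hrunA, hrunB,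
      ?_, ?_⟩
    · have e : (1 + 3 * (n₁ : ℤ)).toNat = (encStr (restList I)).length := by
        rw [length_encStr]; omega
      simp only [GState.patchVal, ho12, ho11, ho10, e, List.append_assoc]
      rw [List.set_append_right _ _ le_rfl, Nat.sub_self]
      simp [h3612]
    · simp only [GState.patchVal, List.length_set]
      linarith
  · have : (GCmd.patch (.reg 38) (.reg 36)).maxTime ≤ 700 := by decide
    nlinarith

end Ctx

/-! ### Running the program on its input -/

/-- The numbers that represent a list of points. -/
def encPoints (l : List Point) : List ℤ := (l.length : ℤ) :: l.flatMap fun u => [u.1, u.2]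

/-- The numbers that represent a list of strings. -/
def encList (l : List (List (Point × ℤ))) : List ℤ := (l.length : ℤ) :: l.flatMap encStr

theorem stringWords_eq (w : ℕ) (l : List (Point × ℤ)) :
    stringWords w l = (encStr l).map (BitVec.ofInt w) := by
  simp [stringWords, encStr, pointWords, enc, List.map_flatMap]

theorem stringListWords_eq (w : ℕ) (l : List (List (Point × ℤ))) :
    stringListWords w l = (encList l).map (BitVec.ofInt w) := by
  simp only [stringListWords, encList, List.map_cons, List.map_flatMap, BitVec.ofInt_natCast]
  exact congrArg (_ :: l.flatMap ·) (funext (stringWords_eq w))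

theorem pointListWords_eq (w : ℕ) (l : List Point) :
    pointListWords w l = (encPoints l).map (BitVec.ofInt w) := by
  simp only [pointListWords, encPoints, List.map_cons, List.map_flatMap, BitVec.ofInt_natCast]
  rfl

/-- The numbers that represent the input. -/
def encInput (m n k l : ℕ) (φ ψ : Point) (LP LT : List (Point × ℤ)) (LQ : List Point) : List ℤ :=
  [(m : ℤ), (n : ℤ), (k : ℤ), (l : ℤ), φ.1, φ.2, ψ.1, ψ.2] ++
    (encStr LP ++ (encStr LT ++ encPoints LQ))

theorem inputWords_eq (w m n k l : ℕ) (φ ψ : Point) (LP LT : List (Point × ℤ))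
    (LQ : List Point) : inputWords w m n k l φ ψ LP LT LQ =
      (encInput m n k l φ ψ LP LT LQ).map (BitVec.ofInt w) := by
  simp [inputWords, encInput, stringWords_eq, pointListWords_eq, pointWords]

theorem getD_append_add (A B : List ℤ) {a x : ℕ} (ha : A.length = a) :
    (A ++ B).getD (a + x) 0 = B.getD x 0 := by
  rw [List.getD_append_right _ _ _ _ (by omega)]
  congr 1
  omega

theorem getD_flatMap {α : Type*} (f : α → List ℤ) (c : ℕ) (hf : ∀ a, (f a).length = c)
    (r : List ℤ) : ∀ (l : List α) (i : ℕ) (hi : i < l.length) (j : ℕ), j < c →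
      (l.flatMap f ++ r).getD (c * i + j) 0 = (f l[i]).getD j 0
  | a :: l, 0, _, j, hj => by
      rw [List.flatMap_cons, List.append_assoc, List.getD_append _ _ _ _ (by rw [hf]; omega)]
      simp
  | a :: l, i + 1, hi, j, hj => by
      rw [List.flatMap_cons, List.append_assoc, mul_add, mul_one, add_comm (c * i), add_assoc,
        getD_append_add _ _ (hf a), getD_flatMap f c hf r l i (by simpa using hi) j hj]
      simp

/-- The memory layout for a given input. -/
def inputLayout (n : ℕ) (l : List ℤ) : Layout := ⟨l.length, 5 * n, fun a => l.getD a 0⟩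

/-- The structured state in which everything is zero. -/
def zeroState : GState := ⟨fun _ => 0, fun _ _ => 0, []⟩

/-- Computing the reserved registers. -/
def prelude : RamProg :=
  .seq (.assign 2 (.op .mul (.lit 5) (.load (.lit 1)))) <|
  .seq (.assign 1 (.op .add (.lit 9) (.op .mul (.lit 3) (.load (.lit 8))))) <|
  .seq (.assign 1 (.op .add (.reg 1) (.op .add (.lit 1) (.op .mul (.lit 3) (.load (.reg 1)))))) <|
  .seq (.assign 1 (.op .add (.reg 1) (.op .add (.lit 1) (.op .mul (.lit 2) (.load (.reg 1)))))) <|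
  .assign 3 (.op .add (.reg 1) (.op .mul (.lit 8) (.op .mul (.reg 2) (.reg 2))))

/-- Pointing to the output. -/
def postlude : RamProg :=
  .assign 0 (.op .add (.reg 1) (.op .mul (.lit 8) (.op .mul (.reg 2) (.reg 2))))

/-- The partitioning program. -/
def partitionProgram : RamProg := .seq prelude (.seq Prog.main.comp postlude)

theorem RamExec.assign_of_eval {w : ℕ} {x : ℕ} {e : RamExpr} {s : RamState w} {v : BitVec w}
    (h : e.eval s = v) :
    RamExec (.assign x e) s (e.cost + 1) { s with reg := Function.update s.reg x v } :=
  h ▸ .assign x e s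

/-- Memory behind the input is zero, and so are an empty grid and an empty output; only the reserved
registers remain to be set. -/
theorem init_mem {w : ℕ} (n : ℕ) (l : List ℤ) :
    (RamState.init (l.map (BitVec.ofInt w))).mem = (zeroState.conc w (inputLayout n l)).mem := by
  funext a
  simp only [RamState.init, GState.conc, GState.cell, inputLayout]
  split_ifs with h1
  · simp [h1]
  · simp [zeroState, not_lt.1 h1]

theorem load_eq {w : ℕ} {n : ℕ} {l : List ℤ} (hL : ((inputLayout n l).outBase : ℤ) ≤ 2 ^ w)
    {a : ℕ} (ha : a < l.length) :
    (zeroState.conc w (inputLayout n l)).mem (BitVec.ofInt w a) =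
      BitVec.ofInt w (l.getD a 0) := by
  have hb : (inputLayout n l).base ≤ (inputLayout n l).outBase := Nat.le_add_right _ _
  have hlt : (a : ℤ) < 2 ^ w := by
    have : (a : ℤ) < l.length := by exact_mod_cast ha
    have : (l.length : ℤ) ≤ (inputLayout n l).outBase := by exact_mod_cast hb
    linarith
  simp only [GState.conc, GState.cell, GExpr.toNat_ofInt_of_lt (by positivity) hlt,
    Int.toNat_natCast]
  rw [if_pos (show a < (inputLayout n l).base from ha)]
  rfl

/-- The end of the input is found by skipping over the pattern, the text and the candidates with the
help of their stored lengths. -/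
theorem exec_prelude {w n : ℕ} {l : List ℤ} {tb qb nT nQ : ℕ}
    (hL : ((inputLayout n l).outBase : ℤ) ≤ 2 ^ w) (h1 : l.getD 1 0 = n)
    (h8 : 9 + 3 * l.getD 8 0 = tb) (hT : l.getD tb 0 = nT) (hqb : qb = tb + 1 + 3 * nT)
    (hQ : l.getD qb 0 = nQ) (hl : l.length = qb + 1 + 2 * nQ) (ht : 9 ≤ tb) :
    RamExec prelude (RamState.init (l.map (BitVec.ofInt w))) 38
      (zeroState.conc w (inputLayout n l)) := by
  have h9 : 9 ≤ l.length := by omega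
  have m1 := load_eq hL (show 1 < l.length by omega)
  have m8 := load_eq hL (show 8 < l.length by omega)
  have mT := load_eq hL (show tb < l.length by omega)
  have mQ := load_eq hL (show qb < l.length by omega)
  rw [← init_mem] at m1 m8 mT mQ
  rw [h1] at m1
  rw [hT] at mT
  rw [hQ] at mQ
  set s := RamState.init (l.map (BitVec.ofInt w)) with hs
  have k1 : RamExec (.assign 2 (.op .mul (.lit 5) (.load (.lit 1)))) s 5
      ⟨Function.update s.reg 2 (BitVec.ofInt w (5 * n : ℕ)), s.mem⟩ := by
    refine RamExec.assign_of_eval ?_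
    simp only [RamExpr.eval, WordOp.eval]
    rw [← Nat.cast_one (R := ℤ), m1]
    push_cast
    rw [BitVec.ofInt_mul]
  have k2 : RamExec (.assign 1 (.op .add (.lit 9) (.op .mul (.lit 3) (.load (.lit 8)))))
      ⟨Function.update s.reg 2 (BitVec.ofInt w (5 * n : ℕ)), s.mem⟩ 7
      ⟨Function.update (Function.update s.reg 2 (BitVec.ofInt w (5 * n : ℕ))) 1
        (BitVec.ofInt w tb), s.mem⟩ := by
    refine RamExec.assign_of_eval ?_
    simp only [RamExpr.eval, WordOp.eval]
    rw [show (8 : ℤ) = ((8 : ℕ) : ℤ) from rfl, m8, ← h8, BitVec.ofInt_add, BitVec.ofInt_mul]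
  have k3 : RamExec (.assign 1 (.op .add (.reg 1) (.op .add (.lit 1)
      (.op .mul (.lit 3) (.load (.reg 1))))))
      ⟨Function.update (Function.update s.reg 2 (BitVec.ofInt w (5 * n : ℕ))) 1
        (BitVec.ofInt w tb), s.mem⟩ 9
      ⟨Function.update (Function.update (Function.update s.reg 2 (BitVec.ofInt w (5 * n : ℕ))) 1
        (BitVec.ofInt w tb)) 1 (BitVec.ofInt w qb), s.mem⟩ := by
    refine RamExec.assign_of_eval ?_
    simp only [RamExpr.eval, WordOp.eval, Function.update_self]
    rw [mT, hqb]
    push_cast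
    rw [add_assoc, BitVec.ofInt_add, BitVec.ofInt_add, BitVec.ofInt_mul]
  have k4 : RamExec (.assign 1 (.op .add (.reg 1) (.op .add (.lit 1)
      (.op .mul (.lit 2) (.load (.reg 1))))))
      ⟨Function.update (Function.update (Function.update s.reg 2 (BitVec.ofInt w (5 * n : ℕ))) 1
        (BitVec.ofInt w tb)) 1 (BitVec.ofInt w qb), s.mem⟩ 9
      ⟨Function.update (Function.update (Function.update (Function.update s.reg 2
        (BitVec.ofInt w (5 * n : ℕ))) 1 (BitVec.ofInt w tb)) 1 (BitVec.ofInt w qb)) 1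
        (BitVec.ofInt w l.length), s.mem⟩ := by
    refine RamExec.assign_of_eval ?_
    simp only [RamExpr.eval, WordOp.eval, Function.update_self]
    rw [mQ, hl]
    push_cast
    rw [add_assoc, BitVec.ofInt_add, BitVec.ofInt_add, BitVec.ofInt_mul]
  have k5 : RamExec (.assign 3 (.op .add (.reg 1) (.op .mul (.lit 8)
      (.op .mul (.reg 2) (.reg 2)))))
      ⟨Function.update (Function.update (Function.update (Function.update s.reg 2
        (BitVec.ofInt w (5 * n : ℕ))) 1 (BitVec.ofInt w tb)) 1 (BitVec.ofInt w qb)) 1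
        (BitVec.ofInt w l.length), s.mem⟩ 8
      ⟨Function.update (Function.update (Function.update (Function.update (Function.update s.reg 2
        (BitVec.ofInt w (5 * n : ℕ))) 1 (BitVec.ofInt w tb)) 1 (BitVec.ofInt w qb)) 1
        (BitVec.ofInt w l.length)) 3 (BitVec.ofInt w (inputLayout n l).outBase), s.mem⟩ := by
    refine RamExec.assign_of_eval ?_
    simp only [RamExpr.eval, WordOp.eval, Function.update_self, ne_eq, OfNat.ofNat_ne_one,
      not_false_eq_true, Function.update_of_ne, Layout.outBase, inputLayout]
    push_cast
    simp only [BitVec.ofInt_add, BitVec.ofInt_mul]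
  have e : (zeroState.conc w (inputLayout n l)) =
      ⟨Function.update (Function.update (Function.update (Function.update (Function.update s.reg 2
        (BitVec.ofInt w (5 * n : ℕ))) 1 (BitVec.ofInt w tb)) 1 (BitVec.ofInt w qb)) 1
        (BitVec.ofInt w l.length)) 3 (BitVec.ofInt w (inputLayout n l).outBase), s.mem⟩ := by
    show RamState.mk _ _ = RamState.mk _ _
    congr 1
    · funext x
      match x with
      | 0 => simp [Function.update, GState.machineReg, hs, RamState.init]
      | 1 => simp [Function.update, GState.machineReg, inputLayout]
      | 2 => simp [Function.update, GState.machineReg, inputLayout]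
      | 3 => simp [Function.update, GState.machineReg, zeroState]
      | x + 4 => simp [Function.update, GState.machineReg, zeroState, hs, RamState.init]
    · exact (init_mem n l).symm
  rw [e]
  exact .seq k1 (.seq k2 (.seq k3 (.seq k4 k5)))


theorem Represents.length_le {L : List (Point × ℤ)} {S : Str} {n : ℕ} (h : Represents L S)
    (hd : S.dom = square n) : L.length ≤ n ^ 2 := by
  classical
  have hsub : L.toFinset ⊆ ((Finset.Ico (0 : ℤ) n ×ˢ Finset.Ico (0 : ℤ) n).image
      fun u => (u, (S u).getD 0)) := by
    rintro ⟨u, c⟩ hu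
    have hS := (h.2 u c).1 (List.mem_toFinset.1 hu)
    have hu : u ∈ square n := by rw [← hd]; exact ⟨c, hS⟩
    simp only [square, Set.mem_ofPred_eq] at hu
    simp only [Finset.mem_image, Finset.mem_product, Finset.mem_Ico, Prod.mk.injEq]
    exact ⟨u, ⟨hu.1, hu.2⟩, rfl, by rw [hS]; rfl⟩
  have h1 := (Finset.card_le_card hsub).trans Finset.card_image_le
  rw [List.toFinset_card_of_nodup h.1, Finset.card_product, Int.card_Ico] at h1
  simpa [sq] using h1

theorem ctx_of_input {C₀ : ℝ} {w m n k l : ℕ} {P T : Str} {Q : Finset Point} {φ ψ : Point}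
    (hl : 0 < l) (hc : Candidates m n k P T Q) (hb : BasisPair C₀ m n Q φ ψ)
    (hw : (n + k + l) ^ 10 ≤ 2 ^ w) (hT : T.FitsWord w) {LP LT : List (Point × ℤ)}
    {LQ : List Point} (hLP : Represents LP P) (hLT : Represents LT T) (hnd : LQ.Nodup)
    (hLQ : LQ.toFinset = Q) : ∃ tb qb,
    Ctx w (inputLayout n (encInput m n k l φ ψ LP LT LQ)) ⟨m, n, l, φ, ψ, T, Q⟩ LT LQ tb qb := by
  have hlenP := hLP.length_le hc.dom_pattern
  have hlenT := hLT.length_le hc.dom_text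
  have hmn := hc.m_le
  have hm := hc.m_pos
  have hlenQ : LQ.length ≤ n ^ 2 := by
    have hsub : LQ.toFinset ⊆ Finset.Ico (0 : ℤ) n ×ˢ Finset.Ico (0 : ℤ) n := by
      intro q hq
      rw [hLQ] at hq
      have := hc.Q_mem hq
      simp only [Finset.mem_product, Finset.mem_Ico]
      omega
    have h1 := Finset.card_le_card hsub
    rw [List.toFinset_card_of_nodup hnd, Finset.card_product, Int.card_Ico] at h1
    simpa [sq] using h1
  have hP2 : m ^ 2 ≤ n ^ 2 := Nat.pow_le_pow_left hmn 2
  set ints := encInput m n k l φ ψ LP LT LQ with hints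
  have hlenQ' : (encPoints LQ).length = 1 + 2 * LQ.length := by
    simp [encPoints, List.length_flatMap]; ring
  have hlen : ints.length = 8 + (1 + 3 * LP.length) + (1 + 3 * LT.length) +
      (1 + 2 * LQ.length) := by
    rw [hints, encInput, List.length_append, List.length_append, List.length_append,
      length_encStr, length_encStr, hlenQ']
    simp; ring
  have g8 : ∀ x, ints.getD (8 + x) 0 = (encStr LP ++ (encStr LT ++ encPoints LQ)).getD x 0 :=
    fun x => getD_append_add _ _ rfl
  have gT : ∀ x, ints.getD (8 + (1 + 3 * LP.length + x)) 0 =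
      (encStr LT ++ encPoints LQ).getD x 0 := fun x => by
    rw [g8, getD_append_add _ _ (length_encStr LP)]
  have gQ : ∀ x, ints.getD (8 + (1 + 3 * LP.length + (1 + 3 * LT.length + x))) 0 =
      (encPoints LQ).getD x 0 := fun x => by
    rw [gT, getD_append_add _ _ (length_encStr LT)]
  refine ⟨8 + (1 + 3 * LP.length), 8 + (1 + 3 * LP.length) + 1 + 3 * LT.length, ?_⟩
  constructor
  · exact hb.valid hc hl
  · rfl
  · have h1 : 2 * ((inputLayout n ints).outBase + 1000 * (n + l) ^ 2) ≤ 2 ^ w := by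
      refine le_trans ?_ hw
      have e : (inputLayout n ints).outBase = ints.length + 200 * n ^ 2 := by
        simp only [Layout.outBase, inputLayout]; ring
      have hk := hc.k_pos
      set N := n + k + l with hN
      -- As `n`, `k`, `l` are positive, `N ^ 8 ≥ 6561`, which absorbs all constants; this is why the
      -- exponent 10 suffices.
      have hN3 : 3 ≤ N := by omega
      have h2 : n ^ 2 ≤ N ^ 2 := Nat.pow_le_pow_left (by omega) 2
      have h3 : (n + l) ^ 2 ≤ N ^ 2 := Nat.pow_le_pow_left (by omega) 2
      have h4 : 3 ^ 8 ≤ N ^ 8 := Nat.pow_le_pow_left hN3 8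
      have h5 : N ^ 10 = N ^ 8 * N ^ 2 := by ring
      have h6 : 3 ^ 2 ≤ N ^ 2 := Nat.pow_le_pow_left hN3 2
      have h7 := Nat.mul_le_mul_right (N ^ 2) h4
      rw [e, hlen, h5]
      omega
    exact_mod_cast h1
  · rfl
  · rfl
  · rfl
  · rfl
  · rfl
  · rfl
  · rfl
  · have := g8 0
    show 9 + 3 * ints.getD 8 0 = _
    rw [this]
    simp only [encStr, List.cons_append, List.getD_cons_zero]
    push_cast; ring
  · show ints.getD _ 0 = _
    have := gT 0
    rw [add_zero] at this
    rw [this]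
    rfl
  · ring
  · intro i hi
    have key : ∀ j, j < 3 → ints.getD (8 + (1 + 3 * LP.length) + (1 + j) + 3 * i) 0 =
        (enc LT[i]).getD j 0 := by
      intro j hj
      rw [← getD_flatMap enc 3 (fun _ => rfl) (encPoints LQ) LT i hi j hj]
      have := gT (1 + (3 * i + j))
      rw [encStr, List.cons_append, add_comm 1 (3 * i + j), List.getD_cons_succ] at this
      rw [← this]
      congr 1
      ring
    exact ⟨key 0 (by norm_num), key 1 (by norm_num), key 2 (by norm_num)⟩
  · show ints.getD _ 0 = _
    have := gQ 0
    rw [add_zero] at this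
    have e : 8 + (1 + 3 * LP.length) + 1 + 3 * LT.length =
      8 + (1 + 3 * LP.length + (1 + 3 * LT.length)) := by ring
    rw [e, this]
    rfl
  · intro i hi
    have key : ∀ j, j < 2 → ints.getD (8 + (1 + 3 * LP.length) + 1 + 3 * LT.length + (1 + j) +
        2 * i) 0 = [LQ[i].1, LQ[i].2].getD j 0 := by
      intro j hj
      rw [← getD_flatMap (fun u : Point => [u.1, u.2]) 2 (fun _ => rfl) [] LQ i hi j hj]
      have := gQ (1 + (2 * i + j))
      rw [encPoints, add_comm 1 (2 * i + j), List.getD_cons_succ] at this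
      rw [List.append_nil, ← this]
      congr 1
      ring
    exact ⟨key 0 (by norm_num), key 1 (by norm_num)⟩
  · show ints.length = _
    rw [hlen]; ring
  · omega
  · exact hLT
  · exact hlenT
  · exact hT
  · intro q
    rw [← List.mem_toFinset, hLQ]
  · exact hlenQ

theorem exec_partitionProgram {w : ℕ} {I : Inst} {l : List ℤ} {LT : List (Point × ℤ)}
    {LQ : List Point} {tb qb : ℕ} (h : Ctx w (inputLayout I.n l) I LT LQ tb qb) :
    ∃ (t : ℕ) (s : RamState w) (FA GA FB GB : Point → ℕ),
      RamExec partitionProgram (RamState.init (l.map (BitVec.ofInt w))) t s ∧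
      t ≤ 60100 * I.n ^ 2 ∧ IsRunTable I.lab I.col I.ψ I.φ FA GA ∧
      IsRunTable I.lab I.col I.φ I.ψ FB GB ∧
      s.HasOutput (stringWords w (restList I) ++ stringListWords w
        (pieceLists I I.ψ I.φ FA GA 1 4 ++ pieceLists I I.φ I.ψ FB GB 2 3)) := by
  obtain ⟨t, s, hrun, ht, FA, GA, FB, GB, hA, hB, hout, hcap⟩ :=
    h.runs_main (s := zeroState) (fun _ _ => rfl) rfl
  set L := inputLayout I.n l with hL
  have hpre := exec_prelude (w := w) (n := I.n) (l := l) h.outBase_le h.inp1 h.inp8 h.inpT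
    h.qb_eq h.inpQ h.base_eq h.tb_ge
  have hpost : RamExec postlude (s.conc w L) 8 ⟨Function.update (s.conc w L).reg 0
      (BitVec.ofInt w L.outBase), (s.conc w L).mem⟩ := by
    refine RamExec.assign_of_eval ?_
    simp only [RamExpr.eval, WordOp.eval, GState.conc, GState.machineReg, Layout.outBase]
    push_cast
    simp only [BitVec.ofInt_add, BitVec.ofInt_mul]
  refine ⟨_, _, FA, GA, FB, GB, .seq hpre (.seq hrun hpost), ?_, hA, hB, ?_⟩
  · have : 1 ≤ I.n ^ 2 := Nat.one_le_pow _ _ h.n_pos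
    omega
  · have e : stringWords w (restList I) ++ stringListWords w
        (pieceLists I I.ψ I.φ FA GA 1 4 ++ pieceLists I I.φ I.ψ FB GB 2 3) =
        s.out.map (BitVec.ofInt w) := by
      rw [stringWords_eq, stringListWords_eq, ← List.map_append, hout]
      rfl
    rw [e]
    have hlt : (L.outBase : ℤ) < 2 ^ w := by
      have h1 := h.size
      have h2 : (0 : ℤ) ≤ L.outBase := by positivity
      have h3 : (0 : ℤ) < I.n := by exact_mod_cast h.n_pos
      have h4 : (0 : ℤ) < 1000 * (I.n + I.l) ^ 2 := by positivity
      linarith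
    have e0 : (BitVec.ofInt w (L.outBase : ℤ)).toNat = L.outBase := by
      rw [GExpr.toNat_ofInt_of_lt (by positivity) hlt, Int.toNat_natCast]
    refine ⟨?_, ?_⟩
    · simp only [Function.update_self, e0, List.length_map]
      exact_mod_cast hcap
    · intro i hi
      rw [List.length_map] at hi
      have e1 : BitVec.ofInt w (L.outBase : ℤ) + BitVec.ofNat w i =
          BitVec.ofInt w ((L.outBase + i : ℕ) : ℤ) := by
        push_cast
        rw [BitVec.ofInt_add, BitVec.ofInt_natCast, BitVec.ofInt_natCast]
      have hlt' : ((L.outBase + i : ℕ) : ℤ) < 2 ^ w := by push_cast; omega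
      have hb : L.base ≤ L.outBase := Nat.le_add_right _ _
      simp only [Function.update_self, e1, GState.conc,
        GExpr.toNat_ofInt_of_lt (by positivity) hlt', Int.toNat_natCast, List.getElem_map]
      congr 1
      unfold GState.cell
      rw [if_neg (by omega), if_neg (by omega), Nat.add_sub_cancel_left]
      simp [hi]

/-! ### The partition -/

/-- The restriction of `T` to the points of a list. -/
noncomputable def strOf (T : Str) (l : List (Point × ℤ)) : Str := T.restrict {u | ∃ c, (u, c) ∈ l}

theorem represents_strOf {T : Str} {l : List (Point × ℤ)} (hnd : l.Nodup)
    (h : ∀ u c, (u, c) ∈ l → T u = some c) : Represents l (strOf T l) := by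
  refine ⟨hnd, fun u a => ?_⟩
  simp only [strOf, Str.restrict, Set.mem_ofPred_eq]
  constructor
  · intro hu
    rw [if_pos ⟨a, hu⟩, h u a hu]
  · intro hu
    split_ifs at hu with hc
    obtain ⟨c, hc⟩ := hc
    rw [h u c hc] at hu
    rwa [← Option.some.inj hu]

theorem mem_dom_strOf {T : Str} {l : List (Point × ℤ)} (h : ∀ u c, (u, c) ∈ l → T u = some c)
    {u : Point} : u ∈ (strOf T l).dom ↔ ∃ c, (u, c) ∈ l := by
  simp only [strOf, Str.restrict, Str.dom, Set.mem_ofPred_eq]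
  constructor
  · rintro ⟨a, ha⟩
    split_ifs at ha with hc
    exact hc
  · rintro ⟨c, hc⟩
    exact ⟨c, by rw [if_pos ⟨c, hc⟩, h u c hc]⟩

theorem strOf_apply {T : Str} {l : List (Point × ℤ)} {u : Point} (hu : u ∈ (strOf T l).dom) :
    strOf T l u = T u := by
  obtain ⟨a, ha⟩ := hu
  simp only [strOf, Str.restrict] at ha ⊢
  split_ifs at ha ⊢
  rfl

namespace Inst

variable {I : Inst}

theorem Valid.text_eq (h : I.Valid) {u : Point} (hu : u ∈ square I.n) :
    I.T u = some (I.col u) := by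
  rw [← h.dom] at hu
  obtain ⟨a, ha⟩ := hu
  simp [col, ha]

theorem Valid.text_eq_of_act (h : I.Valid) {u : Point} (hu : I.Act u) :
    I.T u = some (I.col u) := h.text_eq (hu.mem_text h)

/-- The two shifted points may lie in different squares. If `u.1 < m`, no square ends to the left of
`u`, so the square of the left point reaches `u`; otherwise `u.1 ≥ n - m`, and the square of the
right point does. -/
theorem Deep.act (h : I.Valid) {u : Point} (hu : I.Deep u) : I.Act u := by
  have hn := h.n_le
  have hW := h.W_nonneg
  obtain ⟨h1, h2⟩ := hu
  by_cases hm : u.1 < I.m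
  · exact h2.of_between h (.inr (by dsimp only; omega)) (.inl hm) (.inr le_rfl) (.inr le_rfl)
  · exact h1.of_between h (.inl (by omega)) (.inr (by dsimp only; omega)) (.inr le_rfl)
      (.inr le_rfl)

/-- Points without label are near the boundary of the active text. -/
theorem Valid.exists_near (h : I.Valid) {u : Point} (hu : I.lab u = 0) :
    ∃ v, ¬ I.Act v ∧ (u - v).len ≤ (I.m : ℝ) / I.l := by
  have hg : ¬ I.Good (I.ref u) := by
    intro hg
    unfold lab at hu
    rw [if_pos hg] at hu
    split_ifs at hu <;> omega
  unfold Good at hg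
  push Not at hg
  obtain ⟨v, hv, hd⟩ := hg
  have hW := h.W_nonneg
  have h1 := (frame_psi h).ref_near u
  have h2 := (frame_psi h).ref_near v
  rw [hv] at h2
  -- Two points of a block differ by at most `4 W` in each coordinate, and the failed shift adds `2
  -- W` horizontally. The resulting distance is below `16 W ≤ m / l`.
  have hfar : ∃ x, ¬ I.Act x ∧ (-(6 * I.W) ≤ u.1 - x.1 ∧ u.1 - x.1 ≤ 6 * I.W) ∧
      -(4 * I.W) ≤ u.2 - x.2 ∧ u.2 - x.2 ≤ 4 * I.W := by
    unfold Deep at hd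
    rw [not_and_or] at hd
    rcases hd with hd | hd
    · exact ⟨_, hd, by dsimp only; omega⟩
    · exact ⟨_, hd, by dsimp only; omega⟩
  obtain ⟨x, hx, ⟨b1, b2⟩, b3, b4⟩ := hfar
  refine ⟨x, hx, ?_⟩
  have hl : (0 : ℝ) < I.l := by exact_mod_cast h.l_pos
  have hWm : (I.W : ℝ) * (16 * I.l) ≤ I.m := by
    have : I.W * (16 * I.l) ≤ I.m := Int.ediv_mul_le _ (by have := h.l_pos; positivity)
    exact_mod_cast this
  have hW' : (0 : ℝ) ≤ I.W := by exact_mod_cast hW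
  have c1 : (-(6 * I.W) : ℝ) ≤ ((u - x).1 : ℤ) := by exact_mod_cast b1
  have c2 : (((u - x).1 : ℤ) : ℝ) ≤ 6 * I.W := by exact_mod_cast b2
  have c3 : (-(4 * I.W) : ℝ) ≤ ((u - x).2 : ℤ) := by exact_mod_cast b3
  have c4 : (((u - x).2 : ℤ) : ℝ) ≤ 4 * I.W := by exact_mod_cast b4
  have h8 : (u - x).len ≤ 16 * I.W := by
    unfold Point.len
    apply Real.sqrt_le_iff.2
    refine ⟨by positivity, ?_⟩
    have := sq_le_sq' c1 c2
    have := sq_le_sq' c3 c4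
    nlinarith
  rw [le_div_iff₀ hl]
  calc (u - x).len * I.l ≤ 16 * I.W * I.l := mul_le_mul_of_nonneg_right h8 hl.le
    _ = I.W * (16 * I.l) := by ring
    _ ≤ I.m := hWm

end Inst

theorem borderDist_le {D : Set Point} {u v : Point} (hv : v ∉ D) :
    borderDist D u ≤ (u - v).len := by
  refine csInf_le ⟨0, ?_⟩ ⟨v, hv, rfl⟩
  rintro _ ⟨x, -, rfl⟩
  exact Real.sqrt_nonneg _

theorem Inst.Valid.mem_area {I : Inst} (h : I.Valid) {u : Point} (hu : I.Act u) :
    u ∈ area I.n := by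
  have := hu.mem_text h
  exact _root_.mem_area.2 (by omega)

/-! ### The listed pieces as strings, and their number. -/

section Pieces

variable {I : Inst} {ρ τ : Point} {F G : Point → ℕ} {p q : ℤ}

theorem mem_restList (h : I.Valid) {u : Point} {c : ℤ} :
    (u, c) ∈ restList I ↔ (I.Act u ∧ I.lab u = 0) ∧ c = I.col u := by
  simp only [restList, List.mem_map, List.mem_filter, decide_eq_true_eq, Prod.mk.injEq]
  constructor
  · rintro ⟨v, ⟨-, hv⟩, rfl, rfl⟩
    exact ⟨hv, rfl⟩
  · rintro ⟨hv, rfl⟩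
    exact ⟨u, ⟨h.mem_area hv.1, hv⟩, rfl, rfl⟩

theorem restList_nodup (I : Inst) : (restList I).Nodup :=
  ((area_nodup _).filter _).map_on fun _ _ _ _ he => congrArg Prod.fst he

theorem mem_pieceLists (h : I.Valid) {l : List (Point × ℤ)} :
    l ∈ pieceLists I ρ τ F G p q ↔
      ∃ u, StartOf I ρ τ F p q u ∧ pieceList I.col ρ τ F G u = l := by
  simp only [pieceLists, List.mem_map, List.mem_filter, decide_eq_true_eq]
  constructor
  · rintro ⟨u, ⟨-, hu⟩, rfl⟩
    exact ⟨u, hu, rfl⟩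
  · rintro ⟨u, hu, rfl⟩
    exact ⟨u, ⟨h.mem_area (Inst.Deep.act h (Inst.deep_of_lab u hu.1.1)), hu⟩, rfl⟩

theorem piece_point (h : I.Valid) (hrun : IsRunTable I.lab I.col ρ τ F G) {u : Point}
    (hu : StartOf I ρ τ F p q u) {v : Point} {c : ℤ} (hv : (v, c) ∈ pieceList I.col ρ τ F G u) :
    I.Act v ∧ (I.lab v = p ∨ I.lab v = q) ∧ I.lab v ≠ 0 ∧ I.col v = I.col u ∧ c = I.col v := by
  obtain ⟨⟨i, j, hj, hi, rfl⟩, rfl⟩ := mem_pieceList.1 hv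
  obtain ⟨e1, e2⟩ := hrun.piece_spec hu.1 hj hi
  have h0 := hu.1.1
  rw [e1]
  exact ⟨Inst.Deep.act h (Inst.deep_of_lab _ (by rw [e1]; exact h0)), hu.2, h0, e2, rfl⟩

theorem text_of_piece (h : I.Valid) (hrun : IsRunTable I.lab I.col ρ τ F G)
    {l : List (Point × ℤ)} (hl : l ∈ pieceLists I ρ τ F G p q) (v : Point) (c : ℤ)
    (hv : (v, c) ∈ l) : I.T v = some c := by
  obtain ⟨u, hu, rfl⟩ := (mem_pieceLists h).1 hl
  obtain ⟨h1, -, -, -, rfl⟩ := piece_point h hrun hu hv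
  exact h.text_eq_of_act h1

theorem pieceLists_nodup (h : I.Valid) (hrun : IsRunTable I.lab I.col ρ τ F G)
    {l : List (Point × ℤ)} (hl : l ∈ pieceLists I ρ τ F G p q) : l.Nodup := by
  obtain ⟨u, hu, rfl⟩ := (mem_pieceLists h).1 hl
  have := hrun.pieces_nodup (l := [u]) (List.nodup_singleton u) (by simpa using hu.1)
  rw [List.flatMap_singleton] at this
  exact this.of_map _

theorem pieceLists_pairwise (h : I.Valid) (hrun : IsRunTable I.lab I.col ρ τ F G) :
    ((pieceLists I ρ τ F G p q).map (strOf I.T)).Pairwise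
      fun R R' => Disjoint R.dom R'.dom := by
  classical
  have ht := fun l hl => text_of_piece (p := p) (q := q) h hrun (l := l) hl
  rw [List.pairwise_map, pieceLists, List.pairwise_map]
  refine ((area_nodup I.n).filter _).imp_of_mem ?_
  intro u u' hu hu' hne
  have m1 : pieceList I.col ρ τ F G u ∈ pieceLists I ρ τ F G p q := List.mem_map_of_mem hu
  have m2 : pieceList I.col ρ τ F G u' ∈ pieceLists I ρ τ F G p q := List.mem_map_of_mem hu'
  have s1 : StartOf I ρ τ F p q u := by simpa using (List.mem_filter.1 hu).2
  have s2 : StartOf I ρ τ F p q u' := by simpa using (List.mem_filter.1 hu').2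
  rw [Set.disjoint_left]
  intro v hv hv'
  obtain ⟨c, hc⟩ := (mem_dom_strOf (ht _ m1)).1 hv
  obtain ⟨c', hc'⟩ := (mem_dom_strOf (ht _ m2)).1 hv'
  obtain ⟨⟨i, j, hj, hi, e⟩, -⟩ := mem_pieceList.1 hc
  obtain ⟨⟨i', j', hj', hi', e'⟩, -⟩ := mem_pieceList.1 hc'
  exact hne (hrun.piece_unique s1.1 s2.1 hj hi hj' hi' (e.symm.trans e')).1

theorem dom_piece (h : I.Valid) (hrun : IsRunTable I.lab I.col ρ τ F G) {u : Point}
    (hu : StartOf I ρ τ F p q u) :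
    (strOf I.T (pieceList I.col ρ τ F G u)).dom = parallelogram u ρ τ (F u) (G u) := by
  ext v
  rw [mem_dom_strOf (text_of_piece h hrun ((mem_pieceLists h).2 ⟨u, hu, rfl⟩))]
  constructor
  · rintro ⟨c, hc⟩
    exact (mem_pieceList.1 hc).1
  · intro hv
    exact ⟨_, mem_pieceList.2 ⟨hv, rfl⟩⟩

theorem piece_isMonochromatic (h : I.Valid) (hrun : IsRunTable I.lab I.col ρ τ F G)
    {l : List (Point × ℤ)} (hl : l ∈ pieceLists I ρ τ F G p q) :
    (strOf I.T l).IsMonochromatic := by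
  have ht := text_of_piece h hrun hl
  obtain ⟨u, hu, rfl⟩ := (mem_pieceLists h).1 hl
  refine ⟨I.col u, fun v hv => ?_⟩
  rw [strOf_apply hv]
  obtain ⟨c, hc⟩ := (mem_dom_strOf ht).1 hv
  obtain ⟨-, -, -, e, rfl⟩ := piece_point h hrun hu hc
  rw [ht _ _ hc, e]

theorem mem_piece_of_lab (h : I.Valid) (hrun : IsRunTable I.lab I.col ρ τ F G) {v : Point}
    (hv : I.lab v ≠ 0) (hpq : I.lab v = p ∨ I.lab v = q) :
    ∃ l ∈ pieceLists I ρ τ F G p q, v ∈ (strOf I.T l).dom := by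
  obtain ⟨u, i, j, hu, hj, hi, rfl⟩ := hrun.exists_piece hv
  have hs : StartOf I ρ τ F p q u := ⟨hu, by rwa [← (hrun.piece_spec hu hj hi).1]⟩
  refine ⟨_, (mem_pieceLists h).2 ⟨u, hs, rfl⟩, ?_⟩
  rw [dom_piece h hrun hs]
  exact ⟨i, j, hj, hi, rfl⟩

theorem length_pieceLists_le (h : I.Valid) (hQ : I.Q.Nonempty) {sρ sτ : Point → ℤ} {aρ aτ : ℤ}
    (hf : Inst.Frame I ρ τ sρ sτ aρ aτ) {B : ℕ} (hMρ : I.MismatchBound ρ B)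
    (hMτ : I.MismatchBound τ B) (hrun : IsRunTable I.lab I.col ρ τ F G) {sx sy sx' sy' : ℤ}
    (hx : sx = 1 ∨ sx = -1) (hy : sy = 1 ∨ sy = -1) (hx' : sx' = 1 ∨ sx' = -1)
    (hy' : sy' = 1 ∨ sy' = -1) (hal : Inst.Aligned sx sy ρ) (hal' : Inst.Aligned sx' sy' ρ)
    (hp : p = Inst.code sx sy) (hq : q = Inst.code sx' sy') :
    (pieceLists I ρ τ F G p q).length ≤ 2 * (98 * I.l * I.D.toNat + 100 * I.l * B) := by
  classical
  set l := (area I.n).filter (StartOf I ρ τ F p q) with hl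
  have hnd : l.Nodup := (area_nodup _).filter _
  have hst : ∀ u ∈ l, StartOf I ρ τ F p q u := fun u hu => by
    simpa using (List.mem_filter.1 hu).2
  have h1 := Inst.card_starts h hQ hf hMρ hMτ hrun hx hy hal
    (l.toFinset.filter fun u => I.lab u = p)
    (fun u hu => (hst u (by simpa using (Finset.mem_filter.1 hu).1)).1)
    (fun u hu => by rw [← hp]; exact (Finset.mem_filter.1 hu).2)
  have h2 := Inst.card_starts h hQ hf hMρ hMτ hrun hx' hy' hal'
    (l.toFinset.filter fun u => I.lab u = q)
    (fun u hu => (hst u (by simpa using (Finset.mem_filter.1 hu).1)).1)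
    (fun u hu => by rw [← hq]; exact (Finset.mem_filter.1 hu).2)
  have h3 : l.toFinset ⊆ (l.toFinset.filter fun u => I.lab u = p) ∪
      l.toFinset.filter fun u => I.lab u = q := by
    intro u hu
    have := (hst u (by simpa using hu)).2
    simp only [Finset.mem_union, Finset.mem_filter]
    tauto
  have h4 := (Finset.card_le_card h3).trans (Finset.card_union_le _ _)
  rw [List.toFinset_card_of_nodup hnd] at h4
  rw [pieceLists, List.length_map, ← hl]
  omega

end Pieces

theorem dom_activeText {m n k l : ℕ} {P T : Str} {Q : Finset Point} {φ ψ : Point}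
    (hc : Candidates m n k P T Q) (h : Inst.Valid ⟨m, n, l, φ, ψ, T, Q⟩) (u : Point) :
    u ∈ (P.activeText T Q).dom ↔ Inst.Act ⟨m, n, l, φ, ψ, T, Q⟩ u := by
  have hmem : u ∈ (⋃ q ∈ Q, (P.shift q).dom) ↔ Inst.Act ⟨m, n, l, φ, ψ, T, Q⟩ u := by
    simp only [Set.mem_iUnion, exists_prop]
    exact exists_congr fun q => and_congr_right fun _ => hc.mem_shift_dom q u
  rw [← hmem]
  constructor
  · rintro ⟨a, ha⟩
    simp only [Str.activeText, Str.restrict] at ha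
    split_ifs at ha with hu
    exact hu
  · intro hu
    refine ⟨Inst.col ⟨m, n, l, φ, ψ, T, Q⟩ u, ?_⟩
    simp only [Str.activeText, Str.restrict]
    rw [if_pos hu]
    exact h.text_eq_of_act (hmem.1 hu)

theorem activeText_apply {P T : Str} {Q : Finset Point} {u : Point}
    (hu : u ∈ (P.activeText T Q).dom) : P.activeText T Q u = T u := by
  obtain ⟨a, ha⟩ := hu
  simp only [Str.activeText, Str.restrict] at ha ⊢
  split_ifs at ha ⊢
  rfl

theorem mainTheorem4 (C₀ : ℝ) :
    ∃ (prog : RamProg) (C c : ℕ),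
      ∀ (w m n k l : ℕ) (P T : Str) (Q : Finset Point) (φ ψ : Point),
        0 < l →
        Candidates m n k P T Q →
        BasisPair C₀ m n Q φ ψ →
        (n + k + l) ^ c ≤ 2 ^ w →
        P.FitsWord w → T.FitsWord w →
        ∀ (LP LT : List (Point × ℤ)) (LQ : List Point),
          Represents LP P → Represents LT T → LQ.Nodup → LQ.toFinset = Q →
          ∃ (t : ℕ) (s : RamState w) (LF : List (Point × ℤ)) (LS : List (List (Point × ℤ)))
            (F : Str) (S : List Str),
            RamExec prog (RamState.init (inputWords w m n k l φ ψ LP LT LQ)) t s ∧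
            t ≤ C * (m ^ 2 + l ^ 2 + l * k) * (Nat.log 2 (m ^ 2 + l ^ 2 + l * k) + 1) ^ c ∧
            s.HasOutput (stringWords w LF ++ stringListWords w LS) ∧
            Represents LF F ∧ List.Forall₂ Represents LS S ∧
            (P.activeText T Q).IsPartitionedInto (F :: S) ∧
            S.length ≤ C * (l * k) ∧
            (∀ R ∈ S, R.IsMonochromatic ∧ R.IsSubtileString φ ψ) ∧
            Str.IsPeripheral (P.activeText T Q) (C * ((m : ℝ) / l)) F := by
  -- The time is at most `60100 n ^ 2 ≤ 200000 m ^ 2`, the number of pieces at most `(3200 + 392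
  -- ⌈C₀⌉₊) l k`; the exponent 10 serves the word size.
  refine ⟨partitionProgram, 200000 + 400 * ⌈C₀⌉₊, 10, ?_⟩
  intro w m n k l P T Q φ ψ hl hc hb hw hP hT LP LT LQ hLP hLT hnd hLQ
  obtain ⟨tb, qb, hctx⟩ := ctx_of_input hl hc hb hw hT hLP hLT hnd hLQ
  set I : Inst := ⟨m, n, l, φ, ψ, T, Q⟩ with hI
  have hv : I.Valid := hctx.valid
  obtain ⟨t, s, FA, GA, FB, GB, hexec, ht, hA, hB, hout⟩ :=
    exec_partitionProgram (I := I) hctx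
  set SA := pieceLists I I.ψ I.φ FA GA 1 4 with hSA
  set SB := pieceLists I I.φ I.ψ FB GB 2 3 with hSB
  have hrest : ∀ u c, (u, c) ∈ restList I → T u = some c := by
    intro u c hu
    obtain ⟨⟨h1, -⟩, rfl⟩ := (mem_restList hv).1 hu
    exact hv.text_eq_of_act h1
  have htA : ∀ L ∈ SA, ∀ u c, (u, c) ∈ L → T u = some c := fun L hL => text_of_piece hv hA hL
  have htB : ∀ L ∈ SB, ∀ u c, (u, c) ∈ L → T u = some c := fun L hL => text_of_piece hv hB hL
  have hlabA : ∀ L ∈ SA, ∀ u ∈ (strOf T L).dom,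
      I.Act u ∧ (I.lab u = 1 ∨ I.lab u = 4) := by
    intro L hL u hu
    obtain ⟨c, hc'⟩ := (mem_dom_strOf (htA L hL)).1 hu
    obtain ⟨v, hv', rfl⟩ := (mem_pieceLists hv).1 hL
    obtain ⟨h1, h2, -⟩ := piece_point hv hA hv' hc'
    exact ⟨h1, h2⟩
  have hlabB : ∀ L ∈ SB, ∀ u ∈ (strOf T L).dom,
      I.Act u ∧ (I.lab u = 2 ∨ I.lab u = 3) := by
    intro L hL u hu
    obtain ⟨c, hc'⟩ := (mem_dom_strOf (htB L hL)).1 hu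
    obtain ⟨v, hv', rfl⟩ := (mem_pieceLists hv).1 hL
    obtain ⟨h1, h2, -⟩ := piece_point hv hB hv' hc'
    exact ⟨h1, h2⟩
  have hlabF : ∀ u, u ∈ (strOf T (restList I)).dom ↔ I.Act u ∧ I.lab u = 0 := by
    intro u
    rw [mem_dom_strOf hrest]
    simp only [mem_restList hv, exists_and_left, exists_eq, and_true]
  have hact := dom_activeText (k := k) (l := l) (φ := φ) (ψ := ψ) hc hv
  refine ⟨t, s, restList I, SA ++ SB, strOf T (restList I), (SA ++ SB).map (strOf T), ?_, ?_, hout,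
    represents_strOf (restList_nodup I) hrest, ?_, ⟨?_, ?_, ?_⟩, ?_, ?_, ?_⟩
  · rw [inputWords_eq]
    exact hexec
  · have h1 : 4 * n ^ 2 ≤ 9 * m ^ 2 := by
      have := Nat.pow_le_pow_left hc.n_le 2
      nlinarith
    have h2 : t ≤ 60100 * n ^ 2 := ht
    -- No logarithm is needed: the polylogarithmic factor is only used to be at least 1.
    have h3 : 1 ≤ (Nat.log 2 (m ^ 2 + l ^ 2 + l * k) + 1) ^ 10 := Nat.one_le_pow _ _ (by omega)
    calc t ≤ 200000 * m ^ 2 := by omega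
      _ ≤ (200000 + 400 * ⌈C₀⌉₊) * (m ^ 2 + l ^ 2 + l * k) :=
        Nat.mul_le_mul (by omega) (by rw [add_assoc]; exact Nat.le_add_right _ _)
      _ ≤ _ := Nat.le_mul_of_pos_right _ h3
  · rw [List.forall₂_map_right_iff]
    refine List.forall₂_same.2 fun L hL => ?_
    rcases List.mem_append.1 hL with hL | hL
    · exact represents_strOf (pieceLists_nodup hv hA hL) (htA L hL)
    · exact represents_strOf (pieceLists_nodup hv hB hL) (htB L hL)
  · intro u
    rw [hact]
    simp only [List.mem_cons, List.mem_map, List.mem_append, exists_eq_or_imp, hlabF]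
    constructor
    · intro hu
      by_cases h0 : I.lab u = 0
      · exact .inl ⟨hu, h0⟩
      · right
        have hr := Ctx.lab_range (I := I) u
        by_cases h14 : I.lab u = 1 ∨ I.lab u = 4
        · obtain ⟨L, hL, hm⟩ := mem_piece_of_lab hv hA h0 h14
          exact ⟨_, ⟨L, .inl hL, rfl⟩, hm⟩
        · obtain ⟨L, hL, hm⟩ := mem_piece_of_lab (p := 2) (q := 3) hv hB h0 (by omega)
          exact ⟨_, ⟨L, .inr hL, rfl⟩, hm⟩
    · rintro (hu | ⟨_, ⟨L, hL | hL, rfl⟩, hu⟩)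
      · exact hu.1
      · exact (hlabA L hL u hu).1
      · exact (hlabB L hL u hu).1
  · rw [List.pairwise_cons, List.map_append, List.pairwise_append]
    refine ⟨?_, pieceLists_pairwise hv hA, pieceLists_pairwise hv hB, ?_⟩
    · intro R hR
      rw [Set.disjoint_left]
      intro u hu hu'
      have h0 := ((hlabF u).1 hu).2
      obtain hR | hR := List.mem_append.1 hR <;> obtain ⟨L, hL, rfl⟩ := List.mem_map.1 hR
      · have := (hlabA L hL u hu').2
        omega
      · have := (hlabB L hL u hu').2
        omega
    · intro R hR R' hR'
      obtain ⟨L, hL, rfl⟩ := List.mem_map.1 hR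
      obtain ⟨L', hL', rfl⟩ := List.mem_map.1 hR'
      rw [Set.disjoint_left]
      intro u hu hu'
      have h1 := (hlabA L hL u hu).2
      have h2 := (hlabB L' hL' u hu').2
      omega
  · intro R hR u hu
    have key : ∀ L, R = strOf T L → I.Act u → R u = P.activeText T Q u := by
      rintro L rfl ha
      rw [strOf_apply hu, activeText_apply ((hact u).2 ha)]
    rcases List.mem_cons.1 hR with rfl | hR
    · exact key _ rfl ((hlabF u).1 hu).1
    · obtain ⟨L, hL, rfl⟩ := List.mem_map.1 hR
      refine key L rfl ?_
      rcases List.mem_append.1 hL with hL | hL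
      · exact (hlabA L hL u hu).1
      · exact (hlabB L hL u hu).1
  · have hMφ := hc.mismatchBound l φ ψ hb.phi_diff
    have hMψ := hc.mismatchBound l φ ψ hb.psi_diff
    have hQ : I.Q.Nonempty := hc.nonempty
    have p1 := hv.phi1
    have p2 := hv.phi2
    have p3 := hv.psi1
    have p4 := hv.psi2
    have hD : I.D.toNat ≤ ⌈C₀⌉₊ * k := hb.D_le hc
    -- Both coordinates of `ψ` are non-negative, so it points inward in quadrant 1 and outward in
    -- quadrant 4; `φ`, with signs (+,-), points outward in quadrant 2 and inward in quadrant 3.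
    have h1 := length_pieceLists_le hv hQ (Inst.frame_psi hv) hMψ hMφ hA (sx := -1) (sy := -1)
      (sx' := 1) (sy' := 1) (.inr rfl) (.inr rfl) (.inl rfl) (.inl rfl)
      (.inr ⟨by omega, by omega⟩) (.inl ⟨by omega, by omega⟩)
      (p := 1) (q := 4) (by norm_num [Inst.code]) (by norm_num [Inst.code])
    have h2 := length_pieceLists_le hv hQ (Inst.frame_phi hv) hMφ hMψ hB (sx := 1) (sy := -1)
      (sx' := -1) (sy' := 1) (.inl rfl) (.inr rfl) (.inr rfl) (.inl rfl)
      (.inl ⟨by omega, by omega⟩) (.inr ⟨by omega, by omega⟩)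
      (p := 2) (q := 3) (by norm_num [Inst.code]) (by norm_num [Inst.code])
    have h3 : 98 * I.l * I.D.toNat ≤ 98 * l * (⌈C₀⌉₊ * k) := Nat.mul_le_mul_left _ hD
    have h4 : 98 * I.l * I.D.toNat + 100 * I.l * (8 * k) ≤
        98 * l * (⌈C₀⌉₊ * k) + 100 * l * (8 * k) := Nat.add_le_add_right h3 _
    rw [List.length_map, List.length_append]
    calc SA.length + SB.length
        ≤ 4 * (98 * l * (⌈C₀⌉₊ * k) + 100 * l * (8 * k)) := by linarith
      _ = (3200 + 392 * ⌈C₀⌉₊) * (l * k) := by ring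
      _ ≤ _ := Nat.mul_le_mul_right _ (by omega)
  · intro R hR
    obtain ⟨L, hL, rfl⟩ := List.mem_map.1 hR
    have hD : 0 < φ.cross ψ := by
      have := hb.D_pos
      unfold Point.cross
      linarith
    rcases List.mem_append.1 hL with hL | hL
    · refine ⟨piece_isMonochromatic hv hA hL, ?_⟩
      obtain ⟨u, hu, rfl⟩ := (mem_pieceLists hv).1 hL
      unfold Str.IsSubtileString
      rw [show (strOf T _).dom = _ from dom_piece hv hA hu]
      exact isSubtile_parallelogram hD _ _ _
    · refine ⟨piece_isMonochromatic hv hB hL, ?_⟩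
      obtain ⟨u, hu, rfl⟩ := (mem_pieceLists hv).1 hL
      unfold Str.IsSubtileString
      rw [show (strOf T _).dom = _ from dom_piece hv hB hu, parallelogram_comm]
      exact isSubtile_parallelogram hD _ _ _
  · intro u hu
    obtain ⟨v, hna, hlen⟩ := hv.exists_near ((hlabF u).1 hu).2
    refine (borderDist_le fun hm => hna ((hact v).1 hm)).trans (hlen.trans ?_)
    have h0 : (0 : ℝ) ≤ (m : ℝ) / l := by positivity
    have h1 : (1 : ℝ) ≤ ((200000 + 400 * ⌈C₀⌉₊ : ℕ) : ℝ) := by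
      exact_mod_cast (by omega)
    exact le_mul_of_one_le_left h0 h1
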